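/- **Notation.** Let $\{\Phi_e\}_{e\in\mathbb N}$ be an effective enumeration of all Turing functionals on $\mathbb N^{\mathbb N}$. A *learner* is a total computable function $\Psi:\mathbb N^{<\mathbb N}\to\mathbb N$. A partial function $\Gamma:\subseteq\mathbb N^{\mathbb N}\to\mathbb N^{\mathbb N}$ is *$(<\omega,\omega)$-computable* (learnable by a team) if there are finitely many learners $\Psi_0,\dots,\Psi_{b-1}$ such that for every $g\in\mathrm{dom}(\Gamma)$ there is $i<b$ for which $e=\lim_n\Psi_i(g\restriction n)$ exists and $\Phi_e(g)=\Gamma(g)$. It is *$(\omega,1)$-computable* (nonuniformly computable) if $\Gamma(g)\le_T g$ for every $g\in\mathrm{dom}(\Gamma)$. For $P,Q\subseteq\mathbb N^{\mathbb N}$ write $P\le^{<\omega}_{\omega}Q$ (respectively $P\le^{\omega}_{1}Q$) if some $(<\omega,\omega)$-computable (respectively $(\omega,1)$-computable) $\Gamma$ is defined on all of $Q$ and maps $Q$ into $P$; let $<$ and $\equiv$ denote the associated strict relation and equivalence. For $I\subseteq\mathbb N$ and $f\in(I\times\mathbb N)^{\mathbb N}$ (viewed as a point of $\mathbb N^{\mathbb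 N}$ through a computable pairing function), let $\mathrm{pr}_i(f\restriction n)$ be the string of second coordinates of those entries of $f\restriction n$ whose first coordinate is $i$, and let $\mathrm{pr}_i(f)=\bigcup_n\mathrm{pr}_i(f\restriction n)$. Let $P_i=[T_i]$, where $T_i\subseteq 2^{<\mathbb N}$ is a computable tree (the tree corresponding to $P_i$). The *consistent classical disjunction* $[\bigvee_{CL}]_{i\in I}P_i$ is the set of all $f\in(I\times\mathbb N)^{\mathbb N}$ such that $\mathrm{pr}_i(f)\in P_i$ for some $i\in I$, and $\mathrm{pr}_i(f\restriction n)\in T_i$ for all $i\in I$ and $n\in\mathbb N$. For $I=\{0,\dots,t\}$ it is written $P_0\vee_{CL}\cdots\vee_{CL}P_t$. Let $\bigoplus_nP_n=\{\langle n\rangle^\frown f: n\in\mathbb N,\ f\in P_n\}$. Let $\mathsf{CPA}\subseteq 2^{\mathbb N}$ be the $\Pi^0_1$ set of (characteristic functions, with respect to a fixed effective Gödel numbering of the sentences, of) complete consistent extensions of Peano arithmetic, let $T_{\mathsf{CPA}}\subseteq 2^{<\mathbb N}$ be a computable tree with $[T_{\mathsf{CPA}}]=\mathsf{CPA}$, and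 let $\rho_n$ be its $n$-th leaf in the length-lexicographic order. The *recursive meet* of $\{Q_n\}_{n\in\mathbb N}$ is $\bigsqcap_nQ_n=\mathsf{CPA}\cup\bigcup_n\rho_n{}^\frown Q_n$. A sequence $\{P_n\}_{n\in\mathbb N}$ of $\Pi^0_1$ subsets of $2^{\mathbb N}$ is *computable* if $P_n=[T_n]$ for a uniformly computable sequence of trees $T_n\subseteq 2^{<\mathbb N}$. **Statement.** (1) There is a computable sequence $\{P_n\}_{n\in\mathbb N}$ of nonempty $\Pi^0_1$ subsets of $2^{\mathbb N}$ such that, for every uniformly computable sequence of trees $T_n\subseteq 2^{<\mathbb N}$ with $[T_n]=P_n$ (used to form the disjunctions): (a) for every computable tree $T_{\mathsf{CPA}}$ as above, $$\textstyle\bigsqcap_t\,(P_0\vee_{CL}\cdots\vee_{CL}P_t)\;<^{<\omega}_{\omega}\;\bigsqcap_tP_t;$$ (b) $\;[\bigvee_{CL}]_{n\in\mathbb N}P_n<^{<\omega}_{\omega}\bigoplus_nP_n$. (2) There are nonempty $\Pi^0_1$ sets $P,Q\subseteq 2^{\mathbb N}$ with $P\equiv^{\omega}_{1}Q$ and $P<^{<\omega}_{\omega}Q$.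 -/

import Mathlib

open Filter FirstOrder

namespace MassProblem

/-! ### Strings, points of Baire space, trees -/

/-- Baire space `ℕ^ℕ`. A mass problem is a subset of it. -/
abbrev Baire : Type := ℕ → ℕ

/-- The initial segment `f ↾ n` of length `n`. -/
def initSeg (f : Baire) (n : ℕ) : List ℕ := (List.range n).map f

/-- The concatenation `σ ⌢ f` of a finite string and a point of Baire space. -/
def concat (σ : List ℕ) (f : Baire) : Baire := fun n => σ.getD n (f (n - σ.length))

/-- `T` is a binary tree: a set of `0`-`1`-strings closed under initial segments. -/
def IsBinaryTree (T : Set (List ℕ)) : Prop :=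
  (∀ σ ∈ T, ∀ x ∈ σ, x < 2) ∧ ∀ σ ∈ T, ∀ τ, τ <+: σ → τ ∈ T

/-- The set `[T]` of infinite paths of `T`. -/
def paths (T : Set (List ℕ)) : Set Baire := {f | ∀ n, initSeg f n ∈ T}

/-- `T` is a computable binary tree. -/
def IsComputableTree (T : Set (List ℕ)) : Prop :=
  IsBinaryTree T ∧ ComputablePred fun σ : List ℕ => σ ∈ T

/-- `(T n)` is a (uniformly) computable sequence of binary trees. -/
def IsComputableTreeSeq (T : ℕ → Set (List ℕ)) : Prop :=
  (∀ n, IsBinaryTree (T n)) ∧ ComputablePred fun p : ℕ × List ℕ => p.2 ∈ T p.1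

/-- `P` is a `Π⁰₁` subset of Cantor space `2^ℕ`. -/
def IsPi01 (P : Set Baire) : Prop := ∃ T, IsComputableTree T ∧ paths T = P

/-- `(P n)` is a computable (that is, uniform) sequence of `Π⁰₁` subsets of Cantor space. -/
def IsPi01Seq (P : ℕ → Set Baire) : Prop :=
  ∃ T, IsComputableTreeSeq T ∧ ∀ n, paths (T n) = P n

/-! ### Turing functionals, learners, and reducibilities -/

/-- The value `Φ_e(g; n)` of the `e`-th Turing functional with oracle `g` on input `n`. A stage `m`
codes a pair `(s, k)`; at this stage the `e`-th program is run for `k` steps on the finite oracle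
string `g ↾ s` and the input `n`. The value is the result of the first stage that has one. -/
def functional (e : ℕ) (g : Baire) (n : ℕ) : Part ℕ :=
  Nat.rfindOpt fun m =>
    Nat.Partrec.Code.evaln m.unpair.2 (Nat.Partrec.Code.ofNatCode e)
      (Nat.pair (Encodable.encode (initSeg g m.unpair.1)) n)

/-- `Φ_e(g)` is total and equal to `h`. -/
def Computes (e : ℕ) (g h : Baire) : Prop := ∀ n, h n ∈ functional e g n

/-- The partial function `Γ` is identified by the learner `Ψ` on `g`: `g` is in the domain of `Γ`,
`lim_n Ψ(g ↾ n)` exists, and it is an index `e` with `Φ_e(g) = Γ(g)`. -/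
def IdentifiedOn (Γ : Baire →. Baire) (Ψ : List ℕ → ℕ) (g : Baire) : Prop :=
  ∃ h ∈ Γ g, ∃ e, (∀ᶠ n in atTop, Ψ (initSeg g n) = e) ∧ Computes e g h

/-- `(<ω, ω)`-computability: `Γ` is learnable by a team, that is, there are finitely many computable
learners such that, on every `g` in its domain, `Γ` is identified by one of them. -/
def TeamLearnable (Γ : Baire →. Baire) : Prop :=
  ∃ (b : ℕ) (Ψ : Fin b → List ℕ → ℕ), (∀ i, Computable (Ψ i)) ∧
    ∀ g ∈ Γ.Dom, ∃ i, IdentifiedOn Γ (Ψ i) g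

/-- `(ω, 1)`-computability: `Γ` is nonuniformly computable, that is, `Γ(g) ≤_T g` for every `g` in
its domain. -/
def NonuniformlyComputable (Γ : Baire →. Baire) : Prop :=
  ∀ g, ∀ h ∈ Γ g, TuringReducible (h : ℕ →. ℕ) (g : ℕ →. ℕ)

/-- `P ≤_𝓕 Q`: some partial function in the class `𝓕` is defined on all of `Q` and maps it
into `P`. -/
def ReducibleVia (𝓕 : (Baire →. Baire) → Prop) (P Q : Set Baire) : Prop :=
  ∃ Γ : Baire →. Baire, 𝓕 Γ ∧ ∀ g ∈ Q, ∃ h ∈ Γ g, h ∈ P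

/-- `P <_𝓕 Q`. -/
def StrictlyBelowVia (𝓕 : (Baire →. Baire) → Prop) (P Q : Set Baire) : Prop :=
  ReducibleVia 𝓕 P Q ∧ ¬ ReducibleVia 𝓕 Q P

/-- `P ≡_𝓕 Q`. -/
def EquivalentVia (𝓕 : (Baire →. Baire) → Prop) (P Q : Set Baire) : Prop :=
  ReducibleVia 𝓕 P Q ∧ ReducibleVia 𝓕 Q P

/-! ### Disjunctions -/

/-- The `i`-th projection `pr_i(σ)`: the string written on tape `i` by the record `σ`, whose
letters are pairs `⟨i, k⟩` (write `k` on tape `i`) coded by `Nat.pair`. -/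
def proj (i : ℕ) (σ : List ℕ) : List ℕ :=
  (σ.filter fun x => x.unpair.1 = i).map fun x => x.unpair.2

/-- `pr_i(f) = h` for an infinite record `f`, where `pr_i(f)` is the union of the `pr_i(f ↾ n)`
and `h` is an infinite sequence. -/
def ProjEq (i : ℕ) (f h : Baire) : Prop := ∀ k, ∃ n, initSeg h k <+: proj i (initSeg f n)

/-- The elements of `(I × ℕ)^ℕ`, as points of Baire space. -/
def records (I : Set ℕ) : Set Baire := {f | ∀ n, (f n).unpair.1 ∈ I}

/-- The classical disjunction: the records `f` with `pr_i(f) ∈ P_i` for some `i ∈ I`. -/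
def disjCL (I : Set ℕ) (P : ℕ → Set Baire) : Set Baire :=
  {f ∈ records I | ∃ i ∈ I, ∃ h ∈ P i, ProjEq i f h}

/-- The consistency set: on no tape in `I` does the record ever leave the tree of this tape. -/
def consistencySet (I : Set ℕ) (T : ℕ → Set (List ℕ)) : Set Baire :=
  {f ∈ records I | ∀ i ∈ I, ∀ n, proj i (initSeg f n) ∈ T i}

/-- The consistent classical disjunction `[∨_CL]_{i ∈ I} P_i` of the sets `P_i = [T_i]`, where `T_i`
is the tree corresponding to `P_i`. -/
def consistentDisjCL (I : Set ℕ) (T : ℕ → Set (List ℕ)) : Set Baire :=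
  disjCL I (fun i => paths (T i)) ∩ consistencySet I T

/-- The coproduct `⨁_n P_n`: the set of all `⟨n⟩ ⌢ f` with `f ∈ P_n`. -/
def coproduct (P : ℕ → Set Baire) : Set Baire := {f | ∃ n, ∃ g ∈ P n, f = concat [n] g}

/-! ### Infinitary concatenation -/

/-- The leaves (dead ends) of a tree. -/
def leaves (T : Set (List ℕ)) : Set (List ℕ) := {σ ∈ T | ∀ τ ∈ T, σ <+: τ → τ = σ}

/-- `σ` is the `n`-th leaf of the binary tree `T` in the length-lexicographic order, counting
from `0`. -/
def IsNthLeaf (T : Set (List ℕ)) (n : ℕ) (σ : List ℕ) : Prop :=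
  σ ∈ leaves T ∧ {τ ∈ leaves T | List.Shortlex (· < ·) τ σ}.ncard = n

/-- The infinitary concatenation `[T] ∪ ⋃_n ρ_n ⌢ Q_n`, where `ρ_n` is the `n`-th leaf of `T`. -/
def infConcat (T : Set (List ℕ)) (Q : ℕ → Set Baire) : Set Baire :=
  paths T ∪ {f | ∃ n ρ, IsNthLeaf T n ρ ∧ ∃ g ∈ Q n, f = concat ρ g}

/-! ### Peano arithmetic and its complete consistent extensions -/

/-- The function symbols `0`, `S`, `+`, `·` of first-order arithmetic. -/
inductive PeanoFunc : ℕ → Type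
  | zero : PeanoFunc 0
  | succ : PeanoFunc 1
  | add : PeanoFunc 2
  | mul : PeanoFunc 2

/-- The language of first-order arithmetic. -/
abbrev arith : FirstOrder.Language.{0, 0} where
  Functions := PeanoFunc
  Relations := fun _ => Empty

/-- The term `0`. -/
def tZero {α : Type} : arith.Term α :=
  FirstOrder.Language.Term.func (L := arith) PeanoFunc.zero ![]

/-- The term `S t`. -/
def tSucc {α : Type} (t : arith.Term α) : arith.Term α :=
  FirstOrder.Language.Term.func (L := arith) PeanoFunc.succ ![t]

/-- The term `s + t`. -/
def tAdd {α : Type} (s t : arith.Term α) : arith.Term α :=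
  FirstOrder.Language.Term.func (L := arith) PeanoFunc.add ![s, t]

/-- The term `s · t`. -/
def tMul {α : Type} (s t : arith.Term α) : arith.Term α :=
  FirstOrder.Language.Term.func (L := arith) PeanoFunc.mul ![s, t]

/-- A formula whose variables are `x_0, …, x_{n-1}`, read as one whose variables can be
quantified (the last one first). -/
def toBounded {n : ℕ} (φ : arith.Formula (Fin n)) : arith.BoundedFormula Empty n :=
  FirstOrder.Language.BoundedFormula.relabel (Sum.inr : Fin n → Empty ⊕ Fin n) φ

/-- The variable `x_i`. -/
def pvar {n : ℕ} (i : Fin n) : arith.Term (Fin n) := FirstOrder.Language.Term.var i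

/-- The result `φ(x, t)` of substituting the variables `x` for all variables of `φ` but the last and
the term `t` for the last one. -/
def substLast {n m : ℕ} (φ : arith.Formula (Fin (n + 1))) (x : Fin n → Fin m)
    (t : arith.Term (Fin m)) : arith.Formula (Fin m) :=
  φ.subst (Fin.snoc (α := fun _ => arith.Term (Fin m)) (fun i => pvar (x i)) t)

/-- The induction axiom for the formula `φ(x, y)`, where `x = (x_0, …, x_{n-1})` are parameters:
`∀ x, φ(x, 0) → (∀ y, φ(x, y) → φ(x, S y)) → ∀ y, φ(x, y)`. -/
def inductionAxiom {n : ℕ} (φ : arith.Formula (Fin (n + 1))) : arith.Sentence :=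
  ((toBounded (substLast φ id tZero)).imp
    ((toBounded (φ.imp (substLast φ Fin.castSucc (tSucc (pvar (Fin.last n)))))).all.imp
      (toBounded φ).all)).alls

/-- The axioms of first-order Peano arithmetic. -/
inductive IsPeanoAxiom : arith.Sentence → Prop
  | succ_ne_zero : IsPeanoAxiom (toBounded (n := 1) ((tSucc (pvar 0)).equal tZero).not).alls
  | succ_inj : IsPeanoAxiom (toBounded (n := 2)
      (((tSucc (pvar 0)).equal (tSucc (pvar 1))).imp ((pvar 0).equal (pvar 1)))).alls
  | add_zero : IsPeanoAxiom (toBounded (n := 1) ((tAdd (pvar 0) tZero).equal (pvar 0))).alls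
  | add_succ : IsPeanoAxiom (toBounded (n := 2)
      ((tAdd (pvar 0) (tSucc (pvar 1))).equal (tSucc (tAdd (pvar 0) (pvar 1))))).alls
  | mul_zero : IsPeanoAxiom (toBounded (n := 1) ((tMul (pvar 0) tZero).equal tZero)).alls
  | mul_succ : IsPeanoAxiom (toBounded (n := 2)
      ((tMul (pvar 0) (tSucc (pvar 1))).equal (tAdd (tMul (pvar 0) (pvar 1)) (pvar 0)))).alls
  | induction {n : ℕ} (φ : arith.Formula (Fin (n + 1))) : IsPeanoAxiom (inductionAxiom φ)

/-- First-order Peano arithmetic. -/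
def PA : arith.Theory := {φ | IsPeanoAxiom φ}

/-- Gödel numbers of terms. -/
def termCode {n : ℕ} : arith.Term (Empty ⊕ Fin n) → ℕ
  | .var (.inr i) => Nat.pair 0 i
  | .func PeanoFunc.zero _ => Nat.pair 1 0
  | .func PeanoFunc.succ ts => Nat.pair 2 (termCode (ts 0))
  | .func PeanoFunc.add ts => Nat.pair 3 (Nat.pair (termCode (ts 0)) (termCode (ts 1)))
  | .func PeanoFunc.mul ts => Nat.pair 4 (Nat.pair (termCode (ts 0)) (termCode (ts 1)))

/-- Gödel numbers of formulas. -/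
def formulaCode : {n : ℕ} → arith.BoundedFormula Empty n → ℕ
  | _, .falsum => Nat.pair 0 0
  | _, .equal s t => Nat.pair 1 (Nat.pair (termCode s) (termCode t))
  | _, .imp φ ψ => Nat.pair 2 (Nat.pair (formulaCode φ) (formulaCode ψ))
  | _, .all φ => Nat.pair 3 (formulaCode φ)

/-- The set `CPA` of all (characteristic functions of sets of Gödel numbers of) complete consistent
extensions of Peano arithmetic. -/
def CPA : Set Baire :=
  {f | ∃ T : arith.Theory, PA ⊆ T ∧ T.IsMaximal ∧
    ∀ m, (f m = 1 ∧ ∃ φ ∈ T, formulaCode φ = m) ∨ (f m = 0 ∧ ¬ ∃ φ ∈ T, formulaCode φ = m)}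

end MassProblem

open MassProblem

namespace MassProblem

/-! ### Computable functions on lists and computable predicates -/

section Computability

variable {α β σ : Type*} [Primcodable α] [Primcodable β] [Primcodable σ]

/-! Consider a computable enumeration of bits of a 0-1 matrix, and let P_n be the class of all
completions of its n-th column. A finite injury argument (`exists_independent_matrix`) produces such
an enumeration together with a completion ζ of the whole matrix, so that no member of P_n is
computable from ζ with its n-th column erased. The P_n are separating classes, so every complete
consistent extension of PA computes a member of each of them: a Rosser sentence separates the values
1 and 0 of a partial recursive function in every model of PA (`exists_separation_CPA`).

The reductions from the disjunctions to the sums are uniform: a given member of P_n is written on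
tape n. All failures of reducibility come from `no_team`. Suppose that b learners are given. They
are fed records that copy columns 0, …, b of ζ onto b + 1 tapes. Such a record is consistent, and
some tape receives a whole column, so it is an admissible input. A proposed solution either commits
to a leaf ρ_n (or to a tag n), and then computes a member of P_n, or it computes members of all P_m.
If a learner is stable above some finite record, its guess is a fixed program. Either this program
commits to some ρ_n on an extension, and then tape n is never used again, or it never commits. In
both cases a correct solution would have to compute a member of some P_n from columns other than n,
so the learner is dead (`exists_dead`). Each death costs at most one tape, so at least one tape
survives. Once every living learner can always be made to change its mind, a generic record makes
all of them diverge (`exists_generic`, `false_of_dense`). This record is built computably from the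
remaining columns, because deadness only concerns such records.

For the recursive meets the inputs are placed above the b-th leaf, where b + 1 tapes are available.
There are infinitely many leaves because the tree has no computable path (`infinite_leaves_of_red`).

For the second part, the class of completions of the whole matrix replaces CPA, and records are
coded by binary sequences in unary (`codeTree`). With finitely many tapes and infinite records,
consistency alone forces some tape to be infinite. A code therefore computes a member of some P_i,
which can be placed after the i-th leaf. This gives the nonuniform equivalence, while the failure
for teams is as before. -/

theorem computable_foldl {f : α → List β} {g : α → σ} {h : α → σ × β → σ} (hf : Computable f)
    (hg : Computable g) (hh : Computable₂ h) :
    Computable fun a => (f a).foldl (fun s b => h a (s, b)) (g a) := by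
  -- The fold becomes a primitive recursion on the index, with the list read by lookup.
  have key : Computable fun a => Nat.rec (motive := fun _ => σ) (g a)
      (fun y IH => ((f a)[y]?).elim IH fun b => h a (IH, b)) (f a).length := by
    refine Computable.nat_rec (h := fun (a : α) (p : ℕ × σ) =>
      ((f a)[p.1]?).elim p.2 fun b => h a (p.2, b)) (Computable.list_length.comp hf) hg ?_
    refine (Computable.option_casesOn
      (o := fun p : α × ℕ × σ => (f p.1)[p.2.1]?) (f := fun p => p.2.2)
      (g := fun p b => h p.1 (p.2.2, b)) ?_ ?_ ?_).of_eq fun p => ?_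
    · exact Computable.list_getElem?.comp (hf.comp Computable.fst)
        (Computable.fst.comp Computable.snd)
    · exact Computable.snd.comp Computable.snd
    · exact hh.comp (Computable.fst.comp Computable.fst)
        ((Computable.snd.comp (Computable.snd.comp Computable.fst)).pair Computable.snd)
    · obtain ⟨a, y, s⟩ := p
      cases h : (f a)[y]? <;> simp [h]
  refine key.of_eq fun a => ?_
  have : ∀ l : List β, ∀ s : σ, Nat.rec (motive := fun _ => σ) s
      (fun y IH => (l[y]?).elim IH fun b => h a (IH, b)) l.length =
      l.foldl (fun s b => h a (s, b)) s := by
    intro l s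
    induction l using List.reverseRecOn with
    | nil => rfl
    | append_singleton l b ih =>
      rw [List.foldl_append, ← ih, List.length_append]
      simp only [List.length_singleton, List.foldl_cons, List.foldl_nil]
      have h2 : ∀ n ≤ l.length, Nat.rec (motive := fun _ => σ) s
          (fun y IH => ((l ++ [b])[y]?).elim IH fun b => h a (IH, b)) n =
          Nat.rec (motive := fun _ => σ) s
          (fun y IH => (l[y]?).elim IH fun b => h a (IH, b)) n := by
        intro n hn
        induction n with
        | zero => rfl
        | succ n ihn =>
          simp only [ihn (by omega)]
          rw [List.getElem?_append_left (by omega)]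
      change ((l ++ [b])[l.length]?).elim _ _ = _
      rw [h2 _ le_rfl]
      simp
  exact this _ _

theorem computable_map {f : α → List β} {g : α → β → σ} (hf : Computable f)
    (hg : Computable₂ g) : Computable fun a => (f a).map (g a) := by
  refine (computable_foldl (g := fun _ => ([] : List σ)) (h := fun a p => p.1 ++ [g a p.2]) hf
    (Computable.const []) ?_).of_eq fun a => ?_
  · exact Computable.list_concat.comp (Computable.fst.comp Computable.snd)
      (hg.comp Computable.fst (Computable.snd.comp Computable.snd))
  · have : ∀ (l : List β) (s : List σ), l.foldl (fun s b => s ++ [g a b]) s = s ++ l.map (g a) := by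
      intro l
      induction l with
      | nil => simp
      | cons b l ih => intro s; simp [ih]
    simpa using this (f a) []

theorem computable_flatMap {f : α → List β} {g : α → β → List σ} (hf : Computable f)
    (hg : Computable₂ g) : Computable fun a => (f a).flatMap (g a) := by
  refine ((Primrec.list_flatten (α := σ)).to_comp.comp (computable_map hf hg)).of_eq fun a => ?_
  rw [List.flatMap_def]

theorem _root_.ComputablePred.comp' {p : β → Prop} {f : α → β} (hp : ComputablePred p)
    (hf : Computable f) : ComputablePred fun a => p (f a) := by
  obtain ⟨d, hp⟩ := hp
  exact ⟨fun a => d (f a), hp.comp hf⟩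

theorem _root_.ComputablePred.and' {p q : α → Prop} (hp : ComputablePred p)
    (hq : ComputablePred q) : ComputablePred fun a => p a ∧ q a := by
  obtain ⟨d, hp⟩ := hp
  obtain ⟨d', hq⟩ := hq
  refine ⟨fun a => inferInstance, ?_⟩
  exact ((Primrec.and.to_comp).comp hp hq).of_eq fun a => by simp

theorem _root_.ComputablePred.or' {p q : α → Prop} (hp : ComputablePred p)
    (hq : ComputablePred q) : ComputablePred fun a => p a ∨ q a := by
  obtain ⟨d, hp⟩ := hp
  obtain ⟨d', hq⟩ := hq
  refine ⟨fun a => inferInstance, ?_⟩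
  exact ((Primrec.or.to_comp).comp hp hq).of_eq fun a => by simp

theorem _root_.ComputablePred.imp' {p q : α → Prop} (hp : ComputablePred p)
    (hq : ComputablePred q) : ComputablePred fun a => p a → q a :=
  (hp.not.or' hq).of_eq fun a => by tauto

open Classical in
theorem _root_.ComputablePred.ite' {p : α → Prop} {f g : α → σ} (hp : ComputablePred p)
    (hf : Computable f) (hg : Computable g) : Computable fun a => if p a then f a else g a := by
  obtain ⟨d, hp⟩ := hp
  exact (Computable.cond hp hf hg).of_eq fun a => by by_cases h : p a <;> simp [h]

theorem _root_.ComputablePred.eq' [DecidableEq σ] {f g : α → σ} (hf : Computable f)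
    (hg : Computable g) : ComputablePred fun a => f a = g a := by
  refine ⟨fun a => inferInstance, ?_⟩
  exact ((Primrec.eq (α := σ)).decide.to_comp).comp hf hg

theorem _root_.ComputablePred.lt' {f g : α → ℕ} (hf : Computable f)
    (hg : Computable g) : ComputablePred fun a => f a < g a := by
  refine ⟨fun a => inferInstance, ?_⟩
  exact (Primrec.nat_lt.decide.to_comp).comp hf hg

theorem _root_.ComputablePred.le' {f g : α → ℕ} (hf : Computable f)
    (hg : Computable g) : ComputablePred fun a => f a ≤ g a := by
  refine ⟨fun a => inferInstance, ?_⟩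
  exact (Primrec.nat_le.decide.to_comp).comp hf hg

theorem _root_.ComputablePred.ball_list {p : α → β → Prop} {f : α → List β}
    (hp : ComputablePred fun x : α × β => p x.1 x.2) (hf : Computable f) :
    ComputablePred fun a => ∀ b ∈ f a, p a b := by
  classical
  have : Computable fun a => (f a).foldl (fun s b => s && decide (p a b)) true := by
    refine computable_foldl (h := fun a x => x.1 && decide (p a x.2)) hf (Computable.const true) ?_
    exact (Primrec.and.to_comp).comp (Computable.fst.comp Computable.snd)
      (hp.decide.comp (Computable.fst.pair (Computable.snd.comp Computable.snd)))
  refine ⟨fun a => inferInstance, this.of_eq fun a => ?_⟩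
  have : ∀ (l : List β) (s : Bool), l.foldl (fun s b => s && decide (p a b)) s =
      (s && decide (∀ b ∈ l, p a b)) := by
    intro l
    induction l with
    | nil => simp
    | cons b l ih => intro s; simp [ih, Bool.and_assoc]
  simpa using this (f a) true

theorem _root_.ComputablePred.ball_lt {p : α → ℕ → Prop} {f : α → ℕ}
    (hp : ComputablePred fun x : α × ℕ => p x.1 x.2) (hf : Computable f) :
    ComputablePred fun a => ∀ b < f a, p a b :=
  (hp.ball_list (Primrec.list_range.to_comp.comp hf)).of_eq fun a => by simp

theorem _root_.ComputablePred.bex_lt {p : α → ℕ → Prop} {f : α → ℕ}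
    (hp : ComputablePred fun x : α × ℕ => p x.1 x.2) (hf : Computable f) :
    ComputablePred fun a => ∃ b < f a, p a b :=
  (ComputablePred.ball_lt (p := fun a b => ¬ p a b) hp.not hf).not.of_eq fun a => by simp

theorem computable_take : Computable₂ (List.take : ℕ → List α → List α) :=
  Primrec.list_take.to_comp

theorem computable_drop : Computable₂ (List.drop : ℕ → List α → List α) :=
  Primrec.list_drop.to_comp

theorem computable_getD (d : α) : Computable₂ fun (l : List α) n => l.getD n d :=
  (Primrec.list_getD d).to_comp

theorem computable_pair : Computable₂ Nat.pair := Primrec₂.natPair.to_comp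

theorem computable_unpair_fst : Computable fun n : ℕ => n.unpair.1 :=
  (Primrec.fst.comp Primrec.unpair).to_comp

theorem computable_unpair_snd : Computable fun n : ℕ => n.unpair.2 :=
  (Primrec.snd.comp Primrec.unpair).to_comp

end Computability

/-! ### Initial segments -/

@[simp] theorem length_initSeg (f : Baire) (n : ℕ) : (initSeg f n).length = n := by simp [initSeg]

@[simp] theorem getElem_initSeg (f : Baire) (n k : ℕ) (h : k < (initSeg f n).length) :
    (initSeg f n)[k] = f k := by simp [initSeg]

theorem getD_initSeg (f : Baire) {n k : ℕ} (h : k < n) (d : ℕ) : (initSeg f n).getD k d = f k := by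
  simp [initSeg, h]

theorem getElem?_initSeg (f : Baire) (n k : ℕ) :
    (initSeg f n)[k]? = if k < n then some (f k) else none := by
  split_ifs with h
  · simp [initSeg, h]
  · simp [initSeg]; omega

theorem initSeg_succ (f : Baire) (n : ℕ) : initSeg f (n + 1) = initSeg f n ++ [f n] := by
  simp [initSeg, List.range_succ]

theorem take_initSeg (f : Baire) (k n : ℕ) : (initSeg f n).take k = initSeg f (min k n) := by
  simp [initSeg, ← List.map_take, List.take_range]

theorem initSeg_prefix (f : Baire) {k n : ℕ} (h : k ≤ n) : initSeg f k <+: initSeg f n := by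
  rw [← min_eq_left h, ← take_initSeg]
  exact List.take_prefix _ _

theorem initSeg_add (f : Baire) (k n : ℕ) :
    initSeg f (k + n) = initSeg f k ++ initSeg (fun m => f (k + m)) n := by
  induction n with
  | zero => simp [initSeg]
  | succ n ih => rw [← add_assoc, initSeg_succ, ih, initSeg_succ, List.append_assoc]

/-- `σ` is an initial segment of `f`. -/
def IsInit (σ : List ℕ) (f : Baire) : Prop := initSeg f σ.length = σ

theorem isInit_initSeg (f : Baire) (n : ℕ) : IsInit (initSeg f n) f := by simp [IsInit]

theorem isInit_iff {σ : List ℕ} {f : Baire} : IsInit σ f ↔ ∀ k (h : k < σ.length), σ[k] = f k := by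
  constructor
  · intro h k hk
    have : (initSeg f σ.length)[k]'(by simpa using hk) = σ[k] := by congr 1
    rw [← this, getElem_initSeg]
  · intro h
    refine List.ext_getElem (by simp) fun k h1 h2 => ?_
    rw [getElem_initSeg, h k h2]

theorem isInit_nil (f : Baire) : IsInit [] f := rfl

theorem IsInit.of_prefix {σ τ : List ℕ} {f : Baire} (h : IsInit τ f) (hs : σ <+: τ) :
    IsInit σ f := by
  obtain ⟨ρ, rfl⟩ := hs
  rw [isInit_iff] at h ⊢
  intro k hk
  rw [← h k (by simp; omega), List.getElem_append_left hk]

theorem IsInit.prefix_of_le {σ τ : List ℕ} {f : Baire} (h : IsInit σ f) (h' : IsInit τ f)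
    (hl : σ.length ≤ τ.length) : σ <+: τ := by
  rw [← h, ← h']
  exact initSeg_prefix f hl

theorem IsInit.prefix_initSeg {σ : List ℕ} {f : Baire} (h : IsInit σ f) {n : ℕ}
    (hn : σ.length ≤ n) : σ <+: initSeg f n :=
  h.prefix_of_le (isInit_initSeg f n) (by simpa using hn)

theorem IsInit.getD {σ : List ℕ} {f : Baire} (h : IsInit σ f) {k : ℕ} (hk : k < σ.length) (d : ℕ) :
    σ.getD k d = f k := by
  rw [List.getD_eq_getElem _ _ hk, isInit_iff.1 h]

theorem isInit_of_prefix_initSeg {σ : List ℕ} {f : Baire} {n : ℕ} (h : σ <+: initSeg f n) :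
    IsInit σ f := (isInit_initSeg f n).of_prefix h

theorem IsInit.concat_right {σ : List ℕ} {f : Baire} (h : IsInit σ f) :
    IsInit (σ ++ [f σ.length]) f := by
  have := isInit_initSeg f (σ.length + 1)
  rwa [initSeg_succ, h] at this

theorem exists_limit {s : ℕ → List ℕ} (hs : ∀ n, s n <+: s (n + 1))
    (hl : Tendsto (fun n => (s n).length) atTop atTop) : ∃ f : Baire, ∀ n, IsInit (s n) f := by
  have hmono : ∀ m n, m ≤ n → s m <+: s n := by
    intro m n h
    induction n, h using Nat.le_induction with
    | base => exact List.prefix_rfl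
    | succ n _ ih => exact ih.trans (hs n)
  have hex : ∀ k, ∃ n, k < (s n).length := fun k =>
    ((hl.eventually_gt_atTop k).exists)
  choose N hN using hex
  refine ⟨fun k => (s (N k)).getD k 0, fun n => isInit_iff.2 fun k hk => ?_⟩
  rw [List.getD_eq_getElem _ _ (hN k)]
  rcases le_total n (N k) with h | h
  · obtain ⟨t, ht⟩ := hmono _ _ h
    simp only [← ht, List.getElem_append_left hk]
  · obtain ⟨t, ht⟩ := hmono _ _ h
    simp only [← ht, List.getElem_append_left (hN k)]

theorem concat_of_lt (σ : List ℕ) (f : Baire) {k : ℕ} (h : k < σ.length) :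
    concat σ f k = σ[k] := by simp [concat, h]

theorem concat_add (σ : List ℕ) (f : Baire) (k : ℕ) : concat σ f (σ.length + k) = f k := by
  simp [concat]

theorem isInit_concat (σ : List ℕ) (f : Baire) : IsInit σ (concat σ f) :=
  isInit_iff.2 fun _ hk => (concat_of_lt σ f hk).symm

theorem initSeg_concat_add (σ : List ℕ) (f : Baire) (n : ℕ) :
    initSeg (concat σ f) (σ.length + n) = σ ++ initSeg f n := by
  rw [initSeg_add, isInit_concat σ f]
  congr 2
  funext m
  exact concat_add σ f m

theorem concat_drop {σ : List ℕ} {f : Baire} (h : IsInit σ f) :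
    concat σ (fun m => f (σ.length + m)) = f := by
  funext k
  rcases lt_or_ge k σ.length with hk | hk
  · rw [concat_of_lt _ _ hk, isInit_iff.1 h]
  · obtain ⟨j, rfl⟩ := Nat.exists_eq_add_of_le hk
    rw [concat_add]

/-! ### Reductions by computable functions on strings -/

/-- The function `F` on strings computes `y` from `x`. -/
def RedBy (F : List ℕ → List ℕ) (x y : Baire) : Prop :=
  (∀ n, IsInit (F (initSeg x n)) y) ∧ Tendsto (fun n => (F (initSeg x n)).length) atTop atTop

/-- `y` is computable relative to `x`. -/
def Red (y x : Baire) : Prop := ∃ F, Computable F ∧ RedBy F x y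

theorem RedBy.apply_eq {F : List ℕ → List ℕ} {x y : Baire} (h : RedBy F x y) (n : ℕ) :
    F (initSeg x n) = initSeg y (F (initSeg x n)).length := (h.1 n).symm

theorem RedBy.comp {F G : List ℕ → List ℕ} {x y z : Baire} (hG : RedBy G y z) (hF : RedBy F x y) :
    RedBy (fun σ => G (F σ)) x z := by
  refine ⟨fun n => ?_, ?_⟩
  · change IsInit (G (F (initSeg x n))) z
    rw [hF.apply_eq]
    exact hG.1 _
  · have := hG.2.comp hF.2
    refine this.congr fun n => ?_
    simp only [Function.comp]
    rw [← hF.apply_eq]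

theorem Red.trans {x y z : Baire} (h1 : Red z y) (h2 : Red y x) : Red z x := by
  obtain ⟨G, hG, h1⟩ := h1
  obtain ⟨F, hF, h2⟩ := h2
  exact ⟨_, hG.comp hF, h1.comp h2⟩

theorem RedBy.refl (x : Baire) : RedBy id x x :=
  ⟨fun n => isInit_initSeg x n, by simpa [Function.id_def] using (tendsto_id : Tendsto (id : ℕ → ℕ) atTop atTop)⟩

theorem Red.refl (x : Baire) : Red x x := ⟨id, Computable.id, RedBy.refl x⟩

/-- The longest list of values `G σ 0, G σ 1, …` (at most `|σ|` many) before one is undefined. -/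
def collect (G : List ℕ → ℕ → Option ℕ) (σ : List ℕ) (n : ℕ) : List ℕ :=
  Nat.rec [] (fun k acc => if acc.length = k then acc ++ (G σ k).toList else acc) n

theorem collect_succ (G : List ℕ → ℕ → Option ℕ) (σ : List ℕ) (n : ℕ) :
    collect G σ (n + 1) = if (collect G σ n).length = n then collect G σ n ++ (G σ n).toList
      else collect G σ n := rfl

theorem computable_collect {α : Type*} [Primcodable α] {G : α → List ℕ → ℕ → Option ℕ}
    (hG : Computable fun p : α × List ℕ × ℕ => G p.1 p.2.1 p.2.2) :
    Computable fun p : α × List ℕ => collect (G p.1) p.2 p.2.length := by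
  refine Computable.nat_rec (h := fun (p : α × List ℕ) (q : ℕ × List ℕ) =>
    if q.2.length = q.1 then q.2 ++ (G p.1 p.2 q.1).toList else q.2)
    (Computable.list_length.comp Computable.snd) (Computable.const []) ?_
  have h1 : Computable fun x : (α × List ℕ) × ℕ × List ℕ => x.2.2 :=
    Computable.snd.comp Computable.snd
  have h2 : Computable fun x : (α × List ℕ) × ℕ × List ℕ => x.2.1 :=
    Computable.fst.comp Computable.snd
  have h3 : Computable fun x : (α × List ℕ) × ℕ × List ℕ => (G x.1.1 x.1.2 x.2.1).toList :=
    Primrec.optionToList.to_comp.comp (hG.comp ((Computable.fst.comp Computable.fst).pair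
      ((Computable.snd.comp Computable.fst).pair h2)))
  refine ((ComputablePred.eq' (Computable.list_length.comp h1) h2).ite'
    (Computable.list_append.comp h1 h3) h1).of_eq fun x => ?_
  congr

theorem isInit_collect {G : List ℕ → ℕ → Option ℕ} {σ : List ℕ} {y : Baire}
    (h : ∀ k v, G σ k = some v → v = y k) (n : ℕ) : IsInit (collect G σ n) y := by
  induction n with
  | zero => exact isInit_nil y
  | succ n ih =>
    rw [collect_succ]
    split_ifs with hl
    · cases hv : G σ n with
      | none => simpa using ih
      | some v =>
        have := ih.concat_right
        rw [hl, ← h n v hv] at this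
        simpa using this
    · exact ih

theorem length_collect {G : List ℕ → ℕ → Option ℕ} {σ : List ℕ} {m : ℕ}
    (h : ∀ k < m, (G σ k).isSome) {n : ℕ} (hn : m ≤ n) : m ≤ (collect G σ n).length := by
  have h1 : ∀ k ≤ m, (collect G σ k).length = k := by
    intro k hk
    induction k with
    | zero => rfl
    | succ k ih =>
      obtain ⟨v, hv⟩ := Option.isSome_iff_exists.1 (h k hk)
      rw [collect_succ, if_pos (ih (by omega)), hv]
      simp [ih (by omega)]
  induction n, hn using Nat.le_induction with
  | base => exact (h1 m le_rfl).ge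
  | succ n _ ih =>
    rw [collect_succ]
    split_ifs
    · simp; omega
    · exact ih

theorem redBy_collect {G : List ℕ → ℕ → Option ℕ} {x y : Baire}
    (h1 : ∀ n k v, G (initSeg x n) k = some v → v = y k)
    (h2 : ∀ k, ∀ᶠ n in atTop, (G (initSeg x n) k).isSome) :
    RedBy (fun σ => collect G σ σ.length) x y := by
  refine ⟨fun n => isInit_collect (h1 n) _, tendsto_atTop.2 fun m => ?_⟩
  have : ∀ᶠ n in atTop, ∀ k < m, (G (initSeg x n) k).isSome := by
    have := (Filter.eventually_all_finset (Finset.range m) (l := atTop)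
      (p := fun k n => ((G (initSeg x n) k).isSome : Prop))).2 fun k _ => h2 k
    simpa using this
  filter_upwards [this, eventually_ge_atTop m] with n hn hm
  exact length_collect hn (by simpa using hm)

/-- Entries may be found out of order: `collect` emits them in order and waits for a missing one. It
is therefore enough that found values are correct and that each entry is eventually found. -/
theorem red_of_option {G : List ℕ → ℕ → Option ℕ} (hG : Computable₂ G) {x y : Baire}
    (h1 : ∀ n k v, G (initSeg x n) k = some v → v = y k)
    (h2 : ∀ k, ∀ᶠ n in atTop, (G (initSeg x n) k).isSome) : Red y x := by
  refine ⟨_, ?_, redBy_collect h1 h2⟩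
  have := computable_collect (α := Unit) (G := fun _ => G)
    (hG.comp (Computable.fst.comp Computable.snd) (Computable.snd.comp Computable.snd))
  exact this.comp ((Computable.const ()).pair Computable.id)

theorem red_of_comp {h : ℕ → ℕ} (hh : Computable h) (x : Baire) : Red (fun k => x (h k)) x := by
  refine red_of_option (G := fun σ k => σ[h k]?) ?_ ?_ ?_
  · exact Computable.list_getElem?.comp Computable.fst (hh.comp Computable.snd)
  · intro n k v hv
    rw [getElem?_initSeg] at hv
    split_ifs at hv
    simpa using hv.symm
  · intro k
    filter_upwards [eventually_gt_atTop (h k)] with n hn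
    rw [getElem?_initSeg, if_pos hn]
    rfl

/-! ### Indices of functionals -/

/-- The program decodes the oracle string and returns the requested entry of `F σ`, diverging if
that entry is absent. Every halting stage then gives the correct value, so it does not matter which
one the search in `functional` meets first. -/
theorem exists_index {F : List ℕ → List ℕ} (hF : Computable F) :
    ∃ e, ∀ x y, RedBy F x y → Computes e x y := by
  have hp : Partrec fun p : ℕ × ℕ =>
      ((((Encodable.decode p.1 : Option (List ℕ)).bind fun σ => (F σ)[p.2]?) : Option ℕ) :
        Part ℕ) := by
    refine Computable.ofOption (Computable.option_bind
      (Computable.decode.comp Computable.fst) ?_)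
    exact Computable.list_getElem?.comp (hF.comp Computable.snd)
      (Computable.snd.comp Computable.fst)
  obtain ⟨c, hc⟩ := Nat.Partrec.Code.exists_code.1
    (Partrec.nat_iff.1 (hp.comp (Primrec.unpair.to_comp)))
  refine ⟨Encodable.encode c, fun x y h k => ?_⟩
  have hcode : Nat.Partrec.Code.ofNatCode (Encodable.encode c) = c := by
    rw [← Nat.Partrec.Code.ofNatCode_eq, Denumerable.ofNat_encode]
  have hval : ∀ s, Nat.Partrec.Code.eval c (Nat.pair (Encodable.encode (initSeg x s)) k) =
      (((F (initSeg x s))[k]? : Option ℕ) : Part ℕ) := by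
    intro s
    rw [hc]
    simp
  have hsound : ∀ s t v, v ∈ Nat.Partrec.Code.evaln t c
      (Nat.pair (Encodable.encode (initSeg x s)) k) → v = y k := by
    intro s t v hv
    have := Nat.Partrec.Code.evaln_sound hv
    rw [hval, h.apply_eq, getElem?_initSeg] at this
    split_ifs at this
    · simpa using this
    · simp at this
  unfold functional
  rw [hcode]
  have hdom : (Nat.rfindOpt fun m => Nat.Partrec.Code.evaln m.unpair.2 c
      (Nat.pair (Encodable.encode (initSeg x m.unpair.1)) k)).Dom := by
    rw [Nat.rfindOpt_dom]
    obtain ⟨s, hs⟩ := (h.2.eventually_gt_atTop k).exists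
    have : y k ∈ Nat.Partrec.Code.eval c (Nat.pair (Encodable.encode (initSeg x s)) k) := by
      rw [hval, h.apply_eq, getElem?_initSeg, if_pos hs]
      simp
    obtain ⟨t, ht⟩ := Nat.Partrec.Code.evaln_complete.1 this
    exact ⟨Nat.pair s t, y k, by simpa using ht⟩
  have hm := Part.get_mem hdom
  obtain ⟨m, hm'⟩ := Nat.rfindOpt_spec hm
  rw [← hsound _ _ _ hm']
  exact hm

/-- The value of the functional with index `e` on input `k`, if it is found with the oracle string
`σ`. -/
def functionalOn (e : ℕ) (σ : List ℕ) (k : ℕ) : Option ℕ :=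
  ((List.range σ.length).filterMap fun m =>
    Nat.Partrec.Code.evaln m.unpair.2 (Nat.Partrec.Code.ofNatCode e)
      (Nat.pair (Encodable.encode (σ.take m.unpair.1)) k)).head?

theorem computable_functionalOn :
    Computable fun p : ℕ × List ℕ × ℕ => functionalOn p.1 p.2.1 p.2.2 := by
  refine Primrec.to_comp (Primrec.list_head?.comp (Primrec.listFilterMap
    (Primrec.list_range.comp (Primrec.list_length.comp (Primrec.fst.comp Primrec.snd))) ?_))
  have hm : Primrec fun x : (ℕ × List ℕ × ℕ) × ℕ => x.2.unpair :=
    Primrec.unpair.comp Primrec.snd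
  have hc : Primrec fun x : (ℕ × List ℕ × ℕ) × ℕ => Nat.Partrec.Code.ofNatCode x.1.1 := by
    rw [← Nat.Partrec.Code.ofNatCode_eq]
    exact (Primrec.ofNat Nat.Partrec.Code).comp (Primrec.fst.comp Primrec.fst)
  have hn : Primrec fun x : (ℕ × List ℕ × ℕ) × ℕ =>
      Nat.pair (Encodable.encode (x.1.2.1.take x.2.unpair.1)) x.1.2.2 :=
    Primrec₂.natPair.comp (Primrec.encode.comp (Primrec.list_take.comp (Primrec.fst.comp hm)
      (Primrec.fst.comp (Primrec.snd.comp Primrec.fst))))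
      (Primrec.snd.comp (Primrec.snd.comp Primrec.fst))
  exact Nat.Partrec.Code.primrec_evaln.comp (((Primrec.snd.comp hm).pair hc).pair hn)

theorem head?_filterMap_range {g : ℕ → Option ℕ} {v : ℕ} (n : ℕ)
    (h : ((List.range n).filterMap g).head? = some v) :
    ∃ m < n, g m = some v ∧ ∀ k < m, g k = none := by
  induction n with
  | zero => simp at h
  | succ n ih =>
    rw [List.range_succ, List.filterMap_append, List.head?_append] at h
    cases hh : ((List.range n).filterMap g).head? with
    | some w =>
      rw [hh] at h
      simp only [Option.some_or, Option.some.injEq] at h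
      obtain ⟨m, hm, h'⟩ := ih (by rw [hh, h])
      exact ⟨m, by omega, h'⟩
    | none =>
      rw [hh] at h
      simp only [Option.none_or] at h
      rw [List.head?_eq_none_iff, List.filterMap_eq_nil_iff] at hh
      refine ⟨n, by omega, ?_, fun k hk => hh k (by simpa using hk)⟩
      cases hg : g n with
      | none => simp [hg] at h
      | some w => simpa [hg] using h

theorem mem_rfindOpt_of {g : ℕ → Option ℕ} {v m : ℕ} (h : g m = some v)
    (h' : ∀ k < m, g k = none) : v ∈ Nat.rfindOpt g := by
  have hdom : (Nat.rfindOpt g).Dom := Nat.rfindOpt_dom.2 ⟨m, v, h⟩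
  obtain ⟨m', hm', h2⟩ := Part.mem_bind_iff.1 (Part.get_mem hdom)
  have hs := Nat.rfind_spec hm'
  have hmm : m' = m := by
    rcases lt_trichotomy m' m with hl | hl | hl
    · simp [h' m' hl] at hs
    · exact hl
    · have := Nat.rfind_min hm' hl
      simp [h] at this
  subst hmm
  have hv : (Nat.rfindOpt g).get hdom = v := by simpa [h] using h2
  exact hv ▸ Part.get_mem hdom

/-- A stage `m` uses an oracle string of length at most `m`, so the stages below `σ.length` can be
run on `σ` alone. The first success among them is the first success overall, hence the value does
not change when `σ` grows. -/
theorem redBy_of_computes {e : ℕ} {x y : Baire} (h : Computes e x y) :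
    RedBy (fun σ => collect (functionalOn e) σ σ.length) x y := by
  have htake : ∀ {n m : ℕ}, m < n → (initSeg x n).take m.unpair.1 = initSeg x m.unpair.1 := by
    intro n m hm
    rw [take_initSeg, min_eq_left]
    exact (Nat.unpair_left_le m).trans hm.le
  refine redBy_collect ?_ ?_
  · intro n k v hv
    obtain ⟨m, hm, h1, h2⟩ := head?_filterMap_range _ hv
    rw [length_initSeg] at hm
    refine Part.mem_unique (mem_rfindOpt_of (m := m) ?_ ?_) (h k)
    · simpa [htake hm] using h1
    · intro j hj
      simpa [htake (hj.trans hm)] using h2 j hj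
  · intro k
    obtain ⟨m, hm⟩ := Nat.rfindOpt_spec (h k)
    filter_upwards [eventually_gt_atTop m] with n hn
    rw [functionalOn, List.isSome_head?]
    simp only [ne_eq, List.filterMap_eq_nil_iff, not_forall]
    refine ⟨m, by simpa using hn, ?_⟩
    rw [htake hn]
    intro hc
    rw [hc] at hm
    simp at hm

theorem computable_functional_string (e : ℕ) :
    Computable fun σ => collect (functionalOn e) σ σ.length :=
  (computable_collect computable_functionalOn).comp ((Computable.const e).pair Computable.id)

theorem red_of_computes {e : ℕ} {x y : Baire} (h : Computes e x y) : Red y x :=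
  ⟨_, computable_functional_string e, redBy_of_computes h⟩

/-- A uniform reduction is learned by a team of one, which constantly guesses a single index. -/
theorem teamLearnable_reducible {F : List ℕ → List ℕ} (hF : Computable F) {P Q : Set Baire}
    (h : ∀ g ∈ Q, ∃ y ∈ P, RedBy F g y) : ReducibleVia TeamLearnable P Q := by
  classical
  obtain ⟨e, he⟩ := exists_index hF
  choose! y hy using h
  refine ⟨fun g => ⟨g ∈ Q, fun _ => y g⟩, ⟨1, fun _ _ => e, fun _ => Computable.const e, ?_⟩, ?_⟩
  · intro g hg
    exact ⟨0, y g, ⟨hg, rfl⟩, e, Eventually.of_forall fun _ => rfl, he _ _ (hy g hg).2⟩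
  · intro g hg
    exact ⟨y g, ⟨hg, rfl⟩, (hy g hg).1⟩

end MassProblem

namespace MassProblem

/-! ### A computable sequence of independent separating classes -/

/-- `x` with the `i`-th column erased. -/
def eraseCol (i : ℕ) (x : Baire) : Baire := fun q => if q.unpair.1 = i then 0 else x q

/-- The string `σ` with the entries of the `i`-th column erased. -/
def eraseColStr (i : ℕ) (σ : List ℕ) : List ℕ :=
  (List.range σ.length).map fun q => if q.unpair.1 = i then 0 else σ.getD q 0

theorem eraseColStr_of_agree {i : ℕ} {σ : List ℕ} {x : Baire}
    (h : ∀ q < σ.length, q.unpair.1 ≠ i → σ.getD q 0 = x q) :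
    eraseColStr i σ = initSeg (eraseCol i x) σ.length := by
  unfold eraseColStr initSeg eraseCol
  refine List.map_congr_left fun q hq => ?_
  split_ifs with hi
  · rfl
  · exact h q (by simpa using hq) hi

theorem computable_eraseColStr : Computable₂ eraseColStr := by
  refine Primrec.to_comp (Primrec.list_map
    (Primrec.list_range.comp (Primrec.list_length.comp Primrec.snd)) ?_)
  exact Primrec.ite (Primrec.eq.comp (Primrec.fst.comp (Primrec.unpair.comp Primrec.snd))
    (Primrec.fst.comp Primrec.fst)) (Primrec.const 0)
    ((Primrec.list_getD 0).comp (Primrec.snd.comp Primrec.fst) Primrec.snd)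

/-! ### The finite injury construction. -/

namespace Injury

/-- An entry `(e, r, τ)`: the requirement `e` acted via the string `τ` at the stage before `r`. -/
abbrev Entry : Type := ℕ × ℕ × List ℕ

/-- The bits fixed so far, and the stack of requirements which are currently satisfied. -/
abbrev State : Type := List (ℕ × ℕ) × List Entry

/-- The entries of higher priority than `e`. -/
def above (S : List Entry) (e : ℕ) : List Entry := S.filter fun x => x.1 < e

/-- The most recent entry of higher priority than `e`. -/
def top (S : List Entry) (e : ℕ) : Entry := (above S e).head?.getD (0, 0, [])

/-- The marker of the requirement `e` with parameter `r`, inside its column. -/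
def marker (e r : ℕ) : ℕ := Nat.pair e r

/-- The position which the requirement `e` with parameter `r` controls. -/
def position (e r : ℕ) : ℕ := Nat.pair e.unpair.2 (marker e r)

/-- The value computed at the marker `m` by the program of the requirement `e` in `s` steps from the
oracle string `τ`. -/
def output (s e m : ℕ) (τ : List ℕ) : Option ℕ :=
  ((Nat.Partrec.Code.evaln s (Nat.Partrec.Code.ofNatCode e.unpair.1)
    (Encodable.encode (eraseColStr e.unpair.2 τ))).bind
      fun c => (Encodable.decode c : Option (List ℕ))).bind fun l => l[m]?

/-- A bit different from `v`. -/
def flip (v : ℕ) : ℕ := if v = 0 then 1 else 0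

theorem flip_ne (v : ℕ) : flip v ≠ v := by unfold flip; split_ifs <;> omega

theorem flip_lt (v : ℕ) : flip v < 2 := by unfold flip; split_ifs <;> omega

/-- At stage `s` the requirement `e` may act via `τ`. -/
def Ready (s : ℕ) (st : State) (e : ℕ) (τ : List ℕ) : Prop :=
  (∀ x ∈ st.2, ¬ x.1 = e) ∧ τ.take (top st.2 e).2.2.length = (top st.2 e).2.2 ∧ τ.length ≤ s ∧
    (∀ x ∈ τ, x < 2) ∧ (∀ p ∈ st.1, p.1 < τ.length → τ.getD p.1 0 = p.2) ∧
    (output s e (marker e (top st.2 e).2.1) τ).isSome = true ∧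
    -- If `τ` reaches the controlled position, it must already carry the bit about to be fixed
    -- there. This restricts only a bit of the erased column, on which the output does not depend.
    (position e (top st.2 e).2.1 < τ.length → τ.getD (position e (top st.2 e).2.1) 0 =
      flip ((output s e (marker e (top st.2 e).2.1) τ).getD 0))

/-- The requirement considered at stage `s`. -/
def req (s : ℕ) : ℕ := s.unpair.1.unpair.1

/-- The string considered at stage `s`. -/
def str (s : ℕ) : List ℕ := Denumerable.ofNat (List ℕ) s.unpair.1.unpair.2

open Classical in
/-- One stage of the construction. -/
noncomputable def step (s : ℕ) (st : State) : State :=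
  if Ready s st (req s) (str s) then
    ((position (req s) (top st.2 (req s)).2.1,
      flip ((output s (req s) (marker (req s) (top st.2 (req s)).2.1) (str s)).getD 0)) :: st.1,
      -- Entries of lower priority are discarded. The new stamp exceeds all earlier ones, so the
      -- injured requirements move on to positions never used before.
      (req s, s + 1, str s) :: above st.2 (req s))
  else st

/-- The state before stage `s`. -/
noncomputable def state (s : ℕ) : State := Nat.rec ([], []) (fun s st => step s st) s

/-! ### Computability of the construction. -/

theorem computable_above : Computable₂ above := by
  have h : PrimrecRel fun (x : Entry) (e : ℕ) => x.1 < e :=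
    Primrec.nat_lt.comp (Primrec.fst.comp Primrec.fst) Primrec.snd
  exact (PrimrecRel.listFilter h).to_comp

theorem computable_top : Computable₂ top :=
  Computable.option_getD (Primrec.list_head?.to_comp.comp computable_above) (Computable.const _)

theorem computable_marker : Computable₂ marker := computable_pair

theorem computable_position : Computable₂ position :=
  computable_pair.comp (computable_unpair_snd.comp Computable.fst) computable_marker

theorem computable_output :
    Computable fun p : (ℕ × ℕ) × ℕ × List ℕ => output p.1.1 p.1.2 p.2.1 p.2.2 := by
  have he : Computable fun p : (ℕ × ℕ) × ℕ × List ℕ => p.1.2 :=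
    Computable.snd.comp Computable.fst
  have hc : Computable fun p : (ℕ × ℕ) × ℕ × List ℕ =>
      Nat.Partrec.Code.ofNatCode p.1.2.unpair.1 := by
    rw [← Nat.Partrec.Code.ofNatCode_eq]
    exact (Computable.ofNat Nat.Partrec.Code).comp (computable_unpair_fst.comp he)
  have hσ : Computable fun p : (ℕ × ℕ) × ℕ × List ℕ =>
      Encodable.encode (eraseColStr p.1.2.unpair.2 p.2.2) :=
    Computable.encode.comp (computable_eraseColStr.comp (computable_unpair_snd.comp he)
      (Computable.snd.comp Computable.snd))
  have hall : Computable fun p : (ℕ × ℕ) × ℕ × List ℕ =>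
      ((p.1.1, Nat.Partrec.Code.ofNatCode p.1.2.unpair.1),
        Encodable.encode (eraseColStr p.1.2.unpair.2 p.2.2)) :=
    ((Computable.fst.comp Computable.fst).pair hc).pair hσ
  have h1 : Computable fun p : (ℕ × ℕ) × ℕ × List ℕ =>
      Nat.Partrec.Code.evaln p.1.1 (Nat.Partrec.Code.ofNatCode p.1.2.unpair.1)
        (Encodable.encode (eraseColStr p.1.2.unpair.2 p.2.2)) := by
    have := Computable.comp (f := fun a : (ℕ × Nat.Partrec.Code) × ℕ =>
      Nat.Partrec.Code.evaln a.1.1 a.1.2 a.2) Nat.Partrec.Code.primrec_evaln.to_comp hall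
    exact this
  have h2 : Computable fun p : (ℕ × ℕ) × ℕ × List ℕ =>
      (Nat.Partrec.Code.evaln p.1.1 (Nat.Partrec.Code.ofNatCode p.1.2.unpair.1)
        (Encodable.encode (eraseColStr p.1.2.unpair.2 p.2.2))).bind
          fun c => (Encodable.decode c : Option (List ℕ)) :=
    Computable.option_bind h1 (Computable.decode.comp Computable.snd)
  have h3 : Computable₂ fun (p : (ℕ × ℕ) × ℕ × List ℕ) (l : List ℕ) => l[p.2.1]? :=
    Computable.list_getElem?.comp Computable.snd
      (Computable.fst.comp (Computable.snd.comp Computable.fst))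
  exact (Computable.option_bind h2 h3).of_eq fun p => by rw [output]

theorem computable_flip : Computable flip := by
  refine ((ComputablePred.eq' Computable.id (Computable.const 0)).ite' (Computable.const 1)
    (Computable.const 0)).of_eq fun v => ?_
  simp [flip]

theorem computable_req : Computable req := computable_unpair_fst.comp computable_unpair_fst

theorem computable_str : Computable str :=
  (Computable.ofNat (List ℕ)).comp (computable_unpair_snd.comp computable_unpair_fst)

theorem computablePred_ready {α : Type*} [Primcodable α] {s e : α → ℕ} {st : α → State}
    {τ : α → List ℕ} (hs : Computable s) (hst : Computable st) (he : Computable e)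
    (hτ : Computable τ) : ComputablePred fun a => Ready (s a) (st a) (e a) (τ a) := by
  have hF : Computable fun a => (st a).1 := Computable.fst.comp hst
  have hS : Computable fun a => (st a).2 := Computable.snd.comp hst
  have ht : Computable fun a => top (st a).2 (e a) := computable_top.comp hS he
  have hr : Computable fun a => (top (st a).2 (e a)).2.1 :=
    Computable.fst.comp (Computable.snd.comp ht)
  have hprev : Computable fun a => (top (st a).2 (e a)).2.2 :=
    Computable.snd.comp (Computable.snd.comp ht)
  have hm : Computable fun a => marker (e a) (top (st a).2 (e a)).2.1 :=
    computable_marker.comp he hr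
  have hq : Computable fun a => position (e a) (top (st a).2 (e a)).2.1 :=
    computable_position.comp he hr
  have ho : Computable fun a => output (s a) (e a) (marker (e a) (top (st a).2 (e a)).2.1) (τ a) :=
    Computable.comp (f := fun p : (ℕ × ℕ) × ℕ × List ℕ => output p.1.1 p.1.2 p.2.1 p.2.2)
      computable_output ((hs.pair he).pair (hm.pair hτ))
  have hlen : Computable fun a => (τ a).length := Computable.list_length.comp hτ
  refine ComputablePred.and' ?_ (ComputablePred.and' ?_ (ComputablePred.and' ?_
    (ComputablePred.and' ?_ (ComputablePred.and' ?_ (ComputablePred.and' ?_ ?_)))))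
  · exact ComputablePred.ball_list (p := fun a (x : Entry) => ¬ x.1 = e a)
      (ComputablePred.eq' (Computable.fst.comp Computable.snd) (he.comp Computable.fst)).not hS
  · exact ComputablePred.eq' (computable_take.comp (Computable.list_length.comp hprev) hτ) hprev
  · exact ComputablePred.le' hlen hs
  · exact ComputablePred.ball_list (p := fun _ x => x < 2)
      (ComputablePred.lt' Computable.snd (Computable.const 2)) hτ
  · refine ComputablePred.ball_list (p := fun a (x : ℕ × ℕ) => x.1 < (τ a).length →
      (τ a).getD x.1 0 = x.2) ?_ hF
    have hx1 : Computable fun y : α × ℕ × ℕ => y.2.1 := Computable.fst.comp Computable.snd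
    exact (ComputablePred.lt' hx1 (hlen.comp Computable.fst)).imp'
      (ComputablePred.eq' ((computable_getD 0).comp (hτ.comp Computable.fst) hx1)
        (Computable.snd.comp Computable.snd))
  · exact ComputablePred.eq' (Primrec.option_isSome.to_comp.comp ho) (Computable.const true)
  · exact (ComputablePred.lt' hq hlen).imp' (ComputablePred.eq' ((computable_getD 0).comp hτ hq)
      (computable_flip.comp (Computable.option_getD ho (Computable.const 0))))

theorem computable_step : Computable₂ step := by
  have hs : Computable fun p : ℕ × State => p.1 := Computable.fst
  have hF : Computable fun p : ℕ × State => p.2.1 := Computable.fst.comp Computable.snd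
  have hS : Computable fun p : ℕ × State => p.2.2 := Computable.snd.comp Computable.snd
  have he : Computable fun p : ℕ × State => req p.1 := computable_req.comp hs
  have hτ : Computable fun p : ℕ × State => str p.1 := computable_str.comp hs
  have hr : Computable fun p : ℕ × State => (top p.2.2 (req p.1)).2.1 :=
    Computable.fst.comp (Computable.snd.comp (computable_top.comp hS he))
  have hm : Computable fun p : ℕ × State => marker (req p.1) (top p.2.2 (req p.1)).2.1 :=
    computable_marker.comp he hr
  have hq : Computable fun p : ℕ × State => position (req p.1) (top p.2.2 (req p.1)).2.1 :=
    computable_position.comp he hr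
  have ho : Computable fun p : ℕ × State =>
      output p.1 (req p.1) (marker (req p.1) (top p.2.2 (req p.1)).2.1) (str p.1) := by
    have := Computable.comp (f := fun p : (ℕ × ℕ) × ℕ × List ℕ => output p.1.1 p.1.2 p.2.1 p.2.2)
      computable_output ((hs.pair he).pair (hm.pair hτ))
    exact this
  have hv := computable_flip.comp (Computable.option_getD ho (Computable.const 0))
  have hnew : Computable fun p : ℕ × State => ((req p.1, p.1 + 1, str p.1) : Entry) :=
    he.pair ((Computable.succ.comp hs).pair hτ)
  have hleft := Computable.list_cons.comp (hq.pair hv) hF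
  have hright := Computable.list_cons.comp hnew (computable_above.comp hS he)
  have hst : Computable fun p : ℕ × State => p.2 := Computable.snd
  exact ((computablePred_ready hs hst he hτ).ite' (hleft.pair hright) hst).of_eq fun p => by
    rw [step]

theorem computable_state : Computable state :=
  Computable.nat_rec Computable.id (Computable.const _)
    (computable_step.comp (Computable.fst.comp Computable.snd)
      (Computable.snd.comp Computable.snd)).to₂

/-! ### The stack and its invariants. -/

/-- Some requirement acts at stage `s`. -/
def Acts (s : ℕ) : Prop := Ready s (state s) (req s) (str s)

theorem state_succ_of_not {s : ℕ} (h : ¬ Acts s) : state (s + 1) = state s := by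
  exact if_neg h

theorem state_succ_of_acts {s : ℕ} (h : Acts s) : state (s + 1) =
    ((position (req s) (top (state s).2 (req s)).2.1,
      flip ((output s (req s) (marker (req s) (top (state s).2 (req s)).2.1)
        (str s)).getD 0)) :: (state s).1,
      (req s, s + 1, str s) :: above (state s).2 (req s)) := by
  exact if_pos h

theorem mem_above {S : List Entry} {e : ℕ} {x : Entry} : x ∈ above S e ↔ x ∈ S ∧ x.1 < e := by
  simp [above]

theorem top_mem {S : List Entry} {e : ℕ} (h : above S e ≠ []) : top S e ∈ above S e := by
  unfold top
  cases hS : above S e with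
  | nil => exact absurd hS h
  | cons a l => simp

theorem top_of_nil {S : List Entry} {e : ℕ} (h : above S e = []) : top S e = (0, 0, []) := by
  simp [top, h]

theorem fixed_mono {s t : ℕ} (h : s ≤ t) {p : ℕ × ℕ} (hp : p ∈ (state s).1) : p ∈ (state t).1 := by
  induction t, h using Nat.le_induction with
  | base => exact hp
  | succ t _ ih =>
    by_cases ha : Acts t
    · rw [state_succ_of_acts ha]
      exact List.mem_cons_of_mem _ ih
    · rwa [state_succ_of_not ha]

/-- The order on the entries of a stack, the most recent one first. -/
def Before (x y : Entry) : Prop := y.1 < x.1 ∧ y.2.1 ≤ x.2.1 ∧ y.2.2 <+: x.2.2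

theorem le_top {S : List Entry} (hS : S.Pairwise Before) {e : ℕ} {x : Entry} (hx : x ∈ above S e) :
    x.2.1 ≤ (top S e).2.1 ∧ x.2.2 <+: (top S e).2.2 := by
  have hp : (above S e).Pairwise Before := hS.filter _
  unfold top
  cases h : above S e with
  | nil => rw [h] at hx; simp at hx
  | cons a l =>
    rw [h] at hx hp
    rcases List.mem_cons.1 hx with rfl | hx
    · simp
    · exact ((List.pairwise_cons.1 hp).1 x hx).2

/-- The invariants of the construction. -/
structure Inv (s : ℕ) (st : State) : Prop where
  sorted : st.2.Pairwise Before
  stamp_le : ∀ x ∈ st.2, x.2.1 ≤ s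
  length_le : ∀ x ∈ st.2, x.2.2.length ≤ x.2.1
  binary : ∀ x ∈ st.2, ∀ k ∈ x.2.2, k < 2
  fixed_lt : ∀ p ∈ st.1, p.2 < 2
  -- The position controlled by a requirement that is not on the stack has no enumerated bit: an
  -- enumerated position with the current parameter belongs to a satisfied requirement.
  owner : ∀ p ∈ st.1, ∃ e r, p.1 = position e r ∧ r ≤ (top st.2 e).2.1 ∧
    (r = (top st.2 e).2.1 → ∃ x ∈ st.2, x.1 = e)
  unique : ∀ p ∈ st.1, ∀ p' ∈ st.1, p.1 = p'.1 → p.2 = p'.2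
  consistent : ∀ x ∈ st.2, ∀ p ∈ st.1, p.1 < x.2.2.length → x.2.2.getD p.1 0 = p.2
  diag : ∀ x ∈ st.2, ∃ t r v, output t x.1 (marker x.1 r) x.2.2 = some v ∧
    (position x.1 r, flip v) ∈ st.1

theorem position_inj {e r e' r' : ℕ} (h : position e r = position e' r') : e = e' ∧ r = r' := by
  have h1 := (Nat.pair_eq_pair.1 h).2
  exact Nat.pair_eq_pair.1 h1

theorem le_position (e r : ℕ) : r ≤ position e r :=
  (Nat.right_le_pair e r).trans (Nat.right_le_pair _ _)

theorem above_push {S : List Entry} {x : Entry} {e : ℕ} (h : e ≤ x.1) :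
    above (x :: above S x.1) e = above S e := by
  unfold above
  rw [List.filter_cons, if_neg (by simpa using h), List.filter_filter]
  refine List.filter_congr fun y _ => ?_
  by_cases hy : y.1 < e
  · simp [hy, hy.trans_le h]
  · simp [hy]

theorem above_push_of_lt {S : List Entry} {x : Entry} {e : ℕ} (h : x.1 < e) :
    top (x :: above S x.1) e = x := by
  unfold top above
  rw [List.filter_cons, if_pos (by simpa using h)]
  rfl

/-- When a requirement acts, `owner` shows that its position is still free, so no bit is enumerated
in two ways. The strings that stay on the stack do not reach this position: their lengths are
bounded by their stamps, these by the parameter `r` of the acting requirement, and `r` by the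
position. -/
theorem inv_state (s : ℕ) : Inv s (state s) := by
  induction s with
  | zero =>
    have : state 0 = ([], []) := rfl
    rw [this]
    constructor <;> simp
  | succ s ih =>
    by_cases ha : Acts s
    swap
    · rw [state_succ_of_not ha]
      exact { ih with stamp_le := fun x hx => (ih.stamp_le x hx).trans (Nat.le_succ s) }
    rw [state_succ_of_acts ha]
    obtain ⟨hnew, hprev, hlen, hbin, hcons, hout, hbit⟩ := ha
    generalize hF : (state s).1 = F at *
    generalize hS : (state s).2 = S at *
    have hst : state s = (F, S) := by rw [← hF, ← hS]
    rw [hst] at ih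
    obtain ⟨i1, i2, i3, i4, i5, i6, i7, i8, i9⟩ := ih
    dsimp only at i1 i2 i3 i4 i5 i6 i7 i8 i9
    obtain ⟨v, hv⟩ := Option.isSome_iff_exists.1 hout
    have hv' : (output s (req s) (marker (req s) (top S (req s)).2.1) (str s)).getD 0 = v := by
      rw [hv]; rfl
    rw [hv'] at hbit ⊢
    have htop_le : ∀ e, (top S e).2.1 ≤ s := by
      intro e
      by_cases h : above S e = []
      · rw [top_of_nil h]; exact Nat.zero_le _
      · exact i2 _ (mem_above.1 (top_mem h)).1
    have hpre : (top S (req s)).2.2 <+: str s := by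
      rw [← hprev]; exact List.take_prefix _ _
    have hfresh : ∀ p ∈ F, p.1 ≠ position (req s) (top S (req s)).2.1 := by
      intro p hp h
      obtain ⟨e, r, he, _, hr⟩ := i6 p hp
      obtain ⟨rfl, rfl⟩ := position_inj (he.symm.trans h)
      obtain ⟨x, hx, hxe⟩ := hr rfl
      exact hnew x hx hxe
    constructor
    · refine List.pairwise_cons.2 ⟨fun y hy => ?_, i1.filter _⟩
      have hy' := le_top i1 hy
      exact ⟨(mem_above.1 hy).2, (i2 y (mem_above.1 hy).1).trans (Nat.le_succ s),
        hy'.2.trans hpre⟩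
    · intro x hx
      rcases List.mem_cons.1 hx with rfl | hx
      · exact le_rfl
      · exact (i2 x (mem_above.1 hx).1).trans (Nat.le_succ s)
    · intro x hx
      rcases List.mem_cons.1 hx with rfl | hx
      · exact hlen.trans (Nat.le_succ s)
      · exact i3 x (mem_above.1 hx).1
    · intro x hx
      rcases List.mem_cons.1 hx with rfl | hx
      · exact hbin
      · exact i4 x (mem_above.1 hx).1
    · intro p hp
      rcases List.mem_cons.1 hp with rfl | hp
      · exact flip_lt _
      · exact i5 p hp
    · intro p hp
      rcases List.mem_cons.1 hp with rfl | hp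
      · refine ⟨req s, _, rfl, ?_, fun _ => ⟨_, List.mem_cons_self, rfl⟩⟩
        unfold top
        rw [above_push (x := (req s, s + 1, str s)) le_rfl]
      · obtain ⟨e, r, he, hr, hre⟩ := i6 p hp
        refine ⟨e, r, he, ?_⟩
        rcases le_or_gt e (req s) with h | h
        · have htop : top ((req s, s + 1, str s) :: above S (req s)) e = top S e := by
            unfold top
            rw [above_push (x := (req s, s + 1, str s)) h]
          rw [htop]
          refine ⟨hr, fun h1 => ?_⟩
          obtain ⟨x, hx, hxe⟩ := hre h1
          rcases h.lt_or_eq with h | h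
          · exact ⟨x, List.mem_cons_of_mem _ (mem_above.2 ⟨hx, hxe ▸ h⟩), hxe⟩
          · exact ⟨_, List.mem_cons_self, h.symm⟩
        -- For a requirement of lower priority the parameter jumps to `s + 1`, beyond the parameters
        -- of all bits enumerated so far.
        · rw [above_push_of_lt (x := (req s, s + 1, str s)) h]
          have := htop_le e
          exact ⟨by simp only; omega, fun h1 => by simp only at h1; omega⟩
    · intro p hp p' hp' h
      rcases List.mem_cons.1 hp with rfl | hp <;> rcases List.mem_cons.1 hp' with rfl | hp'
      · rfl
      · exact absurd h.symm (hfresh p' hp')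
      · exact absurd h (hfresh p hp)
      · exact i7 p hp p' hp' h
    · intro x hx p hp hlt
      rcases List.mem_cons.1 hx with rfl | hx <;> rcases List.mem_cons.1 hp with rfl | hp
      · exact hbit hlt
      · exact hcons p hp hlt
      · exfalso
        have h1 := i3 x (mem_above.1 hx).1
        have h2 := (le_top i1 hx).1
        have h3 := le_position (req s) (top S (req s)).2.1
        simp only at hlt
        omega
      · exact i8 x (mem_above.1 hx).1 p hp hlt
    · intro x hx
      rcases List.mem_cons.1 hx with rfl | hx
      · exact ⟨s, _, v, hv, List.mem_cons_self⟩
      · obtain ⟨t, r, w, h1, h2⟩ := i9 x (mem_above.1 hx).1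
        exact ⟨t, r, w, h1, List.mem_cons_of_mem _ h2⟩

/-! ### Finite injury and the limit matrix. -/

/-- After stage `s`, no requirement before `e` acts. -/
def Settled (e s : ℕ) : Prop := ∀ t ≥ s, Acts t → e ≤ req t

theorem Settled.mono {e s t : ℕ} (h : Settled e s) (hst : s ≤ t) : Settled e t :=
  fun u hu => h u (hst.trans hu)

theorem Settled.above_eq {e s : ℕ} (h : Settled e s) {t : ℕ} (ht : s ≤ t) :
    above (state t).2 e = above (state s).2 e := by
  induction t, ht using Nat.le_induction with
  | base => rfl
  | succ t ht ih =>
    by_cases ha : Acts t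
    · rw [state_succ_of_acts ha, ← ih]
      exact above_push (x := (req t, t + 1, str t)) (h t ht ha)
    · rwa [state_succ_of_not ha]

theorem mem_of_settled {e s : ℕ} (h : Settled e s) {x : Entry} (hx : x ∈ (state s).2) (hxe : x.1 = e)
    {t : ℕ} (ht : s ≤ t) : x ∈ (state t).2 := by
  induction t, ht using Nat.le_induction with
  | base => exact hx
  | succ t ht ih =>
    by_cases ha : Acts t
    · rw [state_succ_of_acts ha]
      refine List.mem_cons_of_mem _ (mem_above.2 ⟨ih, ?_⟩)
      have h1 := h t ht ha
      have h2 := ha.1 x ih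
      omega
    · rwa [state_succ_of_not ha]

/-- Once the requirements before `e` are quiet, `e` acts at most once more, because its entry then
stays on the stack and an entry on the stack forbids acting. -/
theorem exists_settled (e : ℕ) : ∃ s, Settled e s := by
  induction e with
  | zero => exact ⟨0, fun _ _ _ => Nat.zero_le _⟩
  | succ e ih =>
    obtain ⟨s, hs⟩ := ih
    by_cases h : ∃ t ≥ s, Acts t ∧ req t = e
    · obtain ⟨t, ht, ha, he⟩ := h
      refine ⟨t + 1, fun u hu hau => ?_⟩
      have h1 := hs u (by omega) hau
      have hmem : (req t, t + 1, str t) ∈ (state (t + 1)).2 := by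
        rw [state_succ_of_acts ha]; exact List.mem_cons_self
      have h2 := hau.1 _ (mem_of_settled (hs.mono (ht.trans (Nat.le_succ t))) hmem he hu)
      simp only at h2
      omega
    · push Not at h
      refine ⟨s, fun u hu hau => ?_⟩
      have h1 := hs u hu hau
      have h2 := h u hu hau
      omega

/-- The entries which stay forever. -/
def Final (x : Entry) : Prop := ∀ᶠ s in atTop, x ∈ (state s).2

theorem Settled.final {e s : ℕ} (h : Settled e s) {x : Entry} (hx : x ∈ (state s).2)
    (hxe : x.1 ≤ e) : Final x := by
  refine (eventually_ge_atTop s).mono fun t ht => ?_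
  refine mem_of_settled (e := x.1) (fun u hu hau => hxe.trans (h u hu hau)) hx rfl ht

/-- Bits are taken from a final string where one reaches, otherwise from the enumeration, and are 0
elsewhere. Any two of these data are present together at some late stage, where the invariants make
them agree. -/
theorem exists_limit_point : ∃ ζ : Baire, (∀ q, ζ q < 2) ∧
    (∀ s, ∀ p ∈ (state s).1, ζ p.1 = p.2) ∧ ∀ x, Final x → IsInit x.2.2 ζ := by
  have key : ∀ q, ∃ b, b < 2 ∧ (∀ s, ∀ p ∈ (state s).1, p.1 = q → b = p.2) ∧
      ∀ x, Final x → q < x.2.2.length → x.2.2.getD q 0 = b := by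
    intro q
    by_cases hx : ∃ x, Final x ∧ q < x.2.2.length
    · obtain ⟨x, hxF, hxq⟩ := hx
      refine ⟨x.2.2.getD q 0, ?_, ?_, ?_⟩
      · obtain ⟨s, hs⟩ := hxF.exists
        rw [List.getD_eq_getElem _ _ hxq]
        exact (inv_state s).binary x hs _ (List.getElem_mem hxq)
      · rintro s p hp rfl
        obtain ⟨t, hxt, ht⟩ := (hxF.and (eventually_ge_atTop s)).exists
        exact (inv_state t).consistent x hxt p (fixed_mono ht hp) hxq
      · intro y hyF hyq
        obtain ⟨t, hxt, hyt⟩ := (hxF.and hyF).exists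
        have hcomp : x.2.2 <+: y.2.2 ∨ y.2.2 <+: x.2.2 := by
          have hp := ((inv_state t).sorted.imp
            (S := fun a b : Entry => a.2.2 <+: b.2.2 ∨ b.2.2 <+: a.2.2)
            (fun {a b} h => Or.inr h.2.2))
          have : Std.Symm fun a b : Entry => a.2.2 <+: b.2.2 ∨ b.2.2 <+: a.2.2 :=
            ⟨fun _ _ h => h.symm⟩
          exact List.Pairwise.forall_of_forall (R := fun a b : Entry => a.2.2 <+: b.2.2 ∨ b.2.2 <+: a.2.2)
            (fun a _ => Or.inl List.prefix_rfl) hp hxt hyt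
        rw [List.getD_eq_getElem _ _ hxq, List.getD_eq_getElem _ _ hyq]
        rcases hcomp with ⟨l, hl⟩ | ⟨l, hl⟩
        · simp only [← hl, List.getElem_append_left hxq]
        · simp only [← hl, List.getElem_append_left hyq]
    · push Not at hx
      by_cases hF : ∃ s, ∃ p ∈ (state s).1, p.1 = q
      · obtain ⟨s, p, hp, rfl⟩ := hF
        refine ⟨p.2, (inv_state s).fixed_lt p hp, fun t p' hp' h => ?_, fun x hxF hxq =>
          absurd hxq (not_lt.2 (hx x hxF))⟩
        exact (inv_state (max s t)).unique p (fixed_mono (le_max_left _ _) hp) p'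
          (fixed_mono (le_max_right _ _) hp') h.symm
      · push Not at hF
        exact ⟨0, by norm_num, fun s p hp h => absurd h (hF s p hp), fun x hxF hxq =>
          absurd hxq (not_lt.2 (hx x hxF))⟩
  choose ζ h1 h2 h3 using key
  refine ⟨ζ, h1, fun s p hp => h2 p.1 s p hp rfl, fun x hx => isInit_iff.2 fun k hk => ?_⟩
  rw [← h3 k x hx hk, List.getD_eq_getElem _ _ hk]

/-- Let `e` code the program of the reduction together with column `i`, at a stage after which `e`
and all earlier requirements are quiet. If `e` is on the stack, its string is an initial segment of
`ζ`, and the reduction gives a value `v` at a marker where `y` must equal `flip v`. If not, the bit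
of a long initial segment of `ζ` at the free position is set to `flip (y m)`. The reduction does not
see this change, so `e` could act at a later stage, a contradiction. -/
theorem not_red {ζ : Baire} (hbin : ∀ q, ζ q < 2) (hfix : ∀ s, ∀ p ∈ (state s).1, ζ p.1 = p.2)
    (hfin : ∀ x, Final x → IsInit x.2.2 ζ) {i : ℕ} {y : Baire}
    (hy : ∀ s, ∀ p ∈ (state s).1, p.1.unpair.1 = i → y p.1.unpair.2 = p.2) :
    ¬ Red y (eraseCol i ζ) := by
  rintro ⟨F, hF, hFy⟩
  obtain ⟨c, hc⟩ := Nat.Partrec.Code.exists_code.1 hF.partrec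
  have hcval : ∀ σ : List ℕ, Nat.Partrec.Code.eval c (Encodable.encode σ) =
      Part.some (Encodable.encode (F σ)) := by
    intro σ
    rw [hc]
    simp
  have hcode : Nat.Partrec.Code.ofNatCode (Encodable.encode c) = c := by
    rw [← Nat.Partrec.Code.ofNatCode_eq, Denumerable.ofNat_encode]
  obtain ⟨e, he1, he2⟩ : ∃ e : ℕ, e.unpair.1 = Encodable.encode c ∧ e.unpair.2 = i :=
    ⟨Nat.pair (Encodable.encode c) i, by simp, by simp⟩
  obtain ⟨s, hs⟩ := exists_settled (e + 1)
  by_cases hx : ∃ x ∈ (state s).2, x.1 = e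
  · obtain ⟨⟨e', r', τ⟩, hx, rfl⟩ := hx
    have hτ : IsInit τ ζ := hfin _ (hs.final hx (Nat.le_succ _))
    obtain ⟨t, r, v, hout, hmem⟩ := (inv_state s).diag _ hx
    simp only at hout hmem he1 he2
    have hyv := hy s _ hmem
    simp only [position, Nat.unpair_pair, he2, true_implies] at hyv
    unfold output at hout
    rw [he1, he2, hcode, eraseColStr_of_agree (x := ζ) (fun q hq _ => hτ.getD hq 0)] at hout
    obtain ⟨l, hl, hlm⟩ := Option.bind_eq_some_iff.1 hout
    obtain ⟨a, ha, hal⟩ := Option.bind_eq_some_iff.1 hl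
    have := Nat.Partrec.Code.evaln_sound ha
    rw [hcval, Part.mem_some_iff] at this
    subst this
    simp only [Encodable.encodek, Option.some.injEq] at hal
    subst hal
    rw [hFy.apply_eq, getElem?_initSeg] at hlm
    split_ifs at hlm
    simp only [Option.some.injEq] at hlm
    exact flip_ne v (by rw [← hyv, hlm])
  · push Not at hx
    have hsettled : Settled e s := fun t ht ha => (Nat.le_succ e).trans (hs t ht ha)
    have habove : ∀ t ≥ s, above (state t).2 e = above (state s).2 e :=
      fun t ht => hsettled.above_eq ht
    have hnot : ∀ t ≥ s, ∀ x ∈ (state t).2, x.1 ≠ e := by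
      intro t ht
      induction t, ht using Nat.le_induction with
      | base => exact hx
      | succ t ht ih =>
        by_cases ha : Acts t
        · rw [state_succ_of_acts ha]
          intro x hx
          rcases List.mem_cons.1 hx with rfl | hx
          · have := hs t ht ha
            simp only
            omega
          · exact ih x (mem_above.1 hx).1
        · rwa [state_succ_of_not ha]
    have htop : ∀ t ≥ s, top (state t).2 e = top (state s).2 e := by
      intro t ht; unfold top; rw [habove t ht]
    set r := (top (state s).2 e).2.1 with hr
    set ρ := (top (state s).2 e).2.2 with hρ
    have hρ1 : ρ.length ≤ r ∧ IsInit ρ ζ := by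
      by_cases h : above (state s).2 e = []
      · rw [hρ, hr, top_of_nil h]
        exact ⟨le_rfl, isInit_nil ζ⟩
      · have hm := mem_above.1 (top_mem h)
        exact ⟨(inv_state s).length_le _ hm.1, hfin _ (hsettled.final hm.1 hm.2.le)⟩
    set m := marker e r with hm
    set q := position e r with hq
    have hqi : q.unpair.1 = i := by rw [hq, position, Nat.unpair_pair]; exact he2
    have hrq : r ≤ q := le_position e r
    obtain ⟨n, hn, hnq⟩ := ((hFy.2.eventually_gt_atTop m).and (eventually_gt_atTop q)).exists
    set v := flip (y m) with hv
    set τ := (initSeg ζ n).set q v with hτ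
    have hτl : τ.length = n := by simp [hτ]
    have hτq : τ.getD q 0 = v := by simp [hτ, hnq]
    have hτk : ∀ k < n, k ≠ q → τ.getD k 0 = ζ k := by
      intro k hk hkq
      rw [hτ, List.getD_eq_getElem?_getD, List.getElem?_set_ne (Ne.symm hkq), getElem?_initSeg,
        if_pos hk]
      rfl
    have herase : eraseColStr i τ = initSeg (eraseCol i ζ) n := by
      rw [eraseColStr_of_agree (x := ζ), hτl]
      intro k hk hki
      refine hτk k (hτl ▸ hk) ?_
      rintro rfl
      exact hki hqi
    have heval : Encodable.encode (F (eraseColStr i τ)) ∈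
        Nat.Partrec.Code.eval c (Encodable.encode (eraseColStr i τ)) := by
      rw [hcval]; exact Part.mem_some _
    obtain ⟨k, hk⟩ := Nat.Partrec.Code.evaln_complete.1 heval
    -- The last component is only padding. It makes the stage late enough for quietness, for the
    -- length bound on `τ` and for the computation to halt.
    set t := Nat.pair (Nat.pair e (Encodable.encode τ)) (max s (max n k)) with ht
    have htM : max s (max n k) ≤ t := Nat.right_le_pair _ _
    have hts : s ≤ t := (le_max_left _ _).trans htM
    have htn : n ≤ t := ((le_max_left _ _).trans (le_max_right _ _)).trans htM
    have htk : k ≤ t := ((le_max_right _ _).trans (le_max_right _ _)).trans htM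
    have hreq : req t = e := by simp [req, ht]
    have hstr : str t = τ := by simp [str, ht]
    have hout : output t e m τ = some (y m) := by
      unfold output
      rw [he1, he2, hcode, Option.mem_def.1 (Nat.Partrec.Code.evaln_mono htk hk)]
      simp only [Option.bind_some, Encodable.encodek]
      rw [herase, hFy.apply_eq, getElem?_initSeg, if_pos hn]
    have hact : Acts t := by
      unfold Acts Ready
      rw [hreq, hstr, htop t hts, ← hr, ← hρ, ← hm, ← hq, hout]
      refine ⟨hnot t hts, ?_, hτl.le.trans htn, ?_, ?_, rfl, fun _ => hτq⟩
      · rw [← hρ1.2]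
        refine List.ext_getElem ?_ fun j h1 h2 => ?_
        · simp [hτl]; omega
        · simp only [length_initSeg, List.getElem_take, getElem_initSeg] at h1 h2 ⊢
          have hjn : j < n := by omega
          rw [← hτk j hjn (by omega), List.getD_eq_getElem _ _ (by omega)]
      · intro x hx
        rw [hτ] at hx
        rcases List.mem_or_eq_of_mem_set hx with hx | rfl
        · obtain ⟨j, _, rfl⟩ := List.mem_map.1 hx
          exact hbin j
        · exact flip_lt _
      · intro p hp hpl
        -- By `owner`, an enumerated bit at `q` would put `e` on the stack.
        have hpq : p.1 ≠ q := by
          intro h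
          obtain ⟨e', r', h1, _, h3⟩ := (inv_state t).owner p hp
          obtain ⟨rfl, rfl⟩ := position_inj (h1.symm.trans h)
          rw [htop t hts] at h3
          obtain ⟨x, hx, hxe⟩ := h3 rfl
          exact hnot t hts x hx hxe
        rw [hτk p.1 (hτl ▸ hpl) hpq]
        exact hfix t p hp
    have := hs t hts hact
    omega

end Injury

/-- There is a computable enumeration of bits of a matrix, and a completion `ζ` of this partial
matrix, such that no column of any completion can be computed from the other columns of `ζ`. -/
theorem exists_independent_matrix : ∃ fixed : ℕ → List (ℕ × ℕ), Computable fixed ∧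
    (∀ s t, s ≤ t → ∀ p ∈ fixed s, p ∈ fixed t) ∧
    ∃ ζ : Baire, (∀ q, ζ q < 2) ∧ (∀ s, ∀ p ∈ fixed s, ζ p.1 = p.2) ∧
      ∀ i y, (∀ s, ∀ p ∈ fixed s, p.1.unpair.1 = i → y p.1.unpair.2 = p.2) →
        ¬ Red y (eraseCol i ζ) := by
  obtain ⟨ζ, h1, h2, h3⟩ := Injury.exists_limit_point
  exact ⟨fun s => (Injury.state s).1, Computable.fst.comp Injury.computable_state,
    fun s t h p hp => Injury.fixed_mono h hp, ζ, h1, h2,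
    fun i y hy => Injury.not_red h1 h2 h3 hy⟩

end MassProblem

namespace MassProblem

/-! ### Relatively computable generic sequences -/

section Generic

variable (V : List ℕ → List ℕ → Prop) (Ψ : ℕ → List ℕ → ℕ)

/-- The candidate considered at stage `u`. -/
def candidate (u : ℕ) : List ℕ := Denumerable.ofNat (List ℕ) u.unpair.1

/-- The candidate of stage `u` is accepted by the state `s` with the oracle string `σ`. -/
def Accepts (σ : List ℕ) (u : ℕ) (s : List ℕ × ℕ) : Prop :=
  -- The counter `s.2` is read as a pair whose first component names the learner to be disturbed
  -- next, so each learner has its turn infinitely often.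
  s.1 <+: candidate u ∧ V σ (candidate u) ∧ ¬ Ψ s.2.unpair.1 (candidate u) = Ψ s.2.unpair.1 s.1

open Classical in
/-- One stage of the construction of a sequence on which no `Ψ i` converges. -/
noncomputable def genericStep (σ : List ℕ) (u : ℕ) (s : List ℕ × ℕ) : List ℕ × ℕ :=
  if Accepts V Ψ σ u s then (candidate u, s.2 + 1) else s

/-- The first `n` stages of the construction from `r₀` with the oracle string `σ`. -/
noncomputable def genericState (r₀ : List ℕ) (σ : List ℕ) (n : ℕ) : List ℕ × ℕ :=
  Nat.rec (r₀, 0) (fun u s => genericStep V Ψ (σ.take u) u s) n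

variable {V Ψ}

theorem computable_prefix {α : Type*} [Primcodable α] {f g : α → List ℕ} (hf : Computable f)
    (hg : Computable g) : ComputablePred fun a => f a <+: g a :=
  (ComputablePred.eq' hf (computable_take.comp (Computable.list_length.comp hf) hg)).of_eq
    fun _ => List.prefix_iff_eq_take.symm

theorem computable_candidate : Computable candidate :=
  (Computable.ofNat (List ℕ)).comp computable_unpair_fst

theorem computable_genericState (hV : ComputablePred fun p : List ℕ × List ℕ => V p.1 p.2)
    (hΨ : Computable₂ Ψ) (r₀ : List ℕ) :
    Computable fun σ : List ℕ => genericState V Ψ r₀ σ σ.length := by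
  have hσ : Computable fun p : List ℕ × ℕ × List ℕ × ℕ => p.1.take p.2.1 :=
    computable_take.comp (Computable.fst.comp Computable.snd) Computable.fst
  have hc : Computable fun p : List ℕ × ℕ × List ℕ × ℕ => candidate p.2.1 :=
    computable_candidate.comp (Computable.fst.comp Computable.snd)
  have hs : Computable fun p : List ℕ × ℕ × List ℕ × ℕ => p.2.2 :=
    Computable.snd.comp Computable.snd
  have hr : Computable fun p : List ℕ × ℕ × List ℕ × ℕ => p.2.2.1 := Computable.fst.comp hs
  have hk : Computable fun p : List ℕ × ℕ × List ℕ × ℕ => p.2.2.2.unpair.1 :=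
    computable_unpair_fst.comp (Computable.snd.comp hs)
  have hacc : ComputablePred fun p : List ℕ × ℕ × List ℕ × ℕ =>
      Accepts V Ψ (p.1.take p.2.1) p.2.1 p.2.2 :=
    (computable_prefix hr hc).and' ((hV.comp' (hσ.pair hc)).and'
      (ComputablePred.eq' (hΨ.comp hk hc) (hΨ.comp hk hr)).not)
  have hstep : Computable fun p : List ℕ × ℕ × List ℕ × ℕ =>
      genericStep V Ψ (p.1.take p.2.1) p.2.1 p.2.2 := by
    have := hacc.ite' (hc.pair (Computable.succ.comp (Computable.snd.comp hs))) hs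
    exact this
  exact Computable.nat_rec Computable.list_length (Computable.const _) hstep.to₂

/-- Stage `u` consults only the first `u` oracle entries, so runs on longer oracle strings continue
the shorter ones. -/
theorem genericState_congr {r₀ σ τ : List ℕ} {n : ℕ} (h : σ.take n = τ.take n) :
    genericState V Ψ r₀ σ n = genericState V Ψ r₀ τ n := by
  induction n with
  | zero => rfl
  | succ n ih =>
    have h' : σ.take n = τ.take n := by
      have := congrArg (List.take n) h
      simpa [List.take_take] using this
    change genericStep V Ψ (σ.take n) n (genericState V Ψ r₀ σ n) =
      genericStep V Ψ (τ.take n) n (genericState V Ψ r₀ τ n)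
    rw [ih h', h']

/-- If the learners `Ψ i` can always be made to change their mind inside a set `V` of strings that
is decidable relative to `ξ`, then some `ξ`-computable sequence makes all of them diverge. -/
theorem exists_generic (hV : ComputablePred fun p : List ℕ × List ℕ => V p.1 p.2)
    (hΨ : Computable₂ Ψ) {ξ : Baire} {W : List ℕ → Prop}
    (hVW : ∀ n r, V (initSeg ξ n) r → W r) (hWV : ∀ r, W r → ∀ᶠ n in atTop, V (initSeg ξ n) r)
    {r₀ : List ℕ} (hr₀ : W r₀)
    (hdense : ∀ i r, W r → ∃ r', r <+: r' ∧ W r' ∧ Ψ i r' ≠ Ψ i r) :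
    ∃ f, Red f ξ ∧ IsInit r₀ f ∧ (∀ N, ∃ n ≥ N, W (initSeg f n)) ∧
      ∀ i e, ¬ ∀ᶠ n in atTop, Ψ i (initSeg f n) = e := by
  set S : ℕ → List ℕ × ℕ := fun n => genericState V Ψ r₀ (initSeg ξ n) n with hS
  have hS0 : S 0 = (r₀, 0) := rfl
  have hSs : ∀ n, S (n + 1) = genericStep V Ψ (initSeg ξ n) n (S n) := by
    intro n
    change genericStep V Ψ ((initSeg ξ (n + 1)).take n) n
      (genericState V Ψ r₀ (initSeg ξ (n + 1)) n) = _
    rw [take_initSeg, min_eq_left (Nat.le_succ n), genericState_congr (τ := initSeg ξ n)]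
    rw [take_initSeg, take_initSeg, min_eq_left (Nat.le_succ n), min_self]
  have hW : ∀ n, W (S n).1 := by
    intro n
    induction n with
    | zero => exact hr₀
    | succ n ih =>
      rw [hSs, genericStep]
      split_ifs with h
      · exact hVW _ _ h.2.1
      · exact ih
  have hpre : ∀ n, (S n).1 <+: (S (n + 1)).1 := by
    intro n
    rw [hSs, genericStep]
    split_ifs with h
    · exact h.1
    · exact List.prefix_rfl
  -- An accepted candidate is a proper extension, since the learner takes different values on it and
  -- on the old string.
  have hlen : ∀ n, (S n).2 ≤ (S n).1.length := by
    intro n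
    induction n with
    | zero => exact Nat.zero_le _
    | succ n ih =>
      rw [hSs, genericStep]
      split_ifs with h
      · have hne : (S n).1 ≠ candidate n := fun hc => h.2.2 (by rw [← hc])
        have : (S n).1.length < (candidate n).length :=
          lt_of_le_of_ne h.1.length_le fun hl => hne (h.1.eq_of_length hl)
        simp only
        omega
      · exact ih
  have hnext : ∀ n, ∃ m ≥ n, (S m).2 = (S n).2 ∧ Accepts V Ψ (initSeg ξ m) m (S m) := by
    intro n
    by_contra hno
    push Not at hno
    have hconst : ∀ m ≥ n, S m = S n := by
      intro m hm
      induction m, hm using Nat.le_induction with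
      | base => rfl
      | succ m hm ih =>
        rw [hSs, genericStep, if_neg (hno m hm (by rw [ih])), ih]
    obtain ⟨r', h1, h2, h3⟩ := hdense (S n).2.unpair.1 (S n).1 (hW n)
    obtain ⟨N, hN⟩ := eventually_atTop.1 (hWV r' h2)
    -- Every string is the candidate of arbitrarily late stages. The padding waits until the oracle
    -- string suffices for `V` to recognise `r'`.
    set u := Nat.pair (Encodable.encode r') (max n N) with hu
    have huM : max n N ≤ u := Nat.right_le_pair _ _
    have hcand : candidate u = r' := by simp [candidate, hu]
    have hun : n ≤ u := (le_max_left _ _).trans huM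
    refine hno u hun (by rw [hconst u hun]) ?_
    rw [hconst u hun]
    unfold Accepts
    rw [hcand]
    exact ⟨h1, hN u ((le_max_right _ _).trans huM), h3⟩
  have hreach : ∀ k, ∃ m, (S m).2 = k ∧ Accepts V Ψ (initSeg ξ m) m (S m) := by
    intro k
    induction k with
    | zero =>
      obtain ⟨m, _, h1, h2⟩ := hnext 0
      exact ⟨m, h1, h2⟩
    | succ k ih =>
      obtain ⟨m, h1, h2⟩ := ih
      have : (S (m + 1)).2 = k + 1 := by rw [hSs, genericStep, if_pos h2]; simp [h1]
      obtain ⟨m', _, h3, h4⟩ := hnext (m + 1)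
      exact ⟨m', h3.trans this, h4⟩
  have hmono : Monotone fun n => (S n).1.length :=
    monotone_nat_of_le_succ fun n => (hpre n).length_le
  have htend : Tendsto (fun n => (S n).1.length) atTop atTop := by
    refine tendsto_atTop_atTop_of_monotone hmono fun k => ?_
    obtain ⟨m, h1, _⟩ := hreach k
    exact ⟨m, h1 ▸ hlen m⟩
  obtain ⟨f, hf⟩ := exists_limit hpre htend
  refine ⟨f, ⟨fun σ => (genericState V Ψ r₀ σ σ.length).1,
    Computable.fst.comp (computable_genericState hV hΨ r₀), ?_, ?_⟩, hf 0, ?_, ?_⟩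
  · intro n
    simpa using hf n
  · simpa using htend
  · intro N
    obtain ⟨m, hm⟩ := (htend.eventually_ge_atTop N).exists
    exact ⟨_, hm, (hf m).symm ▸ hW m⟩
  · intro i e h
    obtain ⟨N, hN⟩ := eventually_atTop.1 h
    -- At counter value `⟨i, N⟩` learner `i` changes its mind between two initial segments of `f` of
    -- length at least `N`.
    obtain ⟨m, h1, h2⟩ := hreach (Nat.pair i N)
    have hm1 : S (m + 1) = (candidate m, (S m).2 + 1) := by rw [hSs, genericStep, if_pos h2]
    have hlm : N ≤ (S m).1.length := (Nat.right_le_pair i N).trans (h1 ▸ hlen m)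
    have e1 := hN _ hlm
    have e2 := hN _ (hlm.trans (hpre m).length_le)
    rw [hf] at e1 e2
    rw [hm1] at e2
    refine h2.2.2 ?_
    rw [h1, Nat.unpair_pair]
    exact e2.trans e1.symm

end Generic

/-! ### Records that copy the columns of a matrix -/

/-- The `j`-th column of a matrix. -/
def col (j : ℕ) (ζ : Baire) : Baire := fun k => ζ (Nat.pair j k)

theorem proj_append (j : ℕ) (r s : List ℕ) : proj j (r ++ s) = proj j r ++ proj j s := by
  simp [proj]

theorem proj_prefix (j : ℕ) {r s : List ℕ} (h : r <+: s) : proj j r <+: proj j s := by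
  obtain ⟨t, rfl⟩ := h
  rw [proj_append]
  exact List.prefix_append _ _

theorem proj_singleton (j a : ℕ) : proj j [a] = if a.unpair.1 = j then [a.unpair.2] else [] := by
  simp only [proj, List.filter_cons, List.filter_nil]
  split_ifs with h1 h2 h2 <;> simp_all

theorem proj_eq_nil {j : ℕ} {r : List ℕ} (h : ∀ a ∈ r, a.unpair.1 ≠ j) : proj j r = [] := by
  simp only [proj, List.map_eq_nil_iff, List.filter_eq_nil_iff]
  simpa using h

theorem computable_proj : Computable₂ proj := by
  have h : PrimrecRel fun (x : ℕ) (i : ℕ) => x.unpair.1 = i :=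
    Primrec.eq.comp (Primrec.fst.comp (Primrec.unpair.comp Primrec.fst)) Primrec.snd
  exact (Primrec.list_map ((PrimrecRel.listFilter h).comp Primrec.snd Primrec.fst)
    ((Primrec.snd.comp Primrec.unpair).comp Primrec.snd).to₂).to_comp

/-- On every tape, the record `r` copies the corresponding column of `ζ`. -/
def Copies (ζ : Baire) (r : List ℕ) : Prop := ∀ j, IsInit (proj j r) (col j ζ)

theorem Copies.of_prefix {ζ : Baire} {r s : List ℕ} (h : Copies ζ s) (hr : r <+: s) : Copies ζ r :=
  fun j => (h j).of_prefix (proj_prefix j hr)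

theorem copies_nil (ζ : Baire) : Copies ζ [] := fun _ => isInit_nil _

theorem Copies.extend {ζ : Baire} {r : List ℕ} (h : Copies ζ r) (j : ℕ) :
    Copies ζ (r ++ [Nat.pair j (ζ (Nat.pair j (proj j r).length))]) := by
  intro i
  rw [proj_append, proj_singleton]
  split_ifs with hi
  · simp only [Nat.unpair_pair] at hi ⊢
    subst hi
    exact (h j).concat_right
  · simpa using h i

/-- `ζ` with all columns outside `J` erased. -/
def restrictCols (J : Finset ℕ) (ζ : Baire) : Baire := fun q => if q.unpair.1 ∈ J then ζ q else 0

theorem computablePred_mem_finset (J : Finset ℕ) : ComputablePred fun n => n ∈ J := by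
  have : ComputablePred fun n : ℕ => ∀ x ∈ J.toList, ¬ x = n :=
    ComputablePred.ball_list (p := fun (n x : ℕ) => ¬ x = n)
      (ComputablePred.eq' Computable.snd Computable.fst).not (Computable.const _)
  exact this.not.of_eq fun n => by simp

theorem restrictCols_red {J : Finset ℕ} {ζ ξ : Baire} (h : ∀ q, q.unpair.1 ∈ J → ξ q = ζ q) :
    Red (restrictCols J ζ) ξ := by
  classical
  refine red_of_option (G := fun σ q => if q.unpair.1 ∈ J then σ[q]? else some 0) ?_ ?_ ?_
  · exact (((computablePred_mem_finset J).comp'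
      (computable_unpair_fst.comp Computable.snd)).ite' Computable.list_getElem?
      (Computable.const _)).of_eq fun p => by congr
  · intro n q v hv
    unfold restrictCols
    split_ifs at hv ⊢ with hq
    · rw [getElem?_initSeg] at hv
      split_ifs at hv
      rw [← h q hq]
      simpa using hv.symm
    · simpa using hv.symm
  · intro q
    filter_upwards [eventually_gt_atTop q] with n hn
    split_ifs
    · rw [getElem?_initSeg, if_pos hn]; rfl
    · rfl

/-- The decidable part of: `r` extends `r₀` by letters on the tapes in `J`, and copies `ζ`. -/
def CopiesOn (J : Finset ℕ) (r₀ σ r : List ℕ) : Prop :=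
  r₀ <+: r ∧ ∀ a ∈ r.drop r₀.length, a.unpair.1 ∈ J ∧ ∀ k < (proj a.unpair.1 r).length,
    Nat.pair a.unpair.1 k < σ.length ∧
      (proj a.unpair.1 r).getD k 0 = σ.getD (Nat.pair a.unpair.1 k) 0

theorem computablePred_copiesOn (J : Finset ℕ) (r₀ : List ℕ) :
    ComputablePred fun p : List ℕ × List ℕ => CopiesOn J r₀ p.1 p.2 := by
  refine (computable_prefix (Computable.const r₀) Computable.snd).and' ?_
  refine ComputablePred.ball_list (β := ℕ) (p := fun (p : List ℕ × List ℕ) a =>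
    a.unpair.1 ∈ J ∧ ∀ k < (proj a.unpair.1 p.2).length, Nat.pair a.unpair.1 k < p.1.length ∧
      (proj a.unpair.1 p.2).getD k 0 = p.1.getD (Nat.pair a.unpair.1 k) 0) ?_
    (computable_drop.comp (Computable.const r₀.length) Computable.snd)
  have ha : Computable fun x : (List ℕ × List ℕ) × ℕ => x.2.unpair.1 :=
    computable_unpair_fst.comp Computable.snd
  have hp : Computable fun x : (List ℕ × List ℕ) × ℕ => proj x.2.unpair.1 x.1.2 :=
    computable_proj.comp ha (Computable.snd.comp Computable.fst)
  refine ((computablePred_mem_finset J).comp' ha).and' ?_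
  refine ComputablePred.ball_lt (p := fun (x : (List ℕ × List ℕ) × ℕ) k =>
    Nat.pair x.2.unpair.1 k < x.1.1.length ∧
      (proj x.2.unpair.1 x.1.2).getD k 0 = x.1.1.getD (Nat.pair x.2.unpair.1 k) 0) ?_
    (Computable.list_length.comp hp)
  have hσ : Computable fun y : ((List ℕ × List ℕ) × ℕ) × ℕ => y.1.1.1 :=
    Computable.fst.comp (Computable.fst.comp Computable.fst)
  have hq : Computable fun y : ((List ℕ × List ℕ) × ℕ) × ℕ => Nat.pair y.1.2.unpair.1 y.2 :=
    computable_pair.comp (ha.comp Computable.fst) Computable.snd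
  exact (ComputablePred.lt' hq (Computable.list_length.comp hσ)).and'
    (ComputablePred.eq' ((computable_getD 0).comp (hp.comp Computable.fst) Computable.snd)
      ((computable_getD 0).comp hσ hq))

theorem copiesOn_sound {J : Finset ℕ} {ζ : Baire} {r₀ r : List ℕ} {n : ℕ} (h₀ : Copies ζ r₀)
    (h : CopiesOn J r₀ (initSeg (restrictCols J ζ) n) r) : Copies ζ r := by
  intro j
  by_cases hj : ∃ a ∈ r.drop r₀.length, a.unpair.1 = j
  · obtain ⟨a, ha, rfl⟩ := hj
    obtain ⟨haJ, hk⟩ := h.2 a ha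
    refine isInit_iff.2 fun k hkl => ?_
    obtain ⟨h1, h2⟩ := hk k hkl
    rw [List.getD_eq_getElem _ _ hkl, getD_initSeg _ (by simpa using h1)] at h2
    rw [h2]
    simp [restrictCols, haJ, col]
  · push Not at hj
    have : r = r₀ ++ r.drop r₀.length := by
      conv_lhs => rw [← List.take_append_drop r₀.length r]
      rw [← List.prefix_iff_eq_take.1 h.1]
    rw [this, proj_append, proj_eq_nil hj, List.append_nil]
    exact h₀ j

/-- Copying is confirmed as soon as the oracle string covers the finitely many matrix positions that
`r` uses on the tapes of its own letters. -/
theorem copiesOn_complete {J : Finset ℕ} {ζ : Baire} {r₀ r : List ℕ} (hr : r₀ <+: r)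
    (hJ : ∀ a ∈ r.drop r₀.length, a.unpair.1 ∈ J) (h : Copies ζ r) :
    ∀ᶠ n in atTop, CopiesOn J r₀ (initSeg (restrictCols J ζ) n) r := by
  have hb : ∃ N, ∀ a ∈ r, ∀ k < (proj a.unpair.1 r).length, Nat.pair a.unpair.1 k < N := by
    have : ∀ a ∈ r, ∀ k < (proj a.unpair.1 r).length,
        Nat.pair a.unpair.1 k ∈ (r.flatMap fun a => (List.range (proj a.unpair.1 r).length).map
          fun k => Nat.pair a.unpair.1 k).toFinset := by
      intro a ha k hk
      simp only [List.mem_toFinset, List.mem_flatMap, List.mem_map, List.mem_range]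
      exact ⟨a, ha, k, hk, rfl⟩
    refine ⟨_, fun a ha k hk => Nat.lt_succ_of_le (Finset.le_sup (f := id) (this a ha k hk))⟩
  obtain ⟨N, hN⟩ := hb
  filter_upwards [eventually_ge_atTop N] with n hn
  refine ⟨hr, fun a ha => ⟨hJ a ha, fun k hk => ?_⟩⟩
  have hlt : Nat.pair a.unpair.1 k < n := (hN a (List.mem_of_mem_drop ha) k hk).trans_le hn
  refine ⟨by simpa using hlt, ?_⟩
  rw [getD_initSeg _ hlt, (h _).getD hk]
  simp [restrictCols, hJ a ha, col]

/-! ### Teams of learners and records -/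

section Team

variable {P : ℕ → Set Baire} {ζ : Baire} {b : ℕ} {E : List ℕ → List ℕ} {Z : Set Baire}
  {Leaf : ℕ → List ℕ → Prop} {Ψ : Fin b → List ℕ → ℕ}

/-- The learner `i` fails on all inputs that are computed by records which extend `r` by letters
on the tapes in `J`, copy `ζ`, and are computable from the columns in `J`. -/
def Dead (ζ : Baire) (E : List ℕ → List ℕ) (Z : Set Baire) (Ψ : Fin b → List ℕ → ℕ) (i : Fin b)
    (r : List ℕ) (J : Finset ℕ) : Prop :=
  ∀ f g, (∀ n, Copies ζ (initSeg f n)) → (∀ n ≥ r.length, (f n).unpair.1 ∈ J) → IsInit r f →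
    Red f (restrictCols J ζ) → RedBy E f g →
      ∀ e, ∀ z ∈ Z, (∀ᶠ n in atTop, Ψ i (initSeg g n) = e) → ¬ Computes e g z

/-- Lengthening the record on allowed tapes and removing tapes only leaves fewer continuations to
refute. -/
theorem Dead.mono {i : Fin b} {r r' : List ℕ} {J J' : Finset ℕ} (h : Dead ζ E Z Ψ i r J)
    (hr : r <+: r') (hJ : ∀ a ∈ r'.drop r.length, a.unpair.1 ∈ J) (hJ' : J' ⊆ J) :
    Dead ζ E Z Ψ i r' J' := by
  intro f g h1 h2 h3 h4 h5
  refine h f g h1 (fun n hn => ?_) (h3.of_prefix hr) (h4.trans (restrictCols_red ?_)) h5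
  · rcases lt_or_ge n r'.length with hlt | hge
    · rw [← isInit_iff.1 h3 n hlt]
      refine hJ _ ?_
      rw [List.mem_iff_getElem]
      refine ⟨n - r.length, by simp; omega, ?_⟩
      rw [List.getElem_drop]
      congr 1
      omega
    · exact hJ' (h2 n hge)
  · intro q hq
    simp [restrictCols, hJ' hq]

theorem RedBy.eventually {E : List ℕ → List ℕ} {f g : Baire} (h : RedBy E f g) {Φ : List ℕ → ℕ}
    {e : ℕ} (he : ∀ᶠ n in atTop, Φ (initSeg g n) = e) :
    ∀ᶠ n in atTop, Φ (E (initSeg f n)) = e := by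
  refine (h.2.eventually he).mono fun n hn => ?_
  rwa [← h.apply_eq] at hn

variable (hP : ∀ n, ∀ y ∈ P n, ¬ Red y (eraseCol n ζ)) (hE : Computable E)
  (H1 : ∀ z ∈ Z, ∀ n ρ, Leaf n ρ → IsInit ρ z → ∃ y ∈ P n, Red y z)
  (H2 : ∀ z ∈ Z, (∃ n ρ, Leaf n ρ ∧ IsInit ρ z) ∨ ∀ n, ∃ y ∈ P n, Red y z)

include hP in
-- For `n ∉ J` the columns in `J` are all available after column `n` is erased.
theorem not_red_restrictCols {J : Finset ℕ} {n : ℕ} (hn : n ∉ J) {y : Baire} (hy : y ∈ P n) :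
    ¬ Red y (restrictCols J ζ) := by
  intro h
  refine hP n y hy (h.trans (restrictCols_red fun q hq => ?_))
  rw [eraseCol, if_neg]
  rintro rfl
  exact hn hq

include hP hE H1 H2 in
/-- A learner which does not change its mind any more can be killed by giving up one tape. -/
theorem exists_dead {i : Fin b} {r : List ℕ} {J : Finset ℕ}
    (hstab : ∀ r', r <+: r' → (∀ a ∈ r'.drop r.length, a.unpair.1 ∈ J) → Copies ζ r' →
      Ψ i (E r') = Ψ i (E r)) (hc : Copies ζ r) :
    ∃ r' n, r <+: r' ∧ (∀ a ∈ r'.drop r.length, a.unpair.1 ∈ J) ∧ Copies ζ r' ∧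
      Dead ζ E Z Ψ i r' (J.erase n) := by
  set e := Ψ i (E r) with he
  have hred : ∀ {f g z : Baire} {K : Finset ℕ}, Red f (restrictCols K ζ) → RedBy E f g →
      Computes e g z → Red z (restrictCols K ζ) := fun h1 h2 h3 =>
    (red_of_computes h3).trans (Red.trans ⟨E, hE, h2⟩ h1)
  -- A learner that is stable on all permitted extensions can have no limit other than its present
  -- guess `e`.
  have hval : ∀ {r' : List ℕ} {K : Finset ℕ} {f g : Baire} {e' : ℕ}, r <+: r' → K ⊆ J →
      (∀ a ∈ r'.drop r.length, a.unpair.1 ∈ J) → IsInit r' f → (∀ n, Copies ζ (initSeg f n)) →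
      (∀ n ≥ r'.length, (f n).unpair.1 ∈ K) → RedBy E f g →
      (∀ᶠ n in atTop, Ψ i (initSeg g n) = e') → e' = e := by
    intro r' K f g e' hr hK hJ hrf hcf hf hfg hlim
    obtain ⟨n, hn, hnr⟩ := ((hfg.eventually hlim).and (eventually_ge_atTop r'.length)).exists
    rw [← hn]
    refine hstab _ (hr.trans (hrf.prefix_initSeg hnr)) (fun a ha => ?_) (hcf n)
    obtain ⟨k, hk, rfl⟩ := List.mem_iff_getElem.1 ha
    rw [List.getElem_drop, getElem_initSeg]
    rcases lt_or_ge (r.length + k) r'.length with hlt | hge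
    · rw [← isInit_iff.1 hrf _ hlt]
      refine hJ _ (List.mem_iff_getElem.2 ⟨k, by simp; omega, ?_⟩)
      rw [List.getElem_drop]
    · exact hK (hf _ hge)
  -- Does program `e` commit to a leaf `ρ_n` on some permitted extension? If so, tape `n` is given
  -- up: every solution then extends `ρ_n` and computes a member of `P n`, while everything is
  -- computed from columns other than `n`.
  by_cases hleaf : ∃ r', r <+: r' ∧ (∀ a ∈ r'.drop r.length, a.unpair.1 ∈ J) ∧ Copies ζ r' ∧
      ∃ n ρ, Leaf n ρ ∧ ρ <+: collect (functionalOn e) (E r') (E r').length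
  · obtain ⟨r', hr, hJ, hc', n, ρ, hρ, hρp⟩ := hleaf
    refine ⟨r', n, hr, hJ, hc', ?_⟩
    intro f g h1 h2 h3 h4 h5 e' z hz hlim hcomp
    obtain rfl : e' = e := hval hr (Finset.erase_subset n J) hJ h3 h1 h2 h5 hlim
    have hρz : IsInit ρ z := by
      have := (redBy_of_computes hcomp).comp h5
      have := this.1 r'.length
      rw [h3] at this
      exact this.of_prefix hρp
    obtain ⟨y, hy, hyz⟩ := H1 z hz n ρ hρ hρz
    exact not_red_restrictCols hP (Finset.notMem_erase n J) hy (hyz.trans (hred h4 h5 hcomp))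
  · push Not at hleaf
    obtain ⟨n, hn⟩ := Infinite.exists_notMem_finset J
    refine ⟨r, n, List.prefix_rfl, by simp, hc, ?_⟩
    rw [Finset.erase_eq_of_notMem hn]
    intro f g h1 h2 h3 h4 h5 e' z hz hlim hcomp
    obtain rfl : e' = e :=
      hval List.prefix_rfl (Finset.Subset.refl J) (by simp) h3 h1 h2 h5 hlim
    rcases H2 z hz with ⟨m, ρ, hρ, hρz⟩ | hall
    · have hz' := (redBy_of_computes hcomp).comp h5
      obtain ⟨k, hk, hkr⟩ := ((hz'.2.eventually_ge_atTop ρ.length).and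
        (eventually_ge_atTop r.length)).exists
      refine hleaf (initSeg f k) (h3.prefix_initSeg hkr) (fun a ha => ?_) (h1 k) m ρ hρ
        (hρz.prefix_of_le (hz'.1 k) hk)
      obtain ⟨l, hl, rfl⟩ := List.mem_iff_getElem.1 ha
      rw [List.getElem_drop, getElem_initSeg]
      exact h2 _ (Nat.le_add_right _ _)
    · obtain ⟨y, hy, hyz⟩ := hall n
      exact not_red_restrictCols hP hn hy (hyz.trans (hred h4 h5 hcomp))

include hE in
-- If every living learner can always be disturbed, a record computable from the columns in `J`
-- makes all living learners diverge, while the dead ones fail on it by definition of `Dead`. The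
-- record codes an input in `In`, where some learner ought to succeed. Since at most `b` learners
-- are dead, the cardinality bound leaves a tape in `J` on which the record can be continued.
theorem false_of_dense (hΨ : ∀ i, Computable (Ψ i)) {Γ : Baire →. Baire} {In : Set Baire}
    (hIn : ∀ f, (∀ n, Copies ζ (initSeg f n)) → (∀ n, (f n).unpair.1 < b + 1) →
      ∃ g ∈ In, RedBy E f g)
    (hdom : ∀ g ∈ In, ∃ h ∈ Γ g, h ∈ Z) (hteam : ∀ g ∈ Γ.Dom, ∃ i, IdentifiedOn Γ (Ψ i) g)
    {r : List ℕ} {J : Finset ℕ} {D : Finset (Fin b)}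
    (hJ : J ⊆ Finset.range (b + 1)) (hr : ∀ a ∈ r, a.unpair.1 < b + 1) (hc : Copies ζ r)
    (hcard : b + 1 ≤ J.card + D.card) (hdead : ∀ i ∈ D, Dead ζ E Z Ψ i r J)
    (hdense : ∀ i ∉ D, ∀ r', r <+: r' → (∀ a ∈ r'.drop r.length, a.unpair.1 ∈ J) →
      Copies ζ r' → ∃ r'', r' <+: r'' ∧ (∀ a ∈ r''.drop r.length, a.unpair.1 ∈ J) ∧
        Copies ζ r'' ∧ Ψ i (E r'') ≠ Ψ i (E r')) : False := by
  classical
  have hDb : D.card ≤ b := by simpa using Finset.card_le_univ D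
  obtain ⟨j, hj⟩ : J.Nonempty := Finset.card_pos.1 (by omega)
  -- Dead learners, and numbers that name no learner, are replaced by the length function. Any
  -- proper extension changes it, so the density hypothesis of `exists_generic` holds for all `i`.
  set L : List ℕ → List ℕ := fun r =>
    List.ofFn fun i : Fin b => if i ∈ D then r.length else Ψ i (E r) with hL
  set Θ : ℕ → List ℕ → ℕ := fun i r => ((L r)[i]?).getD r.length with hΘ
  have hLc : Computable L := by
    refine Computable.list_ofFn (f := fun (i : Fin b) (r : List ℕ) =>
      if i ∈ D then r.length else Ψ i (E r)) fun i => ?_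
    by_cases hi : i ∈ D
    · simpa only [hi, if_true] using Computable.list_length
    · simpa only [hi, if_false] using (hΨ i).comp hE
  have hΘc : Computable₂ Θ :=
    Computable.option_getD (Computable.list_getElem?.comp (hLc.comp Computable.snd)
      Computable.fst) (Computable.list_length.comp Computable.snd)
  have hΘ1 : ∀ i : Fin b, i ∉ D → ∀ r, Θ i r = Ψ i (E r) := by
    intro i hi r
    simp [hΘ, hL, hi]
  have hΘ2 : ∀ i, (∀ h : i < b, (⟨i, h⟩ : Fin b) ∈ D) → ∀ r, Θ i r = r.length := by
    intro i hi r
    by_cases h : i < b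
    · simp [hΘ, hL, h, hi h]
    · simp [hΘ, hL, h]
  obtain ⟨f, hfred, hrf, hfW, hfdiv⟩ := exists_generic (V := CopiesOn J r)
    (W := fun r' => r <+: r' ∧ (∀ a ∈ r'.drop r.length, a.unpair.1 ∈ J) ∧ Copies ζ r')
    (ξ := restrictCols J ζ) (r₀ := r) (computablePred_copiesOn J r) hΘc
    (fun n r' h => ⟨h.1, fun a ha => (h.2 a ha).1, copiesOn_sound hc h⟩)
    (fun r' h => copiesOn_complete h.1 h.2.1 h.2.2) ⟨List.prefix_rfl, by simp, hc⟩ (by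
      rintro i r' ⟨h1, h2, h3⟩
      by_cases hi : ∀ h : i < b, (⟨i, h⟩ : Fin b) ∈ D
      · refine ⟨_, List.prefix_append _ _, ⟨h1.trans (List.prefix_append _ _), ?_,
          h3.extend j⟩, ?_⟩
        · intro a ha
          rw [List.drop_append_of_le_length h1.length_le] at ha
          rcases List.mem_append.1 ha with ha | ha
          · exact h2 a ha
          · rw [List.mem_singleton.1 ha, Nat.unpair_pair]
            exact hj
        · rw [hΘ2 i hi, hΘ2 i hi]
          simp
      · push Not at hi
        obtain ⟨h, hi⟩ := hi
        obtain ⟨r'', k1, k2, k3, k4⟩ := hdense _ hi r' h1 h2 h3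
        refine ⟨r'', k1, ⟨h1.trans k1, k2, k3⟩, ?_⟩
        rwa [hΘ1 ⟨i, h⟩ hi, hΘ1 ⟨i, h⟩ hi])
  have hfc : ∀ n, Copies ζ (initSeg f n) := by
    intro n
    obtain ⟨k, hk, hW⟩ := hfW n
    exact hW.2.2.of_prefix (initSeg_prefix f hk)
  have hfJ : ∀ n ≥ r.length, (f n).unpair.1 ∈ J := by
    intro n hn
    obtain ⟨k, hk, hW⟩ := hfW (n + 1)
    refine hW.2.1 _ (List.mem_iff_getElem.2 ⟨n - r.length, by simp; omega, ?_⟩)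
    rw [List.getElem_drop, getElem_initSeg]
    congr 1
    omega
  have hfb : ∀ n, (f n).unpair.1 < b + 1 := by
    intro n
    rcases lt_or_ge n r.length with h | h
    · rw [← isInit_iff.1 hrf n h]
      exact hr _ (List.getElem_mem h)
    · exact Finset.mem_range.1 (hJ (hfJ n h))
  obtain ⟨g, hg, hfg⟩ := hIn f hfc hfb
  obtain ⟨z, hzΓ, hz⟩ := hdom g hg
  obtain ⟨i, z', hz', e, hlim, hcomp⟩ := hteam g (Part.dom_iff_mem.2 ⟨z, hzΓ⟩)
  obtain rfl := Part.mem_unique hzΓ hz'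
  by_cases hi : i ∈ D
  · exact hdead i hi f g hfc hfJ hrf hfred hfg e z hz hlim hcomp
  · refine hfdiv i e ((hfg.eventually hlim).mono fun n hn => ?_)
    rw [hΘ1 i hi, hn]

include hP hE H1 H2 in
/-- No team of `b` learners can solve `Z` on all inputs that are coded by records which copy the
first `b + 1` columns of a matrix with independent columns. -/
theorem no_team (hΨ : ∀ i, Computable (Ψ i)) {Γ : Baire →. Baire} {In : Set Baire}
    (hIn : ∀ f, (∀ n, Copies ζ (initSeg f n)) → (∀ n, (f n).unpair.1 < b + 1) →
      ∃ g ∈ In, RedBy E f g)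
    (hdom : ∀ g ∈ In, ∃ h ∈ Γ g, h ∈ Z) (hteam : ∀ g ∈ Γ.Dom, ∃ i, IdentifiedOn Γ (Ψ i) g) :
    False := by
  classical
  -- Induction on the number `m` of living learners. Each killing adds one element to `D` and
  -- removes at most one from `J`, so the sum of the two cardinalities stays at least `b + 1`.
  have main : ∀ m, ∀ (r : List ℕ) (J : Finset ℕ) (D : Finset (Fin b)), D.card + m = b →
      J ⊆ Finset.range (b + 1) → (∀ a ∈ r, a.unpair.1 < b + 1) → Copies ζ r →
      b + 1 ≤ J.card + D.card → (∀ i ∈ D, Dead ζ E Z Ψ i r J) → False := by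
    intro m
    induction m with
    | zero =>
      intro r J D hDm hJ hr hc hcard hdead
      refine false_of_dense hE hΨ hIn hdom hteam hJ hr hc hcard hdead fun i hi => ?_
      have := Finset.card_le_univ (insert i D)
      rw [Finset.card_insert_of_notMem hi, Fintype.card_fin] at this
      omega
    | succ m ih =>
      intro r J D hDm hJ hr hc hcard hdead
      by_contra
      -- When the generic argument does not apply, some living learner is stable above some `r'` and
      -- can be killed by `exists_dead`.
      have hdense := mt (false_of_dense hE hΨ hIn hdom hteam hJ hr hc hcard hdead) this
      push Not at hdense
      obtain ⟨i, hi, r', h1, h2, h3, hstab⟩ := hdense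
      have hci := Finset.card_insert_of_notMem hi
      have hsplit : ∀ r'', r' <+: r'' → (∀ a ∈ r''.drop r'.length, a.unpair.1 ∈ J) →
          ∀ a ∈ r''.drop r.length, a.unpair.1 ∈ J := by
        rintro r'' ⟨t, rfl⟩ ht a ha
        rw [List.drop_append_of_le_length h1.length_le] at ha
        rcases List.mem_append.1 ha with ha | ha
        · exact h2 a ha
        · exact ht a (by simpa using ha)
      obtain ⟨r'', n, k1, k2, k3, k4⟩ := exists_dead (i := i) hP hE H1 H2
        (fun r'' hr hJ hc => hstab r'' hr (hsplit r'' hr hJ) hc) h3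
      refine ih r'' (J.erase n) (insert i D) (by omega) ((Finset.erase_subset n J).trans hJ)
        (fun a ha => ?_) k3 ?_ fun i' hi' => ?_
      · obtain ⟨t, rfl⟩ := h1.trans k1
        rcases List.mem_append.1 ha with ha | ha
        · exact hr a ha
        · exact Finset.mem_range.1 (hJ (hsplit _ k1 k2 a (by simpa using ha)))
      · have := Finset.pred_card_le_card_erase (s := J) (a := n)
        omega
      · rcases Finset.mem_insert.1 hi' with rfl | hi'
        · exact k4
        · exact (hdead i' hi').mono (h1.trans k1) (hsplit _ k1 k2) (Finset.erase_subset n J)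
  exact main b [] (Finset.range (b + 1)) ∅ (by simp) (Finset.Subset.refl _) (by simp)
    (copies_nil ζ) (by simp) (by simp)

end Team

end MassProblem

namespace MassProblem

open FirstOrder.Language

/-! ### Models of Peano arithmetic -/

section Models

variable (M : Type) [arith.Structure M]

/-- The interpretation of `0`. -/
def mZero : M := Structure.funMap (L := arith) PeanoFunc.zero ![]

variable {M}

/-- The interpretation of `S`. -/
def mSucc (x : M) : M := Structure.funMap (L := arith) PeanoFunc.succ ![x]

/-- The interpretation of `+`. -/
def mAdd (x y : M) : M := Structure.funMap (L := arith) PeanoFunc.add ![x, y]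

/-- The interpretation of `·`. -/
def mMul (x y : M) : M := Structure.funMap (L := arith) PeanoFunc.mul ![x, y]

variable (M) in
/-- The interpretation of the `n`-th numeral. -/
def num : ℕ → M
  | 0 => mZero M
  | n + 1 => mSucc (num n)

variable {α : Type}

@[simp] theorem realize_tZero (v : α → M) : (tZero : arith.Term α).realize v = mZero M := by
  simp only [tZero, Term.realize, mZero]
  congr 1
  exact Subsingleton.elim _ _

@[simp] theorem realize_tSucc (t : arith.Term α) (v : α → M) :
    (tSucc t).realize v = mSucc (t.realize v) := by
  simp only [tSucc, Term.realize, mSucc]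
  congr 1
  funext i
  fin_cases i
  rfl

@[simp] theorem realize_tAdd (s t : arith.Term α) (v : α → M) :
    (tAdd s t).realize v = mAdd (s.realize v) (t.realize v) := by
  simp only [tAdd, Term.realize, mAdd]
  congr 1
  funext i
  fin_cases i <;> rfl

@[simp] theorem realize_tMul (s t : arith.Term α) (v : α → M) :
    (tMul s t).realize v = mMul (s.realize v) (t.realize v) := by
  simp only [tMul, Term.realize, mMul]
  congr 1
  funext i
  fin_cases i <;> rfl

theorem realize_toBounded {n : ℕ} (φ : arith.Formula (Fin n)) (v : Empty → M) (x : Fin n → M) :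
    (toBounded φ).Realize v x ↔ φ.Realize x :=
  Formula.realize_relabel_sumInr φ

theorem realize_substLast {n m : ℕ} (φ : arith.Formula (Fin (n + 1))) (x : Fin n → Fin m)
    (t : arith.Term (Fin m)) (v : Fin m → M) :
    (substLast φ x t).Realize v ↔ φ.Realize (Fin.snoc (fun i => v (x i)) (t.realize v)) := by
  unfold substLast Formula.Realize
  rw [BoundedFormula.realize_subst]
  have : (fun a : Fin (n + 1) => Term.realize v (Fin.snoc (α := fun _ => arith.Term (Fin m))
      (fun i => pvar (x i)) t a)) = Fin.snoc (fun i => v (x i)) (t.realize v) := by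
    funext a
    refine Fin.lastCases ?_ (fun i => ?_) a
    · simp
    · simp [pvar]
  rw [this]

theorem realize_inductionAxiom {n : ℕ} (φ : arith.Formula (Fin (n + 1))) :
    M ⊨ inductionAxiom φ ↔ ∀ x : Fin n → M, φ.Realize (Fin.snoc x (mZero M)) →
      (∀ y, φ.Realize (Fin.snoc x y) → φ.Realize (Fin.snoc x (mSucc y))) →
        ∀ y, φ.Realize (Fin.snoc x y) := by
  unfold inductionAxiom Sentence.Realize
  rw [BoundedFormula.realize_alls]
  refine forall_congr' fun x => ?_
  simp only [BoundedFormula.realize_imp, BoundedFormula.realize_all, realize_toBounded,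
    realize_substLast, Formula.realize_imp, realize_tZero, realize_tSucc, id_eq]
  simp [pvar]

variable (M) in
/-- The consequences of Peano arithmetic which are used to represent computable relations. -/
structure PeanoFacts : Prop where
  succ_ne_zero : ∀ x : M, mSucc x ≠ mZero M
  succ_inj : ∀ x y : M, mSucc x = mSucc y → x = y
  add_zero : ∀ x : M, mAdd x (mZero M) = x
  add_succ : ∀ x y : M, mAdd x (mSucc y) = mSucc (mAdd x y)
  mul_zero : ∀ x : M, mMul x (mZero M) = mZero M
  mul_succ : ∀ x y : M, mMul x (mSucc y) = mAdd (mMul x y) x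
  cases : ∀ x : M, x = mZero M ∨ ∃ y, x = mSucc y

/-- `y = 0 ∨ ∃ z, y = S z`. -/
noncomputable def caseFormula : arith.Formula (Fin 1) :=
  ((pvar 0).equal tZero) ⊔ Formula.iExs Unit
    ((Term.var (Sum.inl 0) : arith.Term (Fin 1 ⊕ Unit)).equal (tSucc (Term.var (Sum.inr ()))))

theorem realize_caseFormula (x : Fin 1 → M) :
    caseFormula.Realize x ↔ x 0 = mZero M ∨ ∃ y, x 0 = mSucc y := by
  simp only [caseFormula, Formula.realize_sup, Formula.realize_equal, Formula.realize_iExs,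
    realize_tZero, realize_tSucc, pvar, Term.realize_var, Sum.elim_inl, Sum.elim_inr]
  refine or_congr Iff.rfl ⟨fun ⟨i, h⟩ => ⟨_, h⟩, fun ⟨y, h⟩ => ⟨fun _ => y, h⟩⟩

/-- Only the case distinction zero or successor needs induction, applied to `caseFormula`. The other
facts are axioms. -/
theorem peanoFacts_of_model (h : M ⊨ PA) : PeanoFacts M := by
  have hax : ∀ φ, IsPeanoAxiom φ → M ⊨ φ := fun φ hφ => h.realize_of_mem φ hφ
  have key : ∀ {n : ℕ} {φ : arith.Formula (Fin n)}, M ⊨ (toBounded φ).alls →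
      ∀ x : Fin n → M, φ.Realize x := by
    intro n φ hφ x
    unfold Sentence.Realize at hφ
    rw [BoundedFormula.realize_alls] at hφ
    exact (realize_toBounded φ _ x).1 (hφ x)
  refine ⟨fun x => ?_, fun x y => ?_, fun x => ?_, fun x y => ?_, fun x => ?_, fun x y => ?_, ?_⟩
  · have := key (hax _ IsPeanoAxiom.succ_ne_zero) ![x]
    simpa [pvar] using this
  · have := key (hax _ IsPeanoAxiom.succ_inj) ![x, y]
    simpa [pvar] using this
  · have := key (hax _ IsPeanoAxiom.add_zero) ![x]
    simpa [pvar] using this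
  · have := key (hax _ IsPeanoAxiom.add_succ) ![x, y]
    simpa [pvar] using this
  · have := key (hax _ IsPeanoAxiom.mul_zero) ![x]
    simpa [pvar] using this
  · have := key (hax _ IsPeanoAxiom.mul_succ) ![x, y]
    simpa [pvar] using this
  · have := (realize_inductionAxiom (M := M) (n := 0) caseFormula).1
      (hax _ (IsPeanoAxiom.induction caseFormula)) ![]
    have hs : ∀ y : M, caseFormula.Realize (Fin.snoc (α := fun _ => M) ![] y : Fin 1 → M) ↔
        y = mZero M ∨ ∃ z, y = mSucc z := fun y => realize_caseFormula _
    exact fun y => (hs y).1 (this ((hs _).2 (Or.inl rfl))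
      (fun y _ => (hs _).2 (Or.inr ⟨y, rfl⟩)) y)

/-! ### Numerals inside models. -/

namespace PeanoFacts

variable (hM : PeanoFacts M)
include hM

theorem num_inj {m n : ℕ} (h : num M m = num M n) : m = n := by
  induction m generalizing n with
  | zero =>
    cases n with
    | zero => rfl
    | succ n => exact absurd h.symm (hM.succ_ne_zero _)
  | succ m ih =>
    cases n with
    | zero => exact absurd h (hM.succ_ne_zero _)
    | succ n => rw [ih (hM.succ_inj _ _ h)]

theorem num_add (m n : ℕ) : mAdd (num M m) (num M n) = num M (m + n) := by
  induction n with
  | zero => exact hM.add_zero _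
  | succ n ih => exact (hM.add_succ _ _).trans (congrArg mSucc ih)

theorem num_mul (m n : ℕ) : mMul (num M m) (num M n) = num M (m * n) := by
  induction n with
  | zero => exact hM.mul_zero _
  | succ n ih =>
    refine (hM.mul_succ _ _).trans ?_
    rw [ih, hM.num_add, Nat.mul_succ]

theorem succ_add_num (x : M) (n : ℕ) : mAdd (mSucc x) (num M n) = mAdd x (num M (n + 1)) := by
  induction n with
  | zero =>
    change mAdd (mSucc x) (mZero M) = mAdd x (mSucc (mZero M))
    rw [hM.add_zero, hM.add_succ, hM.add_zero]
  | succ n ih =>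
    change mAdd (mSucc x) (mSucc (num M n)) = mAdd x (mSucc (num M (n + 1)))
    rw [hM.add_succ, hM.add_succ, ih]

/-- Elements below a standard number are standard: successors are cancelled on both sides. This
makes bounded quantifiers absolute. -/
theorem exists_num_of_add_eq {z x : M} {n : ℕ} (h : mAdd z x = num M n) :
    ∃ m ≤ n, x = num M m := by
  induction n generalizing x with
  | zero =>
    rcases hM.cases x with rfl | ⟨y, rfl⟩
    · exact ⟨0, le_rfl, rfl⟩
    · rw [hM.add_succ] at h
      exact absurd h (hM.succ_ne_zero _)
  | succ n ih =>
    rcases hM.cases x with rfl | ⟨y, rfl⟩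
    · exact ⟨0, Nat.zero_le _, rfl⟩
    · rw [hM.add_succ] at h
      obtain ⟨m, hm, rfl⟩ := ih (hM.succ_inj _ _ h)
      exact ⟨m + 1, by omega, rfl⟩

/-- Even a nonstandard `w` is comparable with every standard number, as Rosser's argument requires.
-/
theorem num_le_or_eq (w : M) (n : ℕ) : (∃ z, mAdd z (num M n) = w) ∨ ∃ m < n, w = num M m := by
  induction n with
  | zero => exact Or.inl ⟨w, hM.add_zero w⟩
  | succ n ih =>
    rcases ih with ⟨z, rfl⟩ | ⟨m, hm, rfl⟩
    · rcases hM.cases z with rfl | ⟨y, rfl⟩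
      · right
        refine ⟨n, Nat.lt_succ_self n, ?_⟩
        have := hM.num_add 0 n
        rw [zero_add] at this
        exact this
      · exact Or.inl ⟨y, (hM.succ_add_num y n).symm⟩
    · exact Or.inr ⟨m, by omega, rfl⟩

end PeanoFacts

end Models

/-! ### Representable relations -/

section Representable

variable {α β : Type}

/-- `f` is given by a term of arithmetic. -/
def IsTermFun (f : (α → ℕ) → ℕ) : Prop :=
  ∃ t : arith.Term α, ∀ (M : Type) [arith.Structure M], PeanoFacts M → ∀ v : α → ℕ,
    t.realize (fun a => num M (v a)) = num M (f v)

/-- `R` is represented by a formula which is decided by Peano arithmetic on all numerals. -/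
def Representable (R : (α → ℕ) → Prop) : Prop :=
  ∃ φ : arith.Formula α, ∀ (M : Type) [arith.Structure M], PeanoFacts M → ∀ v : α → ℕ,
    φ.Realize (fun a => num M (v a)) ↔ R v

theorem IsTermFun.var (a : α) : IsTermFun fun v : α → ℕ => v a :=
  ⟨Term.var a, fun _ _ _ _ => rfl⟩

theorem IsTermFun.const (n : ℕ) : IsTermFun fun _ : α → ℕ => n := by
  induction n with
  | zero => exact ⟨tZero, fun M _ _ v => realize_tZero _⟩
  | succ n ih =>
    obtain ⟨t, ht⟩ := ih
    exact ⟨tSucc t, fun M _ hM v => by rw [realize_tSucc, ht M hM]; rfl⟩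

theorem IsTermFun.add {f g : (α → ℕ) → ℕ} (hf : IsTermFun f) (hg : IsTermFun g) :
    IsTermFun fun v => f v + g v := by
  obtain ⟨s, hs⟩ := hf
  obtain ⟨t, ht⟩ := hg
  exact ⟨tAdd s t, fun M _ hM v => by rw [realize_tAdd, hs M hM, ht M hM, hM.num_add]⟩

theorem IsTermFun.mul {f g : (α → ℕ) → ℕ} (hf : IsTermFun f) (hg : IsTermFun g) :
    IsTermFun fun v => f v * g v := by
  obtain ⟨s, hs⟩ := hf
  obtain ⟨t, ht⟩ := hg
  exact ⟨tMul s t, fun M _ hM v => by rw [realize_tMul, hs M hM, ht M hM, hM.num_mul]⟩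

theorem Representable.of_iff {R S : (α → ℕ) → Prop} (h : Representable R) (hRS : ∀ v, S v ↔ R v) :
    Representable S := by
  obtain rfl : S = R := funext fun v => propext (hRS v)
  exact h

theorem Representable.eq {f g : (α → ℕ) → ℕ} (hf : IsTermFun f) (hg : IsTermFun g) :
    Representable fun v => f v = g v := by
  obtain ⟨s, hs⟩ := hf
  obtain ⟨t, ht⟩ := hg
  refine ⟨s.equal t, fun M _ hM v => ?_⟩
  rw [Formula.realize_equal, hs M hM, ht M hM]
  exact ⟨fun h => hM.num_inj h, fun h => by rw [h]⟩

theorem Representable.not {R : (α → ℕ) → Prop} (h : Representable R) :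
    Representable fun v => ¬ R v := by
  obtain ⟨φ, hφ⟩ := h
  exact ⟨φ.not, fun M _ hM v => by rw [Formula.realize_not, hφ M hM]⟩

theorem Representable.and {R S : (α → ℕ) → Prop} (h : Representable R) (h' : Representable S) :
    Representable fun v => R v ∧ S v := by
  obtain ⟨φ, hφ⟩ := h
  obtain ⟨ψ, hψ⟩ := h'
  exact ⟨φ ⊓ ψ, fun M _ hM v => by rw [Formula.realize_inf, hφ M hM, hψ M hM]⟩

theorem Representable.or {R S : (α → ℕ) → Prop} (h : Representable R) (h' : Representable S) :
    Representable fun v => R v ∨ S v :=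
  (h.not.and h'.not).not.of_iff fun v => by tauto

/-- `∃ z, z + x = t`, where `x` is the last variable. -/
noncomputable def boundFormula (t : arith.Term α) : arith.Formula (α ⊕ Unit) :=
  Formula.iExs Unit ((tAdd (Term.var (Sum.inr ())) (Term.var (Sum.inl (Sum.inr ())))).equal
    (t.relabel fun a => Sum.inl (Sum.inl a)))

theorem realize_boundFormula {M : Type} [arith.Structure M] (t : arith.Term α) (v : α ⊕ Unit → M) :
    (boundFormula t).Realize v ↔
      ∃ z, mAdd z (v (Sum.inr ())) = t.realize fun a => v (Sum.inl a) := by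
  simp only [boundFormula, Formula.realize_iExs, Formula.realize_equal, realize_tAdd,
    Term.realize_var, Sum.elim_inl, Sum.elim_inr, Term.realize_relabel]
  exact ⟨fun ⟨i, h⟩ => ⟨_, h⟩, fun ⟨z, h⟩ => ⟨fun _ => z, h⟩⟩

theorem sum_elim_num {M : Type} [arith.Structure M] (v : α → ℕ) (m : ℕ) :
    (Sum.elim (fun a => num M (v a)) fun _ : Unit => num M m) =
      fun a => num M (Sum.elim v (fun _ => m) a) := by
  funext a
  cases a <;> rfl

/-- Below a standard bound every witness in the model is a numeral, so the quantifier has the same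
meaning in the model and in ℕ. -/
theorem Representable.bex {f : (α → ℕ) → ℕ} {R : (α → ℕ) → ℕ → Prop} (hf : IsTermFun f)
    (h : Representable fun v : α ⊕ Unit → ℕ => R (fun a => v (Sum.inl a)) (v (Sum.inr ()))) :
    Representable fun v => ∃ x ≤ f v, R v x := by
  obtain ⟨t, ht⟩ := hf
  obtain ⟨φ, hφ⟩ := h
  refine ⟨Formula.iExs Unit (boundFormula t ⊓ φ), fun M _ hM v => ?_⟩
  simp only [Formula.realize_iExs, Formula.realize_inf, realize_boundFormula, Sum.elim_inl,
    Sum.elim_inr, ht M hM]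
  constructor
  · rintro ⟨i, ⟨z, hz⟩, hi⟩
    obtain ⟨m, hm, hx⟩ := hM.exists_num_of_add_eq hz
    obtain rfl : i = fun _ => num M m := funext fun _ => hx
    rw [sum_elim_num, hφ M hM] at hi
    exact ⟨m, hm, hi⟩
  · rintro ⟨m, hm, hR⟩
    refine ⟨fun _ => num M m, ⟨num M (f v - m), ?_⟩, ?_⟩
    · rw [hM.num_add, Nat.sub_add_cancel hm]
    · rw [sum_elim_num, hφ M hM]
      exact hR

theorem Representable.ball {f : (α → ℕ) → ℕ} {R : (α → ℕ) → ℕ → Prop} (hf : IsTermFun f)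
    (h : Representable fun v : α ⊕ Unit → ℕ => R (fun a => v (Sum.inl a)) (v (Sum.inr ()))) :
    Representable fun v => ∀ x ≤ f v, R v x :=
  (Representable.bex (R := fun v x => ¬ R v x) hf h.not).not.of_iff fun v => by
    push Not
    rfl

theorem Representable.comp {R : (β → ℕ) → Prop} (h : Representable R) {f : β → (α → ℕ) → ℕ}
    (hf : ∀ b, IsTermFun (f b)) : Representable fun v => R fun b => f b v := by
  obtain ⟨φ, hφ⟩ := h
  choose t ht using hf
  refine ⟨φ.subst t, fun M _ hM v => ?_⟩
  unfold Formula.Realize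
  rw [BoundedFormula.realize_subst]
  have : (fun a => Term.realize (fun a => num M (v a)) (t a)) = fun b => num M (f b v) :=
    funext fun b => ht b M hM v
  rw [this]
  exact hφ M hM _

theorem Representable.lt {f g : (α → ℕ) → ℕ} (hf : IsTermFun f) (hg : IsTermFun g) :
    Representable fun v => f v < g v := by
  have hf' : IsTermFun fun v : α ⊕ Unit → ℕ => f fun a => v (Sum.inl a) := by
    obtain ⟨t, ht⟩ := hf
    exact ⟨t.relabel Sum.inl, fun M _ hM v => by
      rw [Term.realize_relabel]; exact ht M hM fun a => v (Sum.inl a)⟩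
  have hg' : IsTermFun fun v : α ⊕ Unit → ℕ => g fun a => v (Sum.inl a) := by
    obtain ⟨t, ht⟩ := hg
    exact ⟨t.relabel Sum.inl, fun M _ hM v => by
      rw [Term.realize_relabel]; exact ht M hM fun a => v (Sum.inl a)⟩
  refine (Representable.bex (R := fun v x => f v + x + 1 = g v) hg
    (Representable.eq ((hf'.add (IsTermFun.var _)).add (IsTermFun.const 1)) hg')).of_iff fun v => ?_
  exact ⟨fun h => ⟨g v - f v - 1, by omega, by omega⟩, fun ⟨x, _, h⟩ => by omega⟩

theorem Representable.pair {a b c : (α → ℕ) → ℕ} (ha : IsTermFun a) (hb : IsTermFun b)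
    (hc : IsTermFun c) : Representable fun v => Nat.pair (a v) (b v) = c v := by
  refine (((Representable.lt ha hb).and (Representable.eq ((hb.mul hb).add ha) hc)).or
    ((Representable.lt ha hb).not.and
      (Representable.eq (((ha.mul ha).add ha).add hb) hc))).of_iff fun v => ?_
  unfold Nat.pair
  split_ifs with h <;> simp [h]

/-- Division with remainder is expressed with bounded quantifiers only, as needed to represent the β
function. -/
theorem beta_eq_iff (c i x : ℕ) : Nat.beta c i = x ↔ ∃ p ≤ c, ∃ q ≤ c, Nat.pair p q = c ∧
    x < (i + 1) * q + 1 ∧ ∃ d ≤ p, ((i + 1) * q + 1) * d + x = p := by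
  unfold Nat.beta
  constructor
  · rintro rfl
    refine ⟨c.unpair.1, Nat.unpair_left_le c, c.unpair.2, Nat.unpair_right_le c, Nat.pair_unpair c,
      Nat.mod_lt _ (Nat.succ_pos _), c.unpair.1 / ((i + 1) * c.unpair.2 + 1), Nat.div_le_self _ _,
      Nat.div_add_mod _ _⟩
  · rintro ⟨p, _, q, _, rfl, hx, d, _, rfl⟩
    simp only [Nat.unpair_pair]
    rw [Nat.mul_add_mod, Nat.mod_eq_of_lt hx]

theorem Representable.beta : Representable fun v : Fin 3 → ℕ => Nat.beta (v 0) (v 1) = v 2 := by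
  refine Representable.of_iff ?_ fun v => beta_eq_iff _ _ _
  refine Representable.bex (R := fun (v : Fin 3 → ℕ) p => ∃ q ≤ v 0, Nat.pair p q = v 0 ∧
    v 2 < (v 1 + 1) * q + 1 ∧ ∃ d ≤ p, ((v 1 + 1) * q + 1) * d + v 2 = p) (IsTermFun.var _) ?_
  refine Representable.bex (R := fun (v : Fin 3 ⊕ Unit → ℕ) q =>
    Nat.pair (v (Sum.inr ())) q = v (Sum.inl 0) ∧
    v (Sum.inl 2) < (v (Sum.inl 1) + 1) * q + 1 ∧ ∃ d ≤ v (Sum.inr ()),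
      ((v (Sum.inl 1) + 1) * q + 1) * d + v (Sum.inl 2) = v (Sum.inr ())) (IsTermFun.var _) ?_
  refine (Representable.pair (IsTermFun.var _) (IsTermFun.var _) (IsTermFun.var _)).and
    ((Representable.lt (IsTermFun.var _) ((((IsTermFun.var _).add (IsTermFun.const 1)).mul
      (IsTermFun.var _)).add (IsTermFun.const 1))).and ?_)
  refine Representable.bex (R := fun (v : (Fin 3 ⊕ Unit) ⊕ Unit → ℕ) d =>
      ((v (Sum.inl (Sum.inl 1)) + 1) * v (Sum.inr ()) + 1) * d + v (Sum.inl (Sum.inl 2)) =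
        v (Sum.inl (Sum.inr ()))) (IsTermFun.var _) ?_
  exact Representable.eq ((((((IsTermFun.var _).add (IsTermFun.const 1)).mul
      (IsTermFun.var _)).add (IsTermFun.const 1)).mul (IsTermFun.var _)).add (IsTermFun.var _))
      (IsTermFun.var _)

/-- `R` is the projection of a representable relation. -/
def IsSigma (R : (α → ℕ) → Prop) : Prop :=
  ∃ R' : (α → ℕ) → ℕ → Prop,
    Representable (fun v : α ⊕ Unit → ℕ => R' (fun a => v (Sum.inl a)) (v (Sum.inr ()))) ∧
      ∀ v, R v ↔ ∃ w, R' v w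

theorem IsSigma.of_iff {R S : (α → ℕ) → Prop} (h : IsSigma R) (hRS : ∀ v, S v ↔ R v) :
    IsSigma S := by
  obtain rfl : S = R := funext fun v => propext (hRS v)
  exact h

theorem Representable.isSigma {R : (α → ℕ) → Prop} (h : Representable R) : IsSigma R :=
  ⟨fun v _ => R v, h.comp (f := fun b v => v (Sum.inl b)) fun _ => IsTermFun.var _,
    fun v => by simp⟩

theorem IsSigma.comp {R : (β → ℕ) → Prop} (h : IsSigma R) {f : β → (α → ℕ) → ℕ}
    (hf : ∀ b, IsTermFun (f b)) : IsSigma fun v => R fun b => f b v := by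
  obtain ⟨R', hR', hR⟩ := h
  refine ⟨fun v w => R' (fun b => f b v) w, ?_, fun v => hR _⟩
  refine hR'.comp (f := fun b v => Sum.elim (fun b => f b fun a => v (Sum.inl a))
    (fun _ => v (Sum.inr ())) b) fun b => ?_
  cases b with
  | inl b =>
    obtain ⟨t, ht⟩ := hf b
    exact ⟨t.relabel Sum.inl, fun M _ hM v => by
      rw [Term.realize_relabel]; exact ht M hM fun a => v (Sum.inl a)⟩
  | inr b => exact IsTermFun.var _

/-- Two unbounded witnesses are merged into one common bound, below which both are sought. -/
theorem IsSigma.ex {R : (α → ℕ) → ℕ → Prop}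
    (h : IsSigma fun v : α ⊕ Unit → ℕ => R (fun a => v (Sum.inl a)) (v (Sum.inr ()))) :
    IsSigma fun v => ∃ x, R v x := by
  obtain ⟨R', hR', hR⟩ := h
  refine ⟨fun v u => ∃ x ≤ u, ∃ w ≤ u, R' (Sum.elim v fun _ => x) w, ?_, fun v => ?_⟩
  · refine Representable.bex (R := fun (v : α ⊕ Unit → ℕ) x => ∃ w ≤ v (Sum.inr ()),
      R' (Sum.elim (fun a => v (Sum.inl a)) fun _ => x) w) (IsTermFun.var _) ?_
    refine Representable.bex (R := fun (v : (α ⊕ Unit) ⊕ Unit → ℕ) w =>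
      R' (Sum.elim (fun a => v (Sum.inl (Sum.inl a))) fun _ => v (Sum.inr ())) w)
      (IsTermFun.var _) ?_
    refine (hR'.comp (f := fun b (v : ((α ⊕ Unit) ⊕ Unit) ⊕ Unit → ℕ) => v (Sum.elim (Sum.elim
      (fun a => Sum.inl (Sum.inl (Sum.inl a))) fun _ => Sum.inl (Sum.inr ()))
        (fun _ => Sum.inr ()) b)) fun b => IsTermFun.var _).of_iff fun v => ?_
    refine iff_of_eq (congrArg₂ R' (funext fun a => ?_) rfl)
    cases a <;> rfl
  · have : ∀ x, R v x ↔ ∃ w, R' (Sum.elim v fun _ => x) w := fun x => by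
      rw [← hR]
      exact Iff.rfl
    simp only [this]
    constructor
    · rintro ⟨x, w, h⟩
      exact ⟨max x w, x, le_max_left _ _, w, le_max_right _ _, h⟩
    · rintro ⟨u, x, _, w, _, h⟩
      exact ⟨x, w, h⟩

theorem IsSigma.and {R S : (α → ℕ) → Prop} (h : IsSigma R) (h' : IsSigma S) :
    IsSigma fun v => R v ∧ S v := by
  obtain ⟨R', hR', hR⟩ := h
  obtain ⟨S', hS', hS⟩ := h'
  have : IsSigma fun v => ∃ w, ∃ u, R' v w ∧ S' v u := by
    refine IsSigma.ex (R := fun v w => ∃ u, R' v w ∧ S' v u) ?_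
    refine IsSigma.ex (R := fun (v : α ⊕ Unit → ℕ) u =>
      R' (fun a => v (Sum.inl a)) (v (Sum.inr ())) ∧ S' (fun a => v (Sum.inl a)) u) ?_
    refine Representable.isSigma (Representable.and ?_ ?_)
    · exact hR'.comp (f := fun b v => v (Sum.inl b)) fun b => IsTermFun.var _
    · exact hS'.comp (f := fun b (v : (α ⊕ Unit) ⊕ Unit → ℕ) => v (Sum.elim
        (fun a => Sum.inl (Sum.inl a)) (fun _ => Sum.inr ()) b)) fun b => IsTermFun.var _
  refine this.of_iff fun v => ?_
  rw [hR, hS]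
  constructor
  · rintro ⟨⟨w, h⟩, u, h'⟩
    exact ⟨w, u, h, h'⟩
  · rintro ⟨w, u, h, h'⟩
    exact ⟨⟨w, h⟩, u, h'⟩

/-- Finitely many witnesses have a common bound, so the existential quantifier can be moved in front
of the bounded universal one. -/
theorem IsSigma.ball_lt {f : (α → ℕ) → ℕ} {R : (α → ℕ) → ℕ → Prop} (hf : IsTermFun f)
    (h : IsSigma fun v : α ⊕ Unit → ℕ => R (fun a => v (Sum.inl a)) (v (Sum.inr ()))) :
    IsSigma fun v => ∀ x < f v, R v x := by
  obtain ⟨R', hR', hR⟩ := h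
  have hf' : IsTermFun fun v : α ⊕ Unit → ℕ => f fun a => v (Sum.inl a) := by
    obtain ⟨t, ht⟩ := hf
    exact ⟨t.relabel Sum.inl, fun M _ hM v => by
      rw [Term.realize_relabel]; exact ht M hM fun a => v (Sum.inl a)⟩
  have hf'' : IsTermFun fun v : (α ⊕ Unit) ⊕ Unit → ℕ => f fun a => v (Sum.inl (Sum.inl a)) := by
    obtain ⟨t, ht⟩ := hf'
    exact ⟨t.relabel Sum.inl, fun M _ hM v => by
      rw [Term.realize_relabel]; exact ht M hM fun a => v (Sum.inl a)⟩
  refine ⟨fun v u => ∀ x ≤ f v, ¬ x < f v ∨ ∃ w ≤ u, R' (Sum.elim v fun _ => x) w, ?_,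
    fun v => ?_⟩
  · refine Representable.ball (f := fun v : α ⊕ Unit → ℕ => f fun a => v (Sum.inl a))
      (R := fun (v : α ⊕ Unit → ℕ) x => ¬ (x < f fun a => v (Sum.inl a)) ∨ ∃ w ≤ v (Sum.inr ()),
        R' (Sum.elim (fun a => v (Sum.inl a)) fun _ => x) w) hf' ?_
    refine (Representable.lt (IsTermFun.var _) hf'').not.or ?_
    refine Representable.bex (R := fun (v : (α ⊕ Unit) ⊕ Unit → ℕ) w =>
      R' (Sum.elim (fun a => v (Sum.inl (Sum.inl a))) fun _ => v (Sum.inr ())) w)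
      (IsTermFun.var _) ?_
    refine (hR'.comp (f := fun b (v : ((α ⊕ Unit) ⊕ Unit) ⊕ Unit → ℕ) => v (Sum.elim (Sum.elim
      (fun a => Sum.inl (Sum.inl (Sum.inl a))) fun _ => Sum.inl (Sum.inr ()))
        (fun _ => Sum.inr ()) b)) fun b => IsTermFun.var _).of_iff fun v => ?_
    refine iff_of_eq (congrArg₂ R' (funext fun a => ?_) rfl)
    cases a <;> rfl
  · have : ∀ x, R v x ↔ ∃ w, R' (Sum.elim v fun _ => x) w := fun x => by
      rw [← hR]
      exact Iff.rfl
    simp only [this]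
    constructor
    · intro h
      choose! w hw using h
      refine ⟨(Finset.range (f v)).sup w, fun x _ => ?_⟩
      by_cases hx : x < f v
      · exact Or.inr ⟨w x, Finset.le_sup (f := w) (Finset.mem_range.2 hx), hw x hx⟩
      · exact Or.inl hx
    · rintro ⟨u, h⟩ x hx
      obtain ⟨w, _, hw⟩ := (h x hx.le).resolve_left (not_not.2 hx)
      exact ⟨w, hw⟩

/-- The graph of `f` is the projection of a representable relation. -/
def SigmaGraph (f : ℕ →. ℕ) : Prop := IsSigma fun v : Fin 2 → ℕ => v 1 ∈ f (v 0)

theorem SigmaGraph.app {f : ℕ →. ℕ} (h : SigmaGraph f) {a c : (α → ℕ) → ℕ} (ha : IsTermFun a)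
    (hc : IsTermFun c) : IsSigma fun v => c v ∈ f (a v) :=
  IsSigma.comp h (f := ![a, c]) fun b => by fin_cases b <;> assumption

theorem Representable.beta_app {a b c : (α → ℕ) → ℕ} (ha : IsTermFun a) (hb : IsTermFun b)
    (hc : IsTermFun c) : IsSigma fun v => Nat.beta (a v) (b v) = c v :=
  (Representable.beta.comp (f := ![a, b, c]) fun i => by fin_cases i <;> assumption).isSigma

theorem IsSigma.pair {a b c : (α → ℕ) → ℕ} (ha : IsTermFun a) (hb : IsTermFun b)
    (hc : IsTermFun c) : IsSigma fun v => Nat.pair (a v) (b v) = c v :=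
  (Representable.pair ha hb hc).isSigma

end Representable

end MassProblem

namespace MassProblem

open FirstOrder.Language

/-! ### Partial recursive functions are arithmetical -/

section SigmaGraph

/-- The whole course of the recursion is coded by one number through the β function, so that
existential quantifiers and one bounded universal quantifier describe it. -/
theorem mem_prec_iff {f g : ℕ →. ℕ} (a n v : ℕ) :
    v ∈ (Nat.rec (f a) (fun y IH => IH.bind fun i => g (Nat.pair a (Nat.pair y i))) n : Part ℕ) ↔
      ∃ c, (∃ b, Nat.beta c 0 = b ∧ b ∈ f a) ∧
        (∀ y < n, ∃ i, Nat.beta c y = i ∧ ∃ j, Nat.beta c (y + 1) = j ∧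
          ∃ p, Nat.pair y i = p ∧ ∃ q, Nat.pair a p = q ∧ j ∈ g q) ∧ Nat.beta c n = v := by
  constructor
  · intro h
    have key : ∃ l : List ℕ, ∃ hl : l.length = n + 1, l[0] ∈ f a ∧ l[n] = v ∧
        ∀ y (hy : y < n), l[y + 1] ∈ g (Nat.pair a (Nat.pair y l[y])) := by
      induction n generalizing v with
      | zero => exact ⟨[v], rfl, h, rfl, fun y hy => absurd hy (Nat.not_lt_zero _)⟩
      | succ n ih =>
        obtain ⟨i, hi, hv⟩ := Part.mem_bind_iff.1 h
        obtain ⟨l, hl, h0, rfl, hs⟩ := ih i hi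
        refine ⟨l ++ [v], by simp [hl], ?_, ?_, fun y hy => ?_⟩
        · rw [List.getElem_append_left (by omega)]
          exact h0
        · simp [← hl]
        · rcases Nat.lt_succ_iff_lt_or_eq.1 hy with hy | rfl
          · rw [List.getElem_append_left (by omega), List.getElem_append_left (by omega)]
            exact hs y hy
          · rw [List.getElem_append_left (by omega)]
            simpa [← hl] using hv
    obtain ⟨l, hl, h0, hn, hs⟩ := key
    have hb : ∀ i (hi : i < l.length), Nat.beta (Nat.unbeta l) i = l[i] := fun i hi =>
      Nat.beta_unbeta_coe l ⟨i, hi⟩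
    refine ⟨Nat.unbeta l, ⟨_, rfl, ?_⟩, fun y hy => ⟨_, rfl, _, rfl, _, rfl, _, rfl, ?_⟩, ?_⟩
    · rw [hb 0 (by omega)]
      exact h0
    · rw [hb y (by omega), hb (y + 1) (by omega)]
      exact hs y hy
    · rw [hb n (by omega), hn]
  · rintro ⟨c, ⟨_, rfl, h0⟩, hs, rfl⟩
    induction n with
    | zero => exact h0
    | succ n ih =>
      refine Part.mem_bind_iff.2 ⟨_, ih fun y hy => hs y (Nat.lt_succ_of_lt hy), ?_⟩
      obtain ⟨_, rfl, _, rfl, _, rfl, _, rfl, h⟩ := hs n (Nat.lt_succ_self n)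
      exact h

theorem sigmaGraph_of_partrec {f : ℕ →. ℕ} (hf : Nat.Partrec f) : SigmaGraph f := by
  have V : ∀ {α : Type} (a : α), IsTermFun fun v : α → ℕ => v a := fun a => IsTermFun.var a
  induction hf with
  | zero =>
    exact (Representable.eq (V 1) (IsTermFun.const 0)).isSigma.of_iff fun v => Part.mem_some_iff
  | succ =>
    exact (Representable.eq (V 1) ((V 0).add (IsTermFun.const 1))).isSigma.of_iff fun v =>
      Part.mem_some_iff
  | left =>
    refine IsSigma.of_iff (R := fun v : Fin 2 → ℕ => ∃ b, Nat.pair (v 1) b = v 0)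
      (IsSigma.ex (IsSigma.pair (V _) (V _) (V _))) fun v => Part.mem_some_iff.trans ?_
    constructor
    · intro h
      exact ⟨(v 0).unpair.2, by rw [h, Nat.pair_unpair]⟩
    · rintro ⟨b, hb⟩
      simp [← hb]
  | right =>
    refine IsSigma.of_iff (R := fun v : Fin 2 → ℕ => ∃ b, Nat.pair b (v 1) = v 0)
      (IsSigma.ex (IsSigma.pair (V _) (V _) (V _))) fun v => Part.mem_some_iff.trans ?_
    constructor
    · intro h
      exact ⟨(v 0).unpair.1, by rw [h, Nat.pair_unpair]⟩
    · rintro ⟨b, hb⟩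
      simp [← hb]
  | @pair f g _ _ hf hg =>
    refine IsSigma.of_iff
      (R := fun v : Fin 2 → ℕ => ∃ x, ∃ y, x ∈ f (v 0) ∧ y ∈ g (v 0) ∧ Nat.pair x y = v 1)
      (IsSigma.ex (IsSigma.ex ((hf.app (V _) (V _)).and ((hg.app (V _) (V _)).and
        (IsSigma.pair (V _) (V _) (V _)))))) fun v => ?_
    simp only [Seq.seq, Part.map_eq_map, Part.mem_bind_iff, Part.mem_map_iff]
    constructor
    · rintro ⟨_, ⟨x, hx, rfl⟩, y, hy, h⟩
      exact ⟨x, y, hx, hy, h⟩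
    · rintro ⟨x, y, hx, hy, h⟩
      exact ⟨_, ⟨x, hx, rfl⟩, y, hy, h⟩
  | @comp f g _ _ hf hg =>
    exact IsSigma.of_iff (R := fun v : Fin 2 → ℕ => ∃ x, x ∈ g (v 0) ∧ v 1 ∈ f x)
      (IsSigma.ex ((hg.app (V _) (V _)).and (hf.app (V _) (V _)))) fun v => Part.mem_bind_iff
  | @prec f g _ _ hf hg =>
    refine IsSigma.of_iff (R := fun v : Fin 2 → ℕ => ∃ a, ∃ n, Nat.pair a n = v 0 ∧
      ∃ c, (∃ b, Nat.beta c 0 = b ∧ b ∈ f a) ∧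
        (∀ y < n, ∃ i, Nat.beta c y = i ∧ ∃ j, Nat.beta c (y + 1) = j ∧
          ∃ p, Nat.pair y i = p ∧ ∃ q, Nat.pair a p = q ∧ j ∈ g q) ∧ Nat.beta c n = v 1) ?_
      fun v => ?_
    · refine IsSigma.ex (IsSigma.ex ((IsSigma.pair (V _) (V _) (V _)).and
        (IsSigma.ex (IsSigma.and ?_ (IsSigma.and ?_ ?_)))))
      · exact IsSigma.ex ((Representable.beta_app (V _) (IsTermFun.const 0) (V _)).and
          (hf.app (V _) (V _)))
      · refine IsSigma.ball_lt (V _) ?_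
        exact IsSigma.ex ((Representable.beta_app (V _) (V _) (V _)).and (IsSigma.ex
          ((Representable.beta_app (V _) ((V _).add (IsTermFun.const 1)) (V _)).and (IsSigma.ex
          ((IsSigma.pair (V _) (V _) (V _)).and (IsSigma.ex
          ((IsSigma.pair (V _) (V _) (V _)).and (hg.app (V _) (V _)))))))))
      · exact Representable.beta_app (V _) (V _) (V _)
    · have := mem_prec_iff (f := f) (g := g) (v 0).unpair.1 (v 0).unpair.2 (v 1)
      refine this.trans ?_
      constructor
      · intro h
        exact ⟨_, _, Nat.pair_unpair _, h⟩
      · rintro ⟨a, n, hv, h⟩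
        rw [← hv, Nat.unpair_pair]
        exact h
  | @rfind f _ hf =>
    refine IsSigma.of_iff (R := fun v : Fin 2 → ℕ => (∃ p, Nat.pair (v 0) (v 1) = p ∧ 0 ∈ f p) ∧
      ∀ y < v 1, ∃ p, Nat.pair (v 0) y = p ∧ ∃ m, m + 1 ∈ f p) ?_ fun v => ?_
    · refine (IsSigma.ex ((IsSigma.pair (V _) (V _) (V _)).and
        (hf.app (V _) (IsTermFun.const 0)))).and (IsSigma.ball_lt (V _) ?_)
      exact IsSigma.ex ((IsSigma.pair (V _) (V _) (V _)).and (IsSigma.ex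
        (hf.app (V _) ((V _).add (IsTermFun.const 1)))))
    · refine Nat.mem_rfind.trans ?_
      simp only [Part.map_eq_map, Part.mem_map_iff]
      refine and_congr ?_ (forall_congr' fun y => forall_congr' fun _ => ?_)
      · constructor
        · rintro ⟨m, hm, h⟩
          obtain rfl : m = 0 := by simpa using h
          exact ⟨_, rfl, hm⟩
        · rintro ⟨_, rfl, h⟩
          exact ⟨0, h, by simp⟩
      · constructor
        · rintro ⟨m, hm, h⟩
          refine ⟨_, rfl, m - 1, ?_⟩
          have : m ≠ 0 := by simpa using h
          rwa [Nat.sub_add_cancel (by omega)]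
        · rintro ⟨_, rfl, m, h⟩
          exact ⟨m + 1, h, by simp⟩

end SigmaGraph

/-! ### Separation by Rosser sentences -/

section Rosser

/-- The formula says that there is a witness `w` for the value 1 with no witness for the value 0 at
or below it. If the value is 1, a standard witness works, because everything below it is standard.
If the value is 0 with standard witness `m`, any such `w` is either at least `m`, and so excluded,
or a standard number below `m`, which would be a true witness for the value 1. -/
theorem exists_rosser_formula {f : ℕ →. ℕ} (hf : SigmaGraph f) :
    ∃ θ : arith.Formula Unit, ∀ (M : Type) [arith.Structure M], PeanoFacts M → ∀ n,
      (1 ∈ f n → θ.Realize fun _ => num M n) ∧ (0 ∈ f n → ¬ θ.Realize fun _ => num M n) := by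
  have key : ∀ c, ∃ (R : ℕ → ℕ → Prop) (φ : arith.Formula (Unit ⊕ Unit)),
      (∀ n, c ∈ f n ↔ ∃ w, R n w) ∧ ∀ (M : Type) [arith.Structure M], PeanoFacts M →
        ∀ n w, φ.Realize (Sum.elim (fun _ => num M n) fun _ => num M w) ↔ R n w := by
    intro c
    have : IsSigma fun v : Unit → ℕ => c ∈ f (v ()) :=
      hf.app (IsTermFun.var _) (IsTermFun.const c)
    obtain ⟨R, ⟨φ, hφ⟩, hR⟩ := this
    refine ⟨fun n w => R (fun _ => n) w, φ, fun n => hR fun _ => n, fun M _ hM n w => ?_⟩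
    have := hφ M hM (Sum.elim (fun _ => n) fun _ => w)
    rw [← sum_elim_num] at this
    exact this
  obtain ⟨R₁, φ₁, hR₁, hφ₁⟩ := key 1
  obtain ⟨R₀, φ₀, hR₀, hφ₀⟩ := key 0
  have huniq : ∀ n, 1 ∈ f n → 0 ∈ f n → False := fun n h h' =>
    absurd (Part.mem_unique h h') one_ne_zero
  refine ⟨Formula.iExs Unit (φ₁ ⊓ (Formula.iExs Unit
    (boundFormula (Term.var (Sum.inr ())) ⊓ φ₀.relabel
      (Sum.elim (fun _ => Sum.inl (Sum.inl ())) fun _ => Sum.inr ()))).not), fun M _ hM n => ?_⟩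
  have hreal : ∀ (w u : Unit → M), (φ₀.relabel
      (Sum.elim (fun _ => Sum.inl (Sum.inl ())) fun _ => Sum.inr () :
        Unit ⊕ Unit → (Unit ⊕ Unit) ⊕ Unit)).Realize
        (Sum.elim (Sum.elim (fun _ => num M n) w) u) ↔
      φ₀.Realize (Sum.elim (fun _ => num M n) u) := by
    intro w u
    rw [Formula.realize_relabel]
    refine iff_of_eq (congrArg _ (funext fun a => ?_))
    cases a <;> rfl
  simp only [Formula.realize_iExs, Formula.realize_inf, Formula.realize_not, realize_boundFormula,
    hreal, Sum.elim_inl, Sum.elim_inr, Term.realize_var]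
  constructor
  · intro h
    obtain ⟨w, hw⟩ := (hR₁ n).1 h
    refine ⟨fun _ => num M w, (hφ₁ M hM n w).2 hw, ?_⟩
    rintro ⟨u, ⟨z, hz⟩, hu⟩
    obtain ⟨m, -, hm⟩ := hM.exists_num_of_add_eq hz
    obtain rfl : u = fun _ => num M m := funext fun _ => hm
    exact huniq n h ((hR₀ n).2 ⟨m, (hφ₀ M hM n m).1 hu⟩)
  · rintro h ⟨w, hw, hn⟩
    obtain ⟨m, hm⟩ := (hR₀ n).1 h
    rcases hM.num_le_or_eq (w ()) m with ⟨z, hz⟩ | ⟨k, -, hk⟩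
    · exact hn ⟨fun _ => num M m, ⟨z, hz⟩, (hφ₀ M hM n m).2 hm⟩
    · obtain rfl : w = fun _ => num M k := funext fun _ => hk
      exact huniq n ((hR₁ n).2 ⟨k, (hφ₁ M hM n k).1 hw⟩) h

/-! ### Gödel numbers and numerical instances of formulas. -/

theorem termCode_injective {n : ℕ} :
    Function.Injective (termCode : arith.Term (Empty ⊕ Fin n) → ℕ) := by
  intro s
  induction s with
  | var x =>
    intro t h
    rcases x with x | i
    · exact x.elim
    · rcases t with (x | j) | ⟨g, ts⟩
      · exact x.elim
      · simp only [termCode, Nat.pair_eq_pair] at h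
        rw [Fin.ext h.2]
      · cases g <;> simp [termCode, Nat.pair_eq_pair] at h
  | func g ts ih =>
    intro t h
    rcases t with (x | j) | ⟨g', ts'⟩
    · exact x.elim
    · cases g <;> simp [termCode, Nat.pair_eq_pair] at h
    · cases g <;> cases g' <;> simp [termCode, Nat.pair_eq_pair] at h
      · rw [Subsingleton.elim ts ts']
      · have h0 := ih 0 h
        congr 1
        funext i
        fin_cases i
        exact h0
      · have h0 := ih 0 h.1
        have h1 := ih 1 h.2
        congr 1
        funext i
        fin_cases i
        exacts [h0, h1]
      · have h0 := ih 0 h.1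
        have h1 := ih 1 h.2
        congr 1
        funext i
        fin_cases i
        exacts [h0, h1]

theorem formulaCode_injective {n : ℕ} :
    Function.Injective (formulaCode : arith.BoundedFormula Empty n → ℕ) := by
  intro φ
  induction φ with
  | falsum =>
    intro ψ h
    cases ψ with
    | falsum => rfl
    | rel R _ => exact R.elim
    | _ => simp [formulaCode, Nat.pair_eq_pair] at h
  | equal s t =>
    intro ψ h
    cases ψ with
    | equal s' t' =>
      simp only [formulaCode, Nat.pair_eq_pair] at h
      rw [termCode_injective h.2.1, termCode_injective h.2.2]
    | rel R _ => exact R.elim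
    | _ => simp [formulaCode, Nat.pair_eq_pair] at h
  | rel R _ => exact R.elim
  | imp φ₁ φ₂ ih₁ ih₂ =>
    intro ψ h
    cases ψ with
    | imp ψ₁ ψ₂ =>
      simp only [formulaCode, Nat.pair_eq_pair] at h
      rw [ih₁ h.2.1, ih₂ h.2.2]
    | rel R _ => exact R.elim
    | _ => simp [formulaCode, Nat.pair_eq_pair] at h
  | all φ ih =>
    intro ψ h
    cases ψ with
    | all ψ =>
      simp only [formulaCode, Nat.pair_eq_pair] at h
      rw [ih h.2]
    | rel R _ => exact R.elim
    | _ => simp [formulaCode, Nat.pair_eq_pair] at h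

/-- The numeral `S ⋯ S 0`. -/
def numeral : ℕ → arith.Term (Empty ⊕ Fin 1)
  | 0 => tZero
  | n + 1 => tSucc (numeral n)

theorem realize_numeral {M : Type} [arith.Structure M] (n : ℕ) (v : Empty ⊕ Fin 1 → M) :
    (numeral n).realize v = num M n := by
  induction n with
  | zero => exact realize_tZero v
  | succ n ih => rw [numeral, realize_tSucc, ih]; rfl

/-- The sentence `∀ x, x = n → θ(x)`. -/
noncomputable def instSentence (θ : arith.Formula Unit) (n : ℕ) : arith.Sentence :=
  BoundedFormula.all (BoundedFormula.imp (BoundedFormula.equal (Term.var (Sum.inr 0)) (numeral n))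
    (toBounded (θ.relabel fun _ => (0 : Fin 1))))

theorem realize_instSentence {M : Type} [arith.Structure M] (θ : arith.Formula Unit) (n : ℕ) :
    M ⊨ instSentence θ n ↔ θ.Realize fun _ => num M n := by
  have : ∀ x : M, (BoundedFormula.imp (BoundedFormula.equal (Term.var (Sum.inr 0)) (numeral n))
      (toBounded (θ.relabel fun _ => (0 : Fin 1)))).Realize (default : Empty → M)
        (Fin.snoc default x) ↔ (x = num M n → θ.Realize fun _ => x) := by
    intro x
    rw [BoundedFormula.realize_imp, realize_toBounded, Formula.realize_relabel]
    refine imp_congr ?_ Iff.rfl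
    change Term.realize _ _ = Term.realize _ _ ↔ _
    rw [realize_numeral]
    exact Iff.rfl
  unfold Sentence.Realize Formula.Realize instSentence
  rw [BoundedFormula.realize_all]
  refine (forall_congr' this).trans ?_
  rw [forall_eq]
  exact Iff.rfl

/-- Putting the numeral into an equation rather than substituting it leaves `θ` untouched. The code
of `θ` is then a constant, and only the code of the numeral has to be computed. -/
theorem computable_formulaCode_instSentence (θ : arith.Formula Unit) :
    Computable fun n => formulaCode (instSentence θ n) := by
  have hnum : Computable fun n => termCode (numeral n) := by
    have := Computable.nat_rec (f := fun n : ℕ => n) (g := fun _ => Nat.pair 1 0)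
      (h := fun _ p => Nat.pair 2 p.2) Computable.id (Computable.const _)
      (computable_pair.comp (Computable.const 2) (Computable.snd.comp Computable.snd)).to₂
    refine this.of_eq fun n => ?_
    induction n with
    | zero => rfl
    | succ n ih =>
      simp only [numeral, tSucc, termCode]
      exact congrArg (Nat.pair 2) ih
  have hp : ∀ {f g : ℕ → ℕ}, Computable f → Computable g →
      Computable fun n => Nat.pair (f n) (g n) := fun hf hg => computable_pair.comp hf hg
  have hc := fun c : ℕ => Computable.const (α := ℕ) c
  exact hp (hc 3) (hp (hc 2) (hp (hp (hc 1) (hp (hc (Nat.pair 0 0)) hnum)) (hc _)))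

/-- Complete consistent extensions of Peano arithmetic compute a separating function for every
partial recursive function. -/
theorem exists_separation_CPA {f : ℕ →. ℕ} (hf : Nat.Partrec f) : ∃ h : ℕ → ℕ, Computable h ∧
    ∀ z ∈ CPA, ∀ n, z (h n) < 2 ∧ (1 ∈ f n → z (h n) = 1) ∧ (0 ∈ f n → z (h n) = 0) := by
  obtain ⟨θ, hθ⟩ := exists_rosser_formula (sigmaGraph_of_partrec hf)
  refine ⟨_, computable_formulaCode_instSentence θ, ?_⟩
  rintro z ⟨T, hPA, ⟨⟨M⟩, hmax⟩, hz⟩ n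
  have hM : PeanoFacts M := peanoFacts_of_model
    ⟨fun φ hφ => Theory.realize_sentence_of_mem T (hPA hφ)⟩
  refine ⟨?_, fun h => ?_, fun h => ?_⟩
  · rcases hz (formulaCode (instSentence θ n)) with h | h <;> omega
  · refine ((hz _).resolve_right ?_).1
    rintro ⟨-, hn⟩
    -- By completeness, a sentence missing from `T` has its negation in `T`, but the sentence is
    -- true in the model `M` of `T`.
    refine hn ⟨_, (hmax _).resolve_right fun hnot => ?_, rfl⟩
    have := Theory.realize_sentence_of_mem (M := M) T hnot
    exact this ((realize_instSentence θ n).2 ((hθ M hM n).1 h))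
  · refine ((hz _).resolve_left ?_).1
    rintro ⟨-, φ, hφ, he⟩
    obtain rfl := formulaCode_injective he
    exact (hθ M hM n).2 h ((realize_instSentence θ n).1 (Theory.realize_sentence_of_mem T hφ))

/-- The standard model of arithmetic. -/
@[reducible] def standardModel : arith.Structure ℕ where
  funMap := fun {_} f => match f with
    | PeanoFunc.zero => fun _ => 0
    | PeanoFunc.succ => fun x => x 0 + 1
    | PeanoFunc.add => fun x => x 0 + x 1
    | PeanoFunc.mul => fun x => x 0 * x 1
  RelMap := fun {_} r => r.elim

/-- True arithmetic, the complete theory of the standard model, is a complete consistent extension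
of PA. -/
theorem nonempty_CPA : CPA.Nonempty := by
  classical
  let := standardModel
  have hall : ∀ {n : ℕ} (φ : arith.Formula (Fin n)), (∀ x : Fin n → ℕ, φ.Realize x) →
      ℕ ⊨ (toBounded φ).alls := by
    intro n φ h
    unfold Sentence.Realize
    rw [BoundedFormula.realize_alls]
    exact fun x => (realize_toBounded φ _ x).2 (h x)
  have h0 : mZero ℕ = 0 := rfl
  have hS : ∀ x : ℕ, mSucc x = x + 1 := fun x => rfl
  have hA : ∀ x y : ℕ, mAdd x y = x + y := fun x y => rfl
  have hM : ∀ x y : ℕ, mMul x y = x * y := fun x y => rfl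
  let T := arith.completeTheory ℕ
  refine ⟨fun m => if ∃ φ ∈ T, formulaCode φ = m then 1 else 0, T, fun φ hφ => ?_,
    completeTheory.isMaximal arith ℕ, fun m => ?_⟩
  · change ℕ ⊨ φ
    cases hφ with
    | succ_ne_zero => exact hall _ fun x => by simp [pvar, h0, hS]
    | succ_inj => exact hall _ fun x => by simp [pvar, hS]
    | add_zero => exact hall _ fun x => by simp [pvar, h0, hA]
    | add_succ => exact hall _ fun x => by simp [pvar, hS, hA, add_assoc]
    | mul_zero => exact hall _ fun x => by simp [pvar, h0, hM]
    | mul_succ => exact hall _ fun x => by simp [pvar, hS, hA, hM, mul_add]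
    | induction φ =>
      rw [realize_inductionAxiom]
      intro x hx hs y
      induction y with
      | zero => exact hx
      | succ y ih => exact hs y ih
  · by_cases h : ∃ φ ∈ T, formulaCode φ = m
    · exact Or.inl ⟨if_pos h, h⟩
    · exact Or.inr ⟨if_neg h, h⟩

end Rosser

end MassProblem

namespace MassProblem

/-! ### Binary strings and the length-lexicographic order -/

section Num

/-- The binary string `σ` is the `num σ`-th one in the length-lexicographic order. -/
def strNum (σ : List ℕ) : ℕ := σ.foldl (fun a x => 2 * a + x + 1) 0

theorem strNum_append_singleton (σ : List ℕ) (x : ℕ) : strNum (σ ++ [x]) = 2 * strNum σ + x + 1 := by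
  simp [strNum]

/-- Each binary digit doubles the interval of possible values. The numbers reached from `a` by
strings of a fixed length `l` lie between `2 ^ l * (a + 1) - 1`, inclusive, and `2 ^ l * (a + 2) -
1`, exclusive. -/
theorem foldl_num_bounds {σ : List ℕ} (hσ : ∀ x ∈ σ, x < 2) (a : ℕ) :
    2 ^ σ.length * (a + 1) ≤ σ.foldl (fun a x => 2 * a + x + 1) a + 1 ∧
      σ.foldl (fun a x => 2 * a + x + 1) a + 1 < 2 ^ σ.length * (a + 2) := by
  induction σ generalizing a with
  | nil => simp
  | cons x σ ih =>
    have hx := hσ x (by simp)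
    obtain ⟨h1, h2⟩ := ih (fun y hy => hσ y (by simp [hy])) (2 * a + x + 1)
    simp only [List.foldl_cons, List.length_cons, pow_succ]
    have hp : 0 < 2 ^ σ.length := Nat.two_pow_pos _
    constructor
    · refine le_trans ?_ h1
      rw [mul_assoc]
      exact Nat.mul_le_mul_left _ (by omega)
    · refine lt_of_lt_of_le h2 ?_
      rw [mul_assoc]
      exact Nat.mul_le_mul_left _ (by omega)

/-- At the first difference the two strings enter adjacent disjoint intervals of `foldl_num_bounds`.
-/
theorem foldl_num_lt_of_lex {σ τ : List ℕ} (hσ : ∀ x ∈ σ, x < 2) (hτ : ∀ x ∈ τ, x < 2)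
    (hl : τ.length = σ.length) (h : List.Lex (· < ·) τ σ) (a : ℕ) :
    τ.foldl (fun a x => 2 * a + x + 1) a < σ.foldl (fun a x => 2 * a + x + 1) a := by
  induction h generalizing a with
  | nil => simp at hl
  | @cons x τ σ _ ih =>
    exact ih (fun y hy => hσ y (by simp [hy])) (fun y hy => hτ y (by simp [hy]))
      (by simpa using hl) _
  | @rel x τ y σ hxy =>
    have hy := hσ y (by simp)
    obtain ⟨rfl, rfl⟩ : x = 0 ∧ y = 1 := by omega
    have h1 := (foldl_num_bounds (fun y hy => hτ y (by simp [hy]) : ∀ x ∈ τ, x < 2)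
      (2 * a + 0 + 1)).2
    have h2 := (foldl_num_bounds (fun y hy => hσ y (by simp [hy]) : ∀ x ∈ σ, x < 2)
      (2 * a + 1 + 1)).1
    simp only [List.length_cons, add_left_inj] at hl
    rw [hl] at h1
    rw [show 2 * a + 0 + 1 + 2 = 2 * a + 1 + 1 + 1 by ring] at h1
    simp only [List.foldl_cons]
    omega

theorem strNum_lt_of_shortlex {σ τ : List ℕ} (hσ : ∀ x ∈ σ, x < 2) (hτ : ∀ x ∈ τ, x < 2)
    (h : List.Shortlex (· < ·) τ σ) : strNum τ < strNum σ := by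
  rcases List.shortlex_def.1 h with h | ⟨hl, h⟩
  · have h1 := (foldl_num_bounds hτ 0).2
    have h2 := (foldl_num_bounds hσ 0).1
    have h3 : 2 ^ (τ.length + 1) ≤ 2 ^ σ.length := Nat.pow_le_pow_right (by norm_num) h
    rw [pow_succ] at h3
    unfold strNum
    omega
  · exact foldl_num_lt_of_lex hσ hτ hl h 0

theorem strNum_lt_iff {σ τ : List ℕ} (hσ : ∀ x ∈ σ, x < 2) (hτ : ∀ x ∈ τ, x < 2) :
    strNum τ < strNum σ ↔ List.Shortlex (· < ·) τ σ := by
  refine ⟨fun h => ?_, strNum_lt_of_shortlex hσ hτ⟩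
  by_contra h'
  by_cases h2 : List.Shortlex (· < ·) σ τ
  · exact absurd (strNum_lt_of_shortlex hτ hσ h2) (by omega)
  · obtain rfl := Std.Trichotomous.trichotomous (r := List.Shortlex (α := ℕ) (· < ·)) τ σ h' h2
    exact lt_irrefl _ h

/-- One step in the computation of the binary string with a given number. -/
def numStrStep (p : ℕ × List ℕ) : ℕ × List ℕ :=
  if p.1 = 0 then p else ((p.1 - 1) / 2, (p.1 - 1) % 2 :: p.2)

/-- The `m`-th binary string in the length-lexicographic order. -/
def numStr (m : ℕ) : List ℕ :=
  (Nat.rec (m, []) (fun _ p => numStrStep p) m : ℕ × List ℕ).2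

theorem computable_numStr : Computable numStr := by
  have hs : Primrec numStrStep := by
    have h1 : Primrec fun p : ℕ × List ℕ => p.1 - 1 :=
      Primrec.nat_sub.comp Primrec.fst (Primrec.const 1)
    exact Primrec.ite (Primrec.eq.comp Primrec.fst (Primrec.const 0)) Primrec.id
      ((Primrec.nat_div.comp h1 (Primrec.const 2)).pair
        (Primrec.list_cons.comp (Primrec.nat_mod.comp h1 (Primrec.const 2)) Primrec.snd))
  have := Computable.nat_rec (f := fun m : ℕ => m) (g := fun m => (m, ([] : List ℕ)))
    (h := fun _ p => numStrStep p.2) Computable.id (Computable.id.pair (Computable.const []))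
    (hs.to_comp.comp (Computable.snd.comp Computable.snd)).to₂
  exact Computable.snd.comp this

theorem iterate_numStrStep {σ : List ℕ} (hσ : ∀ x ∈ σ, x < 2) (acc : List ℕ) {k : ℕ}
    (hk : σ.length ≤ k) :
    (numStrStep^[k]) (strNum σ, acc) = (0, σ ++ acc) := by
  induction σ using List.reverseRecOn generalizing acc k with
  | nil =>
    have : ∀ k, (numStrStep^[k]) (0, acc) = (0, acc) := fun k => by
      induction k with
      | zero => rfl
      | succ k ih =>
        rw [Function.iterate_succ_apply]
        exact ih
    exact this k
  | append_singleton σ x ih =>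
    obtain ⟨k, rfl⟩ : ∃ j, k = j + 1 := ⟨k - 1, by simp at hk; omega⟩
    have hx := hσ x (by simp)
    have : numStrStep (strNum (σ ++ [x]), acc) = (strNum σ, x :: acc) := by
      unfold numStrStep
      rw [strNum_append_singleton, if_neg (by simp)]
      simp only [Nat.add_sub_cancel]
      refine Prod.ext ?_ ?_
      · change (2 * strNum σ + x) / 2 = strNum σ
        omega
      · change (2 * strNum σ + x) % 2 :: acc = x :: acc
        congr 1
        omega
    rw [Function.iterate_succ_apply, this,
      ih (fun y hy => hσ y (by simp [hy])) _ (by simpa using hk)]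
    simp

/-- This is why `numStr m` needs only `m` decoding steps. Surplus steps do nothing once the number
is 0. -/
theorem length_le_strNum (σ : List ℕ) : σ.length ≤ strNum σ := by
  induction σ using List.reverseRecOn with
  | nil => simp
  | append_singleton σ x ih =>
    rw [strNum_append_singleton]
    simp
    omega

theorem numStr_strNum {σ : List ℕ} (hσ : ∀ x ∈ σ, x < 2) : numStr (strNum σ) = σ := by
  have : ∀ (p : ℕ × List ℕ) k, (Nat.rec p (fun _ p => numStrStep p) k : ℕ × List ℕ) =
      (numStrStep^[k]) p := fun p k => by
    induction k with
    | zero => rfl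
    | succ k ih => rw [Function.iterate_succ_apply', ← ih]
  rw [numStr, this, iterate_numStrStep hσ [] (length_le_strNum σ)]
  simp

theorem exists_strNum_eq (m : ℕ) : ∃ σ : List ℕ, (∀ x ∈ σ, x < 2) ∧ strNum σ = m := by
  induction m using Nat.strong_induction_on with
  | _ m ih =>
    cases m with
    | zero => exact ⟨[], by simp, rfl⟩
    | succ m =>
      obtain ⟨σ, h1, h2⟩ := ih (m / 2) (by omega)
      refine ⟨σ ++ [m % 2], ?_, ?_⟩
      · intro x hx
        rcases List.mem_append.1 hx with hx | hx
        · exact h1 x hx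
        · rw [List.mem_singleton.1 hx]
          omega
      · rw [strNum_append_singleton, h2]
        omega

theorem numStr_lt (m : ℕ) : ∀ x ∈ numStr m, x < 2 := by
  obtain ⟨σ, h1, rfl⟩ := exists_strNum_eq m
  rwa [numStr_strNum h1]

theorem strNum_numStr (m : ℕ) : strNum (numStr m) = m := by
  obtain ⟨σ, h1, rfl⟩ := exists_strNum_eq m
  rw [numStr_strNum h1]

end Num

/-! ### Leaves of a computable tree -/

section Leaves

variable {C : Set (List ℕ)}

/-- Only the two immediate children have to be tested, which makes being a leaf decidable. -/
theorem mem_leaves_iff (hC : IsBinaryTree C) {σ : List ℕ} :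
    σ ∈ leaves C ↔ σ ∈ C ∧ σ ++ [0] ∉ C ∧ σ ++ [1] ∉ C := by
  constructor
  · rintro ⟨h1, h2⟩
    exact ⟨h1, fun h => by simpa using h2 _ h (List.prefix_append _ _),
      fun h => by simpa using h2 _ h (List.prefix_append _ _)⟩
  · rintro ⟨h1, h2, h3⟩
    refine ⟨h1, fun τ hτ hp => ?_⟩
    obtain ⟨ρ, rfl⟩ := hp
    cases ρ with
    | nil => simp
    | cons x ρ =>
      exfalso
      have hx := hC.1 _ hτ x (by simp)
      have : σ ++ [x] ∈ C := hC.2 _ hτ _ ⟨ρ, by simp⟩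
      interval_cases x
      exacts [h2 this, h3 this]

theorem computablePred_leaves (hC : IsComputableTree C) : ComputablePred fun σ => σ ∈ leaves C := by
  have hsnoc : ∀ x : ℕ, ComputablePred fun σ : List ℕ => σ ++ [x] ∈ C := fun x =>
    hC.2.comp' (Computable.list_concat.comp Computable.id (Computable.const x))
  exact (hC.2.and' ((hsnoc 0).not.and' (hsnoc 1).not)).of_eq fun σ => (mem_leaves_iff hC.1).symm

theorem leaves_eq_of_prefix {σ τ ρ : List ℕ} (hσ : σ ∈ leaves C) (hτ : τ ∈ leaves C)
    (h1 : σ <+: ρ) (h2 : τ <+: ρ) : σ = τ := by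
  rcases List.prefix_or_prefix_of_prefix h1 h2 with h | h
  · exact (hσ.2 τ hτ.1 h).symm
  · exact hτ.2 σ hσ.1 h

open Classical in
/-- The position of a leaf in the length-lexicographic order. -/
noncomputable def leafIndex (C : Set (List ℕ)) (σ : List ℕ) : ℕ :=
  Nat.count (fun m => numStr m ∈ leaves C) (strNum σ)

theorem computable_leafIndex (hC : IsComputableTree C) : Computable (leafIndex C) := by
  classical
  have hnum : Computable strNum := by
    refine computable_foldl (f := fun σ : List ℕ => σ) (g := fun _ => 0)
      (h := fun _ p => 2 * p.1 + p.2 + 1) Computable.id (Computable.const 0) ?_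
    exact (Primrec.succ.comp (Primrec.nat_add.comp (Primrec.nat_mul.comp (Primrec.const 2)
      (Primrec.fst.comp Primrec.snd)) (Primrec.snd.comp Primrec.snd))).to_comp.to₂
  have hstep : Computable fun q : List ℕ × ℕ × ℕ =>
      if numStr q.2.1 ∈ leaves C then q.2.2 + 1 else q.2.2 :=
    ComputablePred.ite' ((computablePred_leaves hC).comp' (computable_numStr.comp
        (Computable.fst.comp Computable.snd)))
      (Computable.succ.comp (Computable.snd.comp Computable.snd))
      (Computable.snd.comp Computable.snd)
  refine (Computable.nat_rec hnum (Computable.const 0) hstep.to₂).of_eq fun σ => ?_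
  unfold leafIndex
  generalize strNum σ = m
  induction m with
  | zero => rfl
  | succ m ih =>
    rw [Nat.count_succ, ← ih]
    dsimp only
    split_ifs <;> rfl

/-- The numbering `numStr` respects the length-lexicographic order, so the cardinality in
`IsNthLeaf` is the computable count `leafIndex`. -/
theorem isNthLeaf_iff (hC : IsBinaryTree C) {n : ℕ} {σ : List ℕ} :
    IsNthLeaf C n σ ↔ σ ∈ leaves C ∧ leafIndex C σ = n := by
  classical
  refine and_congr_right fun hσ => ?_
  have hb : ∀ τ ∈ leaves C, ∀ x ∈ τ, x < 2 := fun τ hτ => hC.1 τ hτ.1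
  have : {τ ∈ leaves C | List.Shortlex (· < ·) τ σ} =
      numStr '' (({m ∈ Finset.range (strNum σ) | numStr m ∈ leaves C} : Finset ℕ) : Set ℕ) := by
    ext τ
    simp only [Set.mem_ofPred_eq, Finset.coe_filter, Finset.mem_range, Set.mem_image]
    constructor
    · rintro ⟨h1, h2⟩
      exact ⟨strNum τ, ⟨strNum_lt_of_shortlex (hb σ hσ) (hb τ h1) h2,
        by rwa [numStr_strNum (hb τ h1)]⟩, numStr_strNum (hb τ h1)⟩
    · rintro ⟨m, ⟨h1, h2⟩, rfl⟩
      refine ⟨h2, (strNum_lt_iff (hb σ hσ) (numStr_lt m)).1 ?_⟩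
      rwa [strNum_numStr]
  rw [this, Set.ncard_image_of_injective _ (fun a b h => by
    rw [← strNum_numStr a, h, strNum_numStr]), Set.ncard_coe_finset, leafIndex,
    Nat.count_eq_card_filter_range]

theorem exists_isNthLeaf (hC : IsBinaryTree C) (h : (leaves C).Infinite) (n : ℕ) :
    ∃ σ, IsNthLeaf C n σ := by
  classical
  have hb : ∀ τ ∈ leaves C, ∀ x ∈ τ, x < 2 := fun τ hτ => hC.1 τ hτ.1
  have hinf : (Set.ofPred fun m => numStr m ∈ leaves C).Infinite := by
    intro hfin
    refine h ((hfin.image numStr).subset fun σ hσ => ⟨strNum σ, ?_, numStr_strNum (hb σ hσ)⟩)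
    change numStr (strNum σ) ∈ leaves C
    rwa [numStr_strNum (hb σ hσ)]
  refine ⟨numStr (Nat.nth (fun m => numStr m ∈ leaves C) n), (isNthLeaf_iff hC).2
    ⟨Nat.nth_mem_of_infinite hinf n, ?_⟩⟩
  rw [leafIndex, strNum_numStr, Nat.count_nth_of_infinite hinf]

/-- A computable tree with finitely many leaves has a computable path. -/
theorem infinite_leaves (hC : IsComputableTree C) (hne : (paths C).Nonempty)
    (hnc : ∀ f ∈ paths C, ¬ Computable f) : (leaves C).Infinite := by
  classical
  intro hfin
  obtain ⟨g, hg⟩ := hne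
  obtain ⟨N, hN⟩ : ∃ N, ∀ σ ∈ leaves C, σ.length < N :=
    ⟨(hfin.toFinset.sup List.length) + 1, fun σ hσ =>
      Nat.lt_succ_of_le (Finset.le_sup (f := List.length) (hfin.mem_toFinset.2 hσ))⟩
  -- From length `N` on there are no leaves, so each node has a child in the tree and the leftmost
  -- one can be chosen computably.
  let next : List ℕ → List ℕ := fun σ => if σ ++ [0] ∈ C then σ ++ [0] else σ ++ [1]
  let s : ℕ → List ℕ := fun k => Nat.rec (initSeg g N) (fun _ σ => next σ) k
  have hsnoc : ∀ x : ℕ, Computable fun σ : List ℕ => σ ++ [x] := fun x =>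
    Computable.list_concat.comp Computable.id (Computable.const x)
  have hnext : Computable next := ComputablePred.ite' (hC.2.comp' (hsnoc 0)) (hsnoc 0) (hsnoc 1)
  have hs : Computable s := by
    have := Computable.nat_rec (f := fun m : ℕ => m) (g := fun _ => initSeg g N)
      (h := fun _ p => next p.2) Computable.id (Computable.const _)
      (hnext.comp (Computable.snd.comp Computable.snd)).to₂
    exact this
  have hlen : ∀ k, (s k).length = N + k := by
    intro k
    induction k with
    | zero => simp [s]
    | succ k ih =>
      change (next (s k)).length = _
      simp only [next]
      split_ifs <;> simp [ih, add_assoc]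
  have hmem : ∀ k, s k ∈ C := by
    intro k
    induction k with
    | zero => exact hg N
    | succ k ih =>
      change next (s k) ∈ C
      simp only [next]
      split_ifs with h0
      · exact h0
      · by_contra h1
        have := hN _ ((mem_leaves_iff hC.1).2 ⟨ih, h0, h1⟩)
        rw [hlen] at this
        omega
  obtain ⟨f, hf⟩ := exists_limit (s := s) (fun k => by
    change s k <+: next (s k)
    simp only [next]
    split_ifs <;> exact List.prefix_append _ _)
    (tendsto_atTop.2 fun m => eventually_atTop.2 ⟨m, fun k hk => by rw [hlen]; omega⟩)
  refine hnc f (fun n => ?_) ?_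
  · refine hC.1.2 (s n) (hmem n) _ ?_
    rw [← hf n]
    exact initSeg_prefix f (by rw [hlen]; omega)
  · refine ((computable_getD 0).comp (hs.comp Computable.succ) Computable.id).of_eq fun k => ?_
    exact (hf (k + 1)).getD (k := k)
      (lt_of_lt_of_eq (by omega) (hlen (k + 1)).symm) 0

end Leaves

/-! ### Infinitary concatenations -/

section InfConcat

variable {C : Set (List ℕ)}

theorem mem_infConcat_iff (hC : IsBinaryTree C) {Q : ℕ → Set Baire} {f : Baire} :
    f ∈ infConcat C Q ↔
      f ∈ paths C ∨ ∃ ρ ∈ leaves C, ∃ g ∈ Q (leafIndex C ρ), f = concat ρ g := by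
  refine or_congr_right ⟨?_, ?_⟩
  · rintro ⟨n, ρ, hρ, h⟩
    obtain ⟨h1, rfl⟩ := (isNthLeaf_iff hC).1 hρ
    exact ⟨ρ, h1, h⟩
  · rintro ⟨ρ, hρ, h⟩
    exact ⟨_, ρ, (isNthLeaf_iff hC).2 ⟨hρ, rfl⟩, h⟩

theorem flatMap_range_eq {f : ℕ → List ℕ} {n k : ℕ} (hk : k < n)
    (h : ∀ j < n, j ≠ k → f j = []) :
    (List.range n).flatMap f = f k := by
  induction n with
  | zero => omega
  | succ n ih =>
    rw [List.range_succ, List.flatMap_append, List.flatMap_singleton]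
    rcases Nat.lt_succ_iff_lt_or_eq.1 hk with hk | rfl
    · rw [ih hk fun j hj => h j (by omega), h n (by omega) (by omega), List.append_nil]
    · rw [List.flatMap_eq_nil_iff.2 fun j hj => by
        have := List.mem_range.1 hj
        exact h j (by omega) (by omega), List.nil_append]

open Classical in
/-- Apply `E n` after the `n`-th leaf. -/
noncomputable def afterLeaf (C : Set (List ℕ)) (E : ℕ → List ℕ → List ℕ) (σ : List ℕ) : List ℕ :=
  if ∃ k < σ.length + 1, σ.take k ∈ leaves C then
    (List.range (σ.length + 1)).flatMap fun k =>
      if σ.take k ∈ leaves C then σ.take k ++ E (leafIndex C (σ.take k)) (σ.drop k) else []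
  else σ

theorem computable_afterLeaf (hC : IsComputableTree C) {E : ℕ → List ℕ → List ℕ}
    (hE : Computable₂ E) : Computable (afterLeaf C E) := by
  classical
  have ht : Computable fun p : List ℕ × ℕ => p.1.take p.2 :=
    computable_take.comp Computable.snd Computable.fst
  have hd : Computable fun p : List ℕ × ℕ => p.1.drop p.2 :=
    computable_drop.comp Computable.snd Computable.fst
  have hleaf := (computablePred_leaves hC).comp' ht
  have hlen : Computable fun σ : List ℕ => σ.length + 1 :=
    Computable.succ.comp Computable.list_length
  have happ : Computable fun p : List ℕ × ℕ =>
      p.1.take p.2 ++ E (leafIndex C (p.1.take p.2)) (p.1.drop p.2) :=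
    Computable.list_append.comp ht (hE.comp ((computable_leafIndex hC).comp ht) hd)
  refine (ComputablePred.ite'
    (ComputablePred.bex_lt (p := fun σ k => σ.take k ∈ leaves C) hleaf hlen)
    (computable_flatMap (Primrec.list_range.to_comp.comp hlen)
      (ComputablePred.ite' hleaf happ (Computable.const [])).to₂) Computable.id).of_eq fun σ => ?_
  unfold afterLeaf
  congr

/-- Leaves are pairwise incomparable, so a string has at most one leaf as a prefix and only one term
of the concatenation is nonempty. -/
theorem afterLeaf_append {E : ℕ → List ℕ → List ℕ} {ρ : List ℕ} (hρ : ρ ∈ leaves C) (τ : List ℕ) :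
    afterLeaf C E (ρ ++ τ) = ρ ++ E (leafIndex C ρ) τ := by
  classical
  rw [afterLeaf, if_pos ⟨ρ.length, by simp, by simpa using hρ⟩,
    flatMap_range_eq (k := ρ.length) (by simp)]
  · simp [hρ]
  · intro j hj hne
    refine if_neg fun h => hne ?_
    have := congrArg List.length (leaves_eq_of_prefix h hρ (List.take_prefix _ _)
      (List.prefix_append _ _))
    rw [List.length_take] at this
    rw [min_eq_left (by omega)] at this
    exact this

theorem afterLeaf_of_forall {E : ℕ → List ℕ → List ℕ} {σ : List ℕ}
    (h : ∀ τ ∈ leaves C, ¬ τ <+: σ) : afterLeaf C E σ = σ := by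
  classical
  exact if_neg fun ⟨k, _, hk⟩ => h _ hk (List.take_prefix _ _)

theorem not_prefix_of_mem_paths {f : Baire} (hf : f ∈ paths C) {τ : List ℕ} (hτ : τ ∈ leaves C)
    (n : ℕ) : ¬ τ <+: initSeg f n := by
  intro h
  have h1 := isInit_of_prefix_initSeg h
  have h2 := hf (τ.length + 1)
  rw [initSeg_succ, h1] at h2
  simpa using hτ.2 _ h2 (List.prefix_append _ _)

theorem redBy_afterLeaf_path {E : ℕ → List ℕ → List ℕ} {f : Baire} (hf : f ∈ paths C) :
    RedBy (afterLeaf C E) f f := by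
  have : ∀ n, afterLeaf C E (initSeg f n) = initSeg f n := fun n =>
    afterLeaf_of_forall fun τ hτ => not_prefix_of_mem_paths hf hτ n
  refine ⟨fun n => ?_, ?_⟩
  · rw [this]
    exact isInit_initSeg f n
  · simp only [this, length_initSeg]
    exact tendsto_id

theorem redBy_afterLeaf_concat {E : ℕ → List ℕ → List ℕ} {ρ : List ℕ} (hρ : ρ ∈ leaves C)
    {g h : Baire} (hg : RedBy (E (leafIndex C ρ)) g h) :
    RedBy (afterLeaf C E) (concat ρ g) (concat ρ h) := by
  have hval : ∀ n, afterLeaf C E (initSeg (concat ρ g) (ρ.length + n)) =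
      ρ ++ E (leafIndex C ρ) (initSeg g n) := fun n => by
    rw [initSeg_concat_add, afterLeaf_append hρ]
  have happ : ∀ n, IsInit (ρ ++ E (leafIndex C ρ) (initSeg g n)) (concat ρ h) := by
    intro n
    rw [IsInit, List.length_append, initSeg_concat_add, hg.1 n]
  refine ⟨fun n => ?_, ?_⟩
  · rcases lt_or_ge n ρ.length with hn | hn
    -- Before the leaf is complete, the string is copied unchanged.
    · rw [afterLeaf_of_forall]
      · have h2 := (isInit_initSeg (concat ρ g) n).prefix_of_le (isInit_concat ρ g)
          (by simpa using hn.le)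
        exact (isInit_concat ρ h).of_prefix h2
      · intro τ hτ hp
        have h2 := (isInit_initSeg (concat ρ g) n).prefix_of_le (isInit_concat ρ g)
          (by simpa using hn.le)
        obtain rfl := leaves_eq_of_prefix hτ hρ (hp.trans h2) List.prefix_rfl
        have := hp.length_le
        simp at this
        omega
    · obtain ⟨k, rfl⟩ := Nat.exists_eq_add_of_le hn
      rw [hval]
      exact happ k
  · refine (tendsto_add_atTop_iff_nat ρ.length).1 ?_
    have : ∀ n, (afterLeaf C E (initSeg (concat ρ g) (n + ρ.length))).length =
        ρ.length + (E (leafIndex C ρ) (initSeg g n)).length := fun n => by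
      rw [add_comm n, hval, List.length_append]
    simp only [this]
    exact tendsto_atTop_mono (fun n => Nat.le_add_left _ _) hg.2

/-- Infinitary concatenations are monotone, with respect to a uniform reduction. -/
theorem redBy_infConcat (hC : IsBinaryTree C) {E : ℕ → List ℕ → List ℕ}
    {Q S : ℕ → Set Baire} (h : ∀ n, ∀ g ∈ Q n, ∃ y ∈ S n, RedBy (E n) g y) {f : Baire}
    (hf : f ∈ infConcat C Q) : ∃ y ∈ infConcat C S, RedBy (afterLeaf C E) f y := by
  rcases (mem_infConcat_iff hC).1 hf with hf | ⟨ρ, hρ, g, hg, rfl⟩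
  · exact ⟨f, Or.inl hf, redBy_afterLeaf_path hf⟩
  · obtain ⟨y, hy, hgy⟩ := h _ g hg
    exact ⟨_, (mem_infConcat_iff hC).2 (Or.inr ⟨ρ, hρ, y, hy, rfl⟩), redBy_afterLeaf_concat hρ hgy⟩

/-- The tree of an infinitary concatenation. -/
def infConcatTree (C : Set (List ℕ)) (T : ℕ → Set (List ℕ)) : Set (List ℕ) :=
  {σ | (∀ x ∈ σ, x < 2) ∧
    (∀ k < σ.length + 1, σ.take k ∈ leaves C → σ.drop k ∈ T (leafIndex C (σ.take k))) ∧
    (σ ∈ C ∨ ∃ k < σ.length + 1, σ.take k ∈ leaves C)}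

theorem isBinaryTree_infConcatTree (hC : IsBinaryTree C) {T : ℕ → Set (List ℕ)}
    (hT : ∀ n, IsBinaryTree (T n)) : IsBinaryTree (infConcatTree C T) := by
  refine ⟨fun σ hσ => hσ.1, ?_⟩
  rintro σ ⟨h1, h2, h3⟩ τ hp
  obtain ⟨ρ, rfl⟩ := hp
  refine ⟨fun x hx => h1 x (List.mem_append_left _ hx), fun k hk hl => ?_, ?_⟩
  · have hk' : k ≤ τ.length := by omega
    have h := h2 k (by rw [List.length_append]; omega)
    rw [List.take_append_of_le_length hk', List.drop_append_of_le_length hk'] at h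
    exact (hT _).2 _ (h hl) _ (List.prefix_append _ _)
  · rcases h3 with h3 | ⟨k, hk, hl⟩
    · exact Or.inl (hC.2 _ h3 _ (List.prefix_append _ _))
    · rcases le_or_gt k τ.length with hk' | hk'
      · rw [List.take_append_of_le_length hk'] at hl
        exact Or.inr ⟨k, by omega, hl⟩
      -- A leaf longer than `τ` extends `τ`, so `τ` itself lies in the tree.
      · left
        refine hC.2 _ hl.1 _ ?_
        rw [List.take_append, List.take_of_length_le hk'.le]
        exact List.prefix_append _ _

theorem isComputableTree_infConcatTree (hC : IsComputableTree C) {T : ℕ → Set (List ℕ)}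
    (hT : IsComputableTreeSeq T) : IsComputableTree (infConcatTree C T) := by
  refine ⟨isBinaryTree_infConcatTree hC.1 hT.1, ?_⟩
  have ht : Computable fun p : List ℕ × ℕ => p.1.take p.2 :=
    computable_take.comp Computable.snd Computable.fst
  have hd : Computable fun p : List ℕ × ℕ => p.1.drop p.2 :=
    computable_drop.comp Computable.snd Computable.fst
  have hleaf := (computablePred_leaves hC).comp' ht
  have hlen : Computable fun σ : List ℕ => σ.length + 1 :=
    Computable.succ.comp Computable.list_length
  refine ComputablePred.and' ?_ (ComputablePred.and' ?_ (ComputablePred.or' hC.2 ?_))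
  · exact ComputablePred.ball_list (p := fun (_ : List ℕ) x => x < 2)
      (ComputablePred.lt' Computable.snd (Computable.const 2)) Computable.id
  · exact ComputablePred.ball_lt (p := fun (σ : List ℕ) k => σ.take k ∈ leaves C →
      σ.drop k ∈ T (leafIndex C (σ.take k))) (hleaf.imp' (hT.2.comp'
        (((computable_leafIndex hC).comp ht).pair hd))) hlen
  · exact ComputablePred.bex_lt (p := fun (σ : List ℕ) k => σ.take k ∈ leaves C) hleaf hlen

theorem paths_infConcatTree (hC : IsBinaryTree C) {T : ℕ → Set (List ℕ)}
    (hT : ∀ n, IsBinaryTree (T n)) :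
    paths (infConcatTree C T) = infConcat C fun n => paths (T n) := by
  ext f
  rw [mem_infConcat_iff hC]
  constructor
  · intro hf
    by_cases h : ∃ k, initSeg f k ∈ leaves C
    · obtain ⟨k, hk⟩ := h
      refine Or.inr ⟨_, hk, fun m => f (k + m), fun n => ?_, ?_⟩
      · have := (hf (k + n)).2.1 k (by simp)
        rw [take_initSeg, min_eq_left (by omega), initSeg_add, List.drop_left' (by simp)] at this
        exact this hk
      · have := concat_drop (isInit_initSeg f k)
        rw [length_initSeg] at this
        exact this.symm
    · refine Or.inl fun n => (hf n).2.2.resolve_right ?_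
      rintro ⟨k, _, hk⟩
      rw [take_initSeg] at hk
      exact h ⟨_, hk⟩
  · rintro (hf | ⟨ρ, hρ, g, hg, rfl⟩)
    · exact fun n => ⟨hC.1 _ (hf n), fun k _ hk =>
        (not_prefix_of_mem_paths hf hk n (List.take_prefix _ _)).elim, Or.inl (hf n)⟩
    · have hmem : ∀ n, initSeg (concat ρ g) (ρ.length + n) ∈ infConcatTree C T := by
        intro n
        rw [initSeg_concat_add]
        refine ⟨fun x hx => ?_, fun k hk hl => ?_, Or.inr ⟨ρ.length, by simp, by simpa⟩⟩
        · rcases List.mem_append.1 hx with hx | hx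
          · exact hC.1 _ hρ.1 x hx
          · exact (hT _).1 _ (hg n) x hx
        · have he := leaves_eq_of_prefix hl hρ (List.take_prefix _ _) (List.prefix_append _ _)
          have hk' : k = ρ.length := by
            have := congrArg List.length he
            rw [List.length_take, min_eq_left (by omega)] at this
            exact this
          subst hk'
          rw [he, List.drop_left' rfl]
          exact hg n
      intro n
      exact (isBinaryTree_infConcatTree hC hT).2 _ (hmem n) _ (initSeg_prefix _ (by omega))

end InfConcat

/-! ### Turing reducibility -/

section TuringReducible

theorem _root_.Nat.RecursiveIn.pair_some {O : Set (ℕ →. ℕ)} {f g : ℕ → ℕ}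
    (hf : Nat.RecursiveIn O fun n => Part.some (f n))
    (hg : Nat.RecursiveIn O fun n => Part.some (g n)) :
    Nat.RecursiveIn O fun n => Part.some (Nat.pair (f n) (g n)) :=
  (Nat.RecursiveIn.pair hf hg).of_eq fun n => by simp [Seq.seq]

theorem _root_.Nat.RecursiveIn.comp_some {O : Set (ℕ →. ℕ)} {f : ℕ →. ℕ} {g : ℕ → ℕ}
    (hf : Nat.RecursiveIn O f) (hg : Nat.RecursiveIn O fun n => Part.some (g n)) :
    Nat.RecursiveIn O fun n => f (g n) :=
  (Nat.RecursiveIn.comp hf hg).of_eq fun _ => Part.bind_some _ _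

theorem _root_.Nat.RecursiveIn.of_computable {O : Set (ℕ →. ℕ)} {f : ℕ → ℕ} (hf : Computable f) :
    Nat.RecursiveIn O fun n => Part.some (f n) :=
  Nat.Partrec.recursiveIn (Partrec.nat_iff.1 hf)

/-- Codes of initial segments of `x` are built by primitive recursion from the oracle. The
computation searches for a segment on which `F` is long enough and reads off the required entry. -/
theorem turingReducible_of_red {x y : Baire} (h : Red y x) :
    TuringReducible (y : ℕ →. ℕ) (x : ℕ →. ℕ) := by
  classical
  obtain ⟨F, hF, h1, h2⟩ := h
  refine RecursiveIn.iff_nat.2 ?_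
  set O : Set (ℕ →. ℕ) := {(x : ℕ →. ℕ)} with hO
  have hx : Nat.RecursiveIn O fun n => Part.some (x n) := Nat.RecursiveIn.oracle _ rfl
  have hl : Nat.RecursiveIn O fun n => Part.some n.unpair.1 := Nat.RecursiveIn.left
  have hr : Nat.RecursiveIn O fun n => Part.some n.unpair.2 := Nat.RecursiveIn.right
  have hid : Nat.RecursiveIn O fun n => Part.some n := Nat.RecursiveIn.of_computable Computable.id
  have hdec : Computable fun n : ℕ => Denumerable.ofNat (List ℕ) n := Computable.ofNat _
  have hsnoc : Computable fun n : ℕ => Encodable.encode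
      (Denumerable.ofNat (List ℕ) n.unpair.1 ++ [n.unpair.2]) :=
    Computable.encode.comp (Computable.list_concat.comp (hdec.comp computable_unpair_fst)
      computable_unpair_snd)
  have hseg : Nat.RecursiveIn O fun n => Part.some (Encodable.encode (initSeg x n)) := by
    have step : Nat.RecursiveIn O fun p : ℕ => Part.some (Encodable.encode
        (Denumerable.ofNat (List ℕ) p.unpair.2.unpair.2 ++ [x p.unpair.2.unpair.1])) := by
      have := (Nat.RecursiveIn.of_computable hsnoc).comp_some
        ((hr.comp_some hr).pair_some (hx.comp_some (hl.comp_some hr)))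
      refine this.of_eq fun p => ?_
      simp
    have := (Nat.RecursiveIn.prec (Nat.RecursiveIn.of_computable (Computable.const
      (Encodable.encode ([] : List ℕ)))) step).comp_some
        ((Nat.RecursiveIn.of_computable (Computable.const 0)).pair_some hid)
    refine this.of_eq fun n => ?_
    simp only [Nat.unpair_pair]
    induction n with
    | zero => rfl
    | succ n ih =>
      change Part.bind _ _ = _
      rw [ih, Part.bind_some, initSeg_succ]
      simp
  have hq : Nat.RecursiveIn O fun n => Part.some (Nat.pair n.unpair.1
      (Encodable.encode (initSeg x n.unpair.2))) := hl.pair_some (hseg.comp_some hr)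
  have hval : Computable fun n : ℕ => (F (Denumerable.ofNat (List ℕ) n.unpair.2)).getD n.unpair.1 0 :=
    (computable_getD 0).comp (hF.comp (hdec.comp computable_unpair_snd)) computable_unpair_fst
  have htest : Computable fun n : ℕ =>
      if n.unpair.1 < (F (Denumerable.ofNat (List ℕ) n.unpair.2)).length then 0 else 1 :=
    (ComputablePred.ite' (ComputablePred.lt' computable_unpair_fst (Computable.list_length.comp
      (hF.comp (hdec.comp computable_unpair_snd)))) (Computable.const 0)
      (Computable.const 1)).of_eq fun n => by split_ifs <;> rfl
  have hfind := Nat.RecursiveIn.rfind ((Nat.RecursiveIn.of_computable htest).comp_some hq)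
  have hres := ((Nat.RecursiveIn.of_computable hval).comp_some hq).comp
    (Nat.RecursiveIn.pair hid hfind)
  refine hres.of_eq_tot fun n => ?_
  obtain ⟨N, hN⟩ := (h2.eventually (eventually_gt_atTop n)).exists
  have hdom : ∃ m, m ∈ Nat.rfind fun m => ((Part.some (if n < (F (initSeg x m)).length then 0 else 1)
      : Part ℕ).map fun k => decide (k = 0)) := by
    refine Part.dom_iff_mem.1 (Nat.rfind_dom.2 ⟨N, ?_, fun _ => trivial⟩)
    simp [hN]
  obtain ⟨m, hm⟩ := hdom
  have hlt : n < (F (initSeg x m)).length := by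
    have := Nat.rfind_spec hm
    simpa using this
  refine Part.mem_bind_iff.2 ⟨Nat.pair n m, ?_, ?_⟩
  · simp only [Seq.seq, Part.map_eq_map, Part.map_some, Part.bind_some, Nat.unpair_pair,
      Denumerable.ofNat_encode, Part.mem_map_iff]
    exact ⟨m, hm, rfl⟩
  · simp only [Nat.unpair_pair, Denumerable.ofNat_encode, Part.mem_some_iff]
    exact ((h1 m).getD hlt 0).symm

end TuringReducible

end MassProblem

namespace MassProblem

/-! ### The sequence of sets -/

section Sequence

/-- The tree of all binary strings that respect the enumerated bits `L`. -/
def constraintTree (L : ℕ → List (ℕ × ℕ)) : Set (List ℕ) :=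
  {σ | (∀ x ∈ σ, x < 2) ∧ ∀ p ∈ L σ.length, p.1 < σ.length → σ.getD p.1 0 = p.2}

theorem isBinaryTree_constraintTree {L : ℕ → List (ℕ × ℕ)}
    (hL : ∀ s t, s ≤ t → ∀ p ∈ L s, p ∈ L t) : IsBinaryTree (constraintTree L) := by
  refine ⟨fun σ hσ => hσ.1, ?_⟩
  rintro σ ⟨h1, h2⟩ τ ⟨ρ, rfl⟩
  refine ⟨fun x hx => h1 x (List.mem_append_left _ hx), fun p hp hl => ?_⟩
  have := h2 p (hL _ _ (by simp) p hp) (by rw [List.length_append]; omega)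
  rwa [List.getD_append _ _ _ _ hl] at this

/-- A string is tested only against the bits enumerated by the stage equal to its length, which
keeps the tree computable. Along an infinite path every enumerated bit is tested eventually. -/
theorem mem_paths_constraintTree {L : ℕ → List (ℕ × ℕ)} (hL : ∀ s t, s ≤ t → ∀ p ∈ L s, p ∈ L t)
    {y : Baire} :
    y ∈ paths (constraintTree L) ↔ (∀ k, y k < 2) ∧ ∀ s, ∀ p ∈ L s, y p.1 = p.2 := by
  constructor
  · intro h
    refine ⟨fun k => (h (k + 1)).1 _ ?_, fun s p hp => ?_⟩
    · rw [initSeg_succ]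
      simp
    · have := (h (max s (p.1 + 1))).2 p (hL _ _ (by simp) p hp) (by simp)
      rwa [getD_initSeg _ (by simp)] at this
  · rintro ⟨h1, h2⟩ n
    refine ⟨fun x hx => ?_, fun p hp hl => ?_⟩
    · obtain ⟨k, -, rfl⟩ := List.mem_map.1 hx
      exact h1 k
    · rw [getD_initSeg _ (by simpa using hl)]
      exact h2 _ p hp

theorem computablePred_constraintTree {L : ℕ → ℕ → List (ℕ × ℕ)} (hL : Computable₂ L) :
    ComputablePred fun p : ℕ × List ℕ => p.2 ∈ constraintTree (L p.1) := by
  refine ComputablePred.and' ?_ ?_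
  · exact ComputablePred.ball_list (p := fun (_ : ℕ × List ℕ) x => x < 2)
      (ComputablePred.lt' Computable.snd (Computable.const 2)) Computable.snd
  · have hlen : Computable fun p : (ℕ × List ℕ) × ℕ × ℕ => p.1.2.length :=
      Computable.list_length.comp (Computable.snd.comp Computable.fst)
    have hpos : Computable fun p : (ℕ × List ℕ) × ℕ × ℕ => p.2.1 :=
      Computable.fst.comp Computable.snd
    refine ComputablePred.ball_list (p := fun (p : ℕ × List ℕ) (q : ℕ × ℕ) =>
      q.1 < p.2.length → p.2.getD q.1 0 = q.2) ?_
      (hL.comp Computable.fst (Computable.list_length.comp Computable.snd))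
    exact (ComputablePred.lt' hpos hlen).imp' (ComputablePred.eq' ((computable_getD 0).comp
      (Computable.snd.comp Computable.fst) hpos) (Computable.snd.comp Computable.snd))

/-- The enumerated bits of the column `n`. -/
def colFixed (fixed : ℕ → List (ℕ × ℕ)) (n s : ℕ) : List (ℕ × ℕ) :=
  (fixed s).flatMap fun p => if p.1.unpair.1 = n then [(p.1.unpair.2, p.2)] else []

theorem mem_colFixed {fixed : ℕ → List (ℕ × ℕ)} {n s k v : ℕ} :
    (k, v) ∈ colFixed fixed n s ↔ (Nat.pair n k, v) ∈ fixed s := by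
  simp only [colFixed, List.mem_flatMap]
  constructor
  · rintro ⟨p, hp, h⟩
    split_ifs at h with hn
    · simp only [List.mem_singleton, Prod.mk.injEq] at h
      rw [← hn, h.1, h.2, Nat.pair_unpair]
      exact hp
    · simp at h
  · intro h
    exact ⟨_, h, by simp⟩

theorem computable_colFixed {fixed : ℕ → List (ℕ × ℕ)} (h : Computable fixed) :
    Computable₂ (colFixed fixed) := by
  have hq : Computable fun p : (ℕ × ℕ) × ℕ × ℕ => p.2.1 := Computable.fst.comp Computable.snd
  have hv : Computable fun p : (ℕ × ℕ) × ℕ × ℕ => p.2.2 := Computable.snd.comp Computable.snd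
  refine computable_flatMap (f := fun p : ℕ × ℕ => fixed p.2) (g := fun p (q : ℕ × ℕ) =>
    if q.1.unpair.1 = p.1 then [(q.1.unpair.2, q.2)] else []) (h.comp Computable.snd) ?_
  refine (ComputablePred.ite' (ComputablePred.eq' (computable_unpair_fst.comp hq)
    (Computable.fst.comp Computable.fst)) (Computable.list_cons.comp
      ((computable_unpair_snd.comp hq).pair hv) (Computable.const [])) (Computable.const [])).of_eq
      fun p => ?_
  dsimp only
  split_ifs <;> rfl

theorem col_red (n : ℕ) (w : Baire) : Red (col n w) w :=
  red_of_comp (computable_pair.comp (Computable.const n) Computable.id) w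

/-- Every complete consistent extension of Peano arithmetic computes a point that respects the
enumerated bits. -/
theorem exists_red_of_mem_CPA {fixed : ℕ → List (ℕ × ℕ)} (hfix : Computable fixed)
    (hmono : ∀ s t, s ≤ t → ∀ p ∈ fixed s, p ∈ fixed t) {ζ : Baire} (hb : ∀ q, ζ q < 2)
    (hζ : ∀ s, ∀ p ∈ fixed s, ζ p.1 = p.2) {z : Baire} (hz : z ∈ CPA) :
    ∃ w ∈ paths (constraintTree fixed), Red w z := by
  -- Searching through all stages turns `look` into a partial recursive function that returns the
  -- bit enumerated at `q`. A function separating its values 0 and 1 is a completion of the matrix.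
  let look : ℕ → ℕ → Option ℕ := fun q s =>
    ((fixed s).flatMap fun p => if p.1 = q then [p.2] else []).head?
  have hlook : Computable₂ look := by
    refine Primrec.list_head?.to_comp.comp (computable_flatMap (f := fun p : ℕ × ℕ => fixed p.2)
      (g := fun p (q : ℕ × ℕ) => if q.1 = p.1 then [q.2] else []) (hfix.comp Computable.snd) ?_)
    refine (ComputablePred.ite' (ComputablePred.eq' (Computable.fst.comp Computable.snd)
      (Computable.fst.comp Computable.fst)) (Computable.list_cons.comp
        (Computable.snd.comp Computable.snd) (Computable.const [])) (Computable.const [])).of_eq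
        fun p => ?_
    dsimp only
    split_ifs <;> rfl
  have hsome : ∀ q s v, look q s = some v → v = ζ q := by
    intro q s v h
    have := List.mem_of_head? h
    obtain ⟨p, hp, h⟩ := List.mem_flatMap.1 this
    split_ifs at h with hq
    · rw [List.mem_singleton.1 h, ← hq, hζ s p hp]
    · simp at h
  have hdom : ∀ s, ∀ p ∈ fixed s, p.2 ∈ Nat.rfindOpt (look p.1) := by
    intro s p hp
    have h1 : (look p.1 s).isSome := by
      rw [List.isSome_head?]
      exact List.ne_nil_of_mem (a := p.2) (List.mem_flatMap.2 ⟨p, hp, by simp⟩)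
    obtain ⟨v, hv⟩ := Option.isSome_iff_exists.1 h1
    have h2 := Part.get_mem (Nat.rfindOpt_dom.2 ⟨s, v, hv⟩)
    obtain ⟨m, hm⟩ := Nat.rfindOpt_spec h2
    have := hsome _ _ _ hm
    rw [hζ s p hp] at this
    rwa [this] at h2
  obtain ⟨h, hh, hsep⟩ := exists_separation_CPA (Partrec.nat_iff.1 (Partrec.rfindOpt hlook))
  refine ⟨fun q => z (h q), (mem_paths_constraintTree hmono).2
    ⟨fun q => (hsep z hz q).1, fun s p hp => ?_⟩, red_of_comp hh z⟩
  have h2 := hdom s p hp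
  have h3 := hb p.1
  rw [hζ s p hp] at h3
  obtain h0 | h1 : p.2 = 0 ∨ p.2 = 1 := by omega
  · rw [h0] at h2 ⊢
    exact (hsep z hz p.1).2.2 h2
  · rw [h1] at h2 ⊢
    exact (hsep z hz p.1).2.1 h2

/-- The sequence of sets used for both parts of the theorem, together with a tree all of whose paths
compute members of all these sets. -/
theorem exists_sequence : ∃ (T : ℕ → Set (List ℕ)) (K : Set (List ℕ)) (ζ : Baire),
    IsComputableTreeSeq T ∧ IsComputableTree K ∧ (∀ n, col n ζ ∈ paths (T n)) ∧
    (∀ n, ∀ y ∈ paths (T n), ¬ Red y (eraseCol n ζ)) ∧ (paths K).Nonempty ∧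
    (∀ z ∈ paths K, ∀ n, ∃ y ∈ paths (T n), Red y z) ∧
    ∀ z ∈ CPA, ∀ n, ∃ y ∈ paths (T n), Red y z := by
  obtain ⟨fixed, hfix, hmono, ζ, hb, hζ, hind⟩ := exists_independent_matrix
  have hcmono : ∀ n s t, s ≤ t → ∀ p ∈ colFixed fixed n s, p ∈ colFixed fixed n t :=
    fun n s t h p hp => mem_colFixed.2 (hmono s t h _ (mem_colFixed.1 hp))
  have hcol : ∀ w ∈ paths (constraintTree fixed), ∀ n,
      col n w ∈ paths (constraintTree (colFixed fixed n)) := by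
    intro w hw n
    obtain ⟨h1, h2⟩ := (mem_paths_constraintTree hmono).1 hw
    exact (mem_paths_constraintTree (hcmono n)).2
      ⟨fun k => h1 _, fun s p hp => h2 s _ (mem_colFixed.1 hp)⟩
  have hζK : ζ ∈ paths (constraintTree fixed) := (mem_paths_constraintTree hmono).2 ⟨hb, hζ⟩
  -- The paths of `K` are the completions of the whole matrix, so they compute members of all the
  -- classes through their columns.
  refine ⟨fun n => constraintTree (colFixed fixed n), constraintTree fixed, ζ,
    ⟨fun n => isBinaryTree_constraintTree (hcmono n),
      computablePred_constraintTree (computable_colFixed hfix)⟩,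
    ⟨isBinaryTree_constraintTree hmono, ?_⟩, hcol ζ hζK, fun n y hy => ?_, ⟨ζ, hζK⟩,
    fun z hz n => ⟨_, hcol z hz n, col_red n z⟩, fun z hz n => ?_⟩
  · exact (computablePred_constraintTree (L := fun _ => fixed) (hfix.comp Computable.snd)).comp'
      ((Computable.const 0).pair Computable.id)
  · refine hind n y fun s p hp hn => ?_
    refine ((mem_paths_constraintTree (hcmono n)).1 hy).2 s (p.1.unpair.2, p.2) (mem_colFixed.2 ?_)
    rw [← hn, Nat.pair_unpair]
    exact hp
  · obtain ⟨w, hw, hwz⟩ := exists_red_of_mem_CPA hfix hmono hb hζ hz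
    exact ⟨_, hcol w hw n, (col_red n w).trans hwz⟩

end Sequence

/-! ### Records -/

section Records

variable {T : ℕ → Set (List ℕ)} {ζ : Baire}

theorem red_of_computable {f : Baire} (hf : Computable f) (x : Baire) : Red f x := by
  refine red_of_option (G := fun _ k => some (f k)) (Computable.option_some.comp
    (hf.comp Computable.snd)) ?_ ?_
  · intro n k v h
    exact (Option.some.inj h).symm
  · simp

theorem proj_unbounded {f : Baire} {i : ℕ} (h : ∃ᶠ n in atTop, (f n).unpair.1 = i) (k : ℕ) :
    ∃ n, k ≤ (proj i (initSeg f n)).length := by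
  induction k with
  | zero => exact ⟨0, Nat.zero_le _⟩
  | succ k ih =>
    obtain ⟨n, hn⟩ := ih
    obtain ⟨m, hm, hi⟩ := (frequently_atTop.1 h) n
    refine ⟨m + 1, ?_⟩
    rw [initSeg_succ, proj_append, proj_singleton, if_pos hi]
    have := (proj_prefix i (initSeg_prefix f hm)).length_le
    simp
    omega

theorem exists_frequent_tape {f : Baire} {b : ℕ} (h : ∀ n, (f n).unpair.1 < b + 1) :
    ∃ i ≤ b, ∃ᶠ n in atTop, (f n).unpair.1 = i := by
  by_contra hc
  push Not at hc
  have : ∀ᶠ n in atTop, ∀ i ∈ Finset.range (b + 1), (f n).unpair.1 ≠ i := by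
    rw [Filter.eventually_all_finset]
    intro i hi
    exact hc i (by simpa [Nat.lt_succ_iff] using hi)
  obtain ⟨n, hn⟩ := this.exists
  exact hn _ (Finset.mem_range.2 (h n)) rfl

/-- Copying keeps every tape inside its tree. With finitely many tapes some tape is written
infinitely often, and it then receives a whole column of `ζ`. -/
theorem mem_consistentDisjCL_of_copies (hζ : ∀ n, col n ζ ∈ paths (T n)) {f : Baire} {b : ℕ}
    {I : Set ℕ} (hf : ∀ n, Copies ζ (initSeg f n)) (hb : ∀ n, (f n).unpair.1 < b + 1)
    (hI : ∀ i ≤ b, i ∈ I) : f ∈ consistentDisjCL I T := by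
  have hrec : f ∈ records I := fun n => hI _ (Nat.lt_succ_iff.1 (hb n))
  refine ⟨⟨hrec, ?_⟩, hrec, fun i _ n => ?_⟩
  · obtain ⟨i, hi, hfreq⟩ := exists_frequent_tape hb
    refine ⟨i, hI i hi, col i ζ, hζ i, fun k => ?_⟩
    obtain ⟨n, hn⟩ := proj_unbounded hfreq k
    exact ⟨n, (isInit_initSeg _ k).prefix_of_le (hf n i) (by simpa using hn)⟩
  · rw [← hf n i]
    exact hζ i _

theorem initSeg_tag (n : ℕ) (g : Baire) (k : ℕ) :
    initSeg (fun m => Nat.pair n (g m)) k = (initSeg g k).map (Nat.pair n) := by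
  simp [initSeg]

theorem proj_map_pair (i n : ℕ) (σ : List ℕ) :
    proj i (σ.map (Nat.pair n)) = if n = i then σ else [] := by
  induction σ with
  | nil => simp [proj]
  | cons a σ ih =>
    rw [List.map_cons, ← List.singleton_append, proj_append, ih, proj_singleton]
    split_ifs <;> simp_all

theorem tag_mem_consistencySet (hne : ∀ i, [] ∈ T i) {I : Set ℕ} {n : ℕ} (hn : n ∈ I) {g : Baire}
    (hg : g ∈ paths (T n)) : (fun k => Nat.pair n (g k)) ∈ consistencySet I T := by
  refine ⟨fun k => by simpa using hn, fun i _ k => ?_⟩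
  rw [initSeg_tag, proj_map_pair]
  split_ifs with h
  · rw [← h]
    exact hg k
  · exact hne i

theorem tag_mem_consistentDisjCL (hne : ∀ i, [] ∈ T i) {I : Set ℕ} {n : ℕ} (hn : n ∈ I) {g : Baire}
    (hg : g ∈ paths (T n)) : (fun k => Nat.pair n (g k)) ∈ consistentDisjCL I T := by
  have h := tag_mem_consistencySet hne hn hg
  refine ⟨⟨h.1, n, hn, g, hg, fun k => ⟨k, ?_⟩⟩, h⟩
  rw [initSeg_tag, proj_map_pair, if_pos rfl]

theorem redBy_tag (n : ℕ) (g : Baire) :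
    RedBy (fun σ => σ.map (Nat.pair n)) g fun k => Nat.pair n (g k) := by
  refine ⟨fun k => ?_, ?_⟩
  · dsimp only
    rw [← initSeg_tag]
    exact isInit_initSeg _ _
  · simp only [List.length_map, length_initSeg]
    exact tendsto_id

theorem computable_tag : Computable₂ fun n (σ : List ℕ) => σ.map (Nat.pair n) :=
  computable_map (f := fun p : ℕ × List ℕ => p.2) (g := fun p x => Nat.pair p.1 x) Computable.snd
    (computable_pair.comp (Computable.fst.comp Computable.fst) Computable.snd)

theorem redBy_append (ρ : List ℕ) (f : Baire) : RedBy (fun σ => ρ ++ σ) f (concat ρ f) := by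
  refine ⟨fun n => ?_, ?_⟩
  · dsimp only
    rw [← initSeg_concat_add]
    exact isInit_initSeg _ _
  · simp only [List.length_append, length_initSeg]
    exact tendsto_atTop_mono (fun n => Nat.le_add_left n _) tendsto_id

theorem computable_append (ρ : List ℕ) : Computable fun σ : List ℕ => ρ ++ σ :=
  Computable.list_append.comp (Computable.const ρ) Computable.id

theorem red_concat (ρ : List ℕ) (f : Baire) : Red f (concat ρ f) := by
  have := red_of_comp (h := fun k => ρ.length + k)
    (Primrec.nat_add.comp (Primrec.const ρ.length) Primrec.id).to_comp (concat ρ f)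
  simpa only [concat_add] using this

end Records

end MassProblem

namespace MassProblem

/-! ### Disjunctions of a sequence of sets -/

section Disjunctions

variable {T : ℕ → Set (List ℕ)} {ζ : Baire}

theorem nil_mem_of_paths {S : Set (List ℕ)} {f : Baire} (h : f ∈ paths S) : [] ∈ S := h 0

/-- No team learns to find a member of an infinitary concatenation of sets `P n` from a record that
copies an independent matrix. -/
theorem not_reducible_infConcat {C : Set (List ℕ)} (hC : IsBinaryTree C)
    (hleaf : (leaves C).Infinite) {P : ℕ → Set Baire}
    (hP : ∀ n, ∀ y ∈ P n, ¬ Red y (eraseCol n ζ)) (hCP : ∀ z ∈ paths C, ∀ n, ∃ y ∈ P n, Red y z)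
    {S : ℕ → Set Baire} {E : List ℕ → List ℕ} (hE : Computable E)
    (hS : ∀ b f, (∀ n, Copies ζ (initSeg f n)) → (∀ n, (f n).unpair.1 < b + 1) →
      ∃ g ∈ S b, RedBy E f g) :
    ¬ ReducibleVia TeamLearnable (infConcat C P) (infConcat C S) := by
  rintro ⟨Γ, ⟨b, Ψ, hΨ, hteam⟩, hdom⟩
  -- Against `b` learners the inputs are placed above leaf number `b`, where the set `S b` accepts
  -- records on `b + 1` tapes.
  obtain ⟨ρ, hρ⟩ := exists_isNthLeaf hC hleaf b
  refine no_team (P := P) (ζ := ζ) (b := b) (E := fun σ => ρ ++ E σ) (Z := infConcat C P)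
    (Leaf := IsNthLeaf C) (Ψ := Ψ) (In := infConcat C S) hP ((computable_append ρ).comp hE) ?_ ?_ hΨ
    ?_ hdom hteam
  · intro z hz n τ hτ hin
    rcases (mem_infConcat_iff hC).1 hz with hz | ⟨τ', hτ', g, hg, rfl⟩
    · exact (not_prefix_of_mem_paths hz hτ.1 τ.length (by rw [hin])).elim
    · obtain ⟨h1, rfl⟩ := (isNthLeaf_iff hC).1 hτ
      obtain rfl := leaves_eq_of_prefix h1 hτ' (hin.prefix_initSeg (le_max_left _ τ'.length))
        ((isInit_concat τ' g).prefix_initSeg (le_max_right _ _))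
      exact ⟨g, hg, red_concat _ g⟩
  · rintro z (hz | ⟨n, τ, hτ, g, hg, rfl⟩)
    · exact Or.inr (hCP z hz)
    · exact Or.inl ⟨n, τ, hτ, isInit_concat _ _⟩
  · intro f h1 h2
    obtain ⟨g, hg, hfg⟩ := hS b f h1 h2
    exact ⟨concat ρ g, Or.inr ⟨b, ρ, hρ, g, hg, rfl⟩, (redBy_append ρ g).comp hfg⟩

/-- A computable path would compute a member of the class of column 0, which is not computable even
from the other columns of `ζ`. -/
theorem infinite_leaves_of_red {C : Set (List ℕ)} (hC : IsComputableTree C)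
    (hne : (paths C).Nonempty) (hP : ∀ n, ∀ y ∈ paths (T n), ¬ Red y (eraseCol n ζ))
    (hCP : ∀ z ∈ paths C, ∀ n, ∃ y ∈ paths (T n), Red y z) : (leaves C).Infinite := by
  refine infinite_leaves hC hne fun f hf hcomp => ?_
  obtain ⟨y, hy, hyf⟩ := hCP f hf 0
  exact hP 0 y hy (hyf.trans (red_of_computable hcomp _))

/-- After leaf `n`, the given point is written on tape `n` of an otherwise empty record. Strictness
is `not_reducible_infConcat`, since tapes `0, …, b` are exactly those allowed after leaf `b`. -/
theorem infConcat_disj_strictlyBelow (hζ : ∀ n, col n ζ ∈ paths (T n))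
    (hP : ∀ n, ∀ y ∈ paths (T n), ¬ Red y (eraseCol n ζ)) {C : Set (List ℕ)}
    (hC : IsComputableTree C) (hne : (paths C).Nonempty)
    (hCP : ∀ z ∈ paths C, ∀ n, ∃ y ∈ paths (T n), Red y z) :
    StrictlyBelowVia TeamLearnable (infConcat C fun t => consistentDisjCL (Set.Iic t) T)
      (infConcat C fun n => paths (T n)) := by
  refine ⟨teamLearnable_reducible (computable_afterLeaf hC computable_tag) fun g hg =>
    redBy_infConcat hC.1 (fun n y hy => ⟨_, ?_, redBy_tag n y⟩) hg,
    not_reducible_infConcat hC.1 (infinite_leaves_of_red hC hne hP hCP) hP hCP (E := id)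
      Computable.id fun b f h1 h2 => ⟨f, ?_, RedBy.refl f⟩⟩
  · exact tag_mem_consistentDisjCL (fun i => nil_mem_of_paths (hζ i)) (Set.mem_Iic.2 le_rfl) hy
  · exact mem_consistentDisjCL_of_copies hζ h1 h2 fun i hi => hi

/-- The one-letter strings `[n]` take the place of the leaves, and every solution extends one of
them. Since all tapes are allowed, any number of learners can be met with enough columns. -/
theorem disj_strictlyBelow_coproduct (hζ : ∀ n, col n ζ ∈ paths (T n))
    (hP : ∀ n, ∀ y ∈ paths (T n), ¬ Red y (eraseCol n ζ)) :
    StrictlyBelowVia TeamLearnable (consistentDisjCL Set.univ T)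
      (coproduct fun n => paths (T n)) := by
  have hisInit : ∀ {n m : ℕ} {g : Baire}, IsInit [n] (concat [m] g) ↔ n = m := by
    intro n m g
    rw [isInit_iff]
    constructor
    · intro h
      exact h 0 (by simp)
    · rintro rfl k hk
      obtain rfl : k = 0 := by simpa using hk
      rfl
  constructor
  · refine teamLearnable_reducible (F := fun σ => (σ.drop 1).map (Nat.pair (σ.getD 0 0))) ?_ ?_
    · exact computable_tag.comp ((computable_getD 0).comp Computable.id (Computable.const 0))
        (computable_drop.comp (Computable.const 1) Computable.id)
    · rintro g ⟨n, h, hh, rfl⟩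
      refine ⟨_, tag_mem_consistentDisjCL (fun i => nil_mem_of_paths (hζ i)) (Set.mem_univ n) hh, ?_⟩
      have hval : ∀ k, ((initSeg (concat [n] h) (1 + k)).drop 1).map
          (Nat.pair ((initSeg (concat [n] h) (1 + k)).getD 0 0)) =
            (initSeg h k).map (Nat.pair n) := by
        intro k
        have := initSeg_concat_add [n] h k
        rw [List.length_singleton] at this
        rw [this]
        rfl
      refine ⟨fun k => ?_, ?_⟩
      · rcases k with _ | k
        · exact isInit_nil _
        · dsimp only
          rw [add_comm k, hval]
          exact (redBy_tag n h).1 k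
      · refine (tendsto_add_atTop_iff_nat 1).1 ?_
        simp only [add_comm _ 1, hval]
        exact (redBy_tag n h).2
  · rintro ⟨Γ, ⟨b, Ψ, hΨ, hteam⟩, hdom⟩
    refine no_team (P := fun n => paths (T n)) (ζ := ζ) (b := b) (E := id)
      (Z := coproduct fun n => paths (T n)) (Leaf := fun n ρ => ρ = [n]) (Ψ := Ψ)
      (In := consistentDisjCL Set.univ T) hP Computable.id ?_ ?_ hΨ ?_ hdom hteam
    · rintro z ⟨m, g, hg, rfl⟩ n ρ rfl hin
      obtain rfl := hisInit.1 hin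
      exact ⟨g, hg, red_concat _ g⟩
    · rintro z ⟨m, g, hg, rfl⟩
      exact Or.inl ⟨m, [m], rfl, isInit_concat _ _⟩
    · intro f h1 h2
      exact ⟨f, mem_consistentDisjCL_of_copies hζ h1 h2 fun i _ => Set.mem_univ i, RedBy.refl f⟩

end Disjunctions

/-! ### Unary codes of records -/

section Unary

/-- The letter `x` is appended to a unary code; the state consists of the number of `1`s at the end
and the decoded record. -/
def decodeStep (s : ℕ × List ℕ) (x : ℕ) : ℕ × List ℕ :=
  if x = 0 then (0, s.2 ++ [s.1]) else (s.1 + 1, s.2)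

/-- The decoded record, and the number of `1`s at the end of the code. -/
def decodeUnary (σ : List ℕ) : ℕ × List ℕ := σ.foldl decodeStep (0, [])

/-- Every letter `a` of the record is coded by `a` many `1`s followed by a `0`. -/
def encodeUnary (r : List ℕ) : List ℕ := r.flatMap fun a => List.replicate a 1 ++ [0]

theorem computable_decodeUnary : Computable decodeUnary := by
  refine computable_foldl (f := fun σ : List ℕ => σ) (g := fun _ => (0, []))
    (h := fun _ p => decodeStep p.1 p.2) Computable.id (Computable.const _) ?_
  have h1 : Primrec fun p : List ℕ × (ℕ × List ℕ) × ℕ => p.2.1.1 :=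
    Primrec.fst.comp (Primrec.fst.comp Primrec.snd)
  have h2 : Primrec fun p : List ℕ × (ℕ × List ℕ) × ℕ => p.2.1.2 :=
    Primrec.snd.comp (Primrec.fst.comp Primrec.snd)
  have := Primrec.ite (Primrec.eq.comp (Primrec.snd.comp Primrec.snd :
      Primrec fun p : List ℕ × (ℕ × List ℕ) × ℕ => p.2.2) (Primrec.const 0))
    ((Primrec.const 0).pair (Primrec.list_concat.comp h2 h1)) ((Primrec.succ.comp h1).pair h2)
  exact this.to_comp

theorem computable_encodeUnary : Computable encodeUnary := by
  refine computable_flatMap (f := fun σ : List ℕ => σ)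
    (g := fun _ a => List.replicate a 1 ++ [0]) Computable.id ?_
  have hrep : Computable fun a : ℕ => List.replicate a 1 :=
    (computable_map (f := fun a : ℕ => List.range a) (g := fun _ _ => 1)
      Primrec.list_range.to_comp (Computable.const 1)).of_eq fun a => by simp
  exact Computable.list_concat.comp (hrep.comp Computable.snd) (Computable.const 0)

theorem decodeUnary_append_singleton (σ : List ℕ) (x : ℕ) :
    decodeUnary (σ ++ [x]) = decodeStep (decodeUnary σ) x := by
  simp [decodeUnary]

theorem decodeUnary_mono {σ τ : List ℕ} (h : σ <+: τ) :
    (decodeUnary σ).2 <+: (decodeUnary τ).2 := by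
  obtain ⟨ρ, rfl⟩ := h
  induction ρ using List.reverseRecOn with
  | nil => simp
  | append_singleton ρ x ih =>
    rw [← List.append_assoc, decodeUnary_append_singleton, decodeStep]
    split_ifs
    · exact ih.trans (List.prefix_append _ _)
    · exact ih

theorem decodeUnary_encodeUnary_append (r : List ℕ) (j : ℕ) :
    decodeUnary (encodeUnary r ++ List.replicate j 1) = (j, r) := by
  have h0 : ∀ r, decodeUnary (encodeUnary r) = (0, r) → ∀ j,
      decodeUnary (encodeUnary r ++ List.replicate j 1) = (j, r) := by
    intro r hr j
    induction j with
    | zero => simpa using hr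
    | succ j ih =>
      rw [List.replicate_succ', ← List.append_assoc, decodeUnary_append_singleton, ih]
      rfl
  refine h0 r ?_ j
  induction r using List.reverseRecOn with
  | nil => rfl
  | append_singleton r a ih =>
    have : encodeUnary (r ++ [a]) = encodeUnary r ++ List.replicate a 1 ++ [0] := by
      simp [encodeUnary]
    rw [this, decodeUnary_append_singleton, h0 r ih]
    rfl

theorem encodeUnary_mono {r s : List ℕ} (h : r <+: s) : encodeUnary r <+: encodeUnary s := by
  obtain ⟨t, rfl⟩ := h
  rw [encodeUnary, encodeUnary, List.flatMap_append]
  exact List.prefix_append _ _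

theorem length_le_length_encodeUnary (r : List ℕ) : r.length ≤ (encodeUnary r).length := by
  induction r with
  | nil => simp
  | cons a r ih =>
    rw [encodeUnary, List.flatMap_cons, ← encodeUnary]
    simp
    omega

theorem encodeUnary_lt (r : List ℕ) : ∀ x ∈ encodeUnary r, x < 2 := by
  intro x hx
  obtain ⟨a, _, h⟩ := List.mem_flatMap.1 hx
  rcases List.mem_append.1 h with h | h
  · rw [(List.mem_replicate.1 h).2]
    norm_num
  · rw [List.mem_singleton.1 h]
    norm_num

/-- A prefix of a unary code is the unary code of a prefix of the record, followed by `1`s. -/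
theorem decodeUnary_of_prefix {σ r : List ℕ} (h : σ <+: encodeUnary r) :
    (decodeUnary σ).2 <+: r ∧ ((decodeUnary σ).1 = 0 ∨ ∃ a ∈ r, (decodeUnary σ).1 ≤ a) := by
  have h1 : (decodeUnary σ).2 <+: r := by
    have := decodeUnary_mono h
    have h2 := decodeUnary_encodeUnary_append r 0
    rw [List.replicate_zero, List.append_nil] at h2
    rwa [h2] at this
  refine ⟨h1, ?_⟩
  induction r using List.reverseRecOn with
  | nil =>
    obtain rfl : σ = [] := by simpa [encodeUnary] using h
    exact Or.inl rfl
  | append_singleton r a ih =>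
    have he : encodeUnary (r ++ [a]) = encodeUnary r ++ (List.replicate a 1 ++ [0]) := by
      simp [encodeUnary]
    rw [he] at h
    rcases le_or_gt σ.length (encodeUnary r).length with hl | hl
    · have hp := List.prefix_of_prefix_length_le h (List.prefix_append _ _) hl
      have h2 := decodeUnary_mono hp
      have h3 := decodeUnary_encodeUnary_append r 0
      rw [List.replicate_zero, List.append_nil] at h3
      rw [h3] at h2
      rcases ih hp h2 with h | ⟨c, hc, h⟩
      · exact Or.inl h
      · exact Or.inr ⟨c, List.mem_append_left _ hc, h⟩
    · obtain ⟨τ, rfl⟩ := List.prefix_of_prefix_length_le (List.prefix_append _ _) h hl.le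
      have hτ := (List.prefix_append_right_inj _).1 h
      rcases List.prefix_concat_iff.1 hτ with rfl | hτ
      · left
        have := decodeUnary_encodeUnary_append (r ++ [a]) 0
        rw [List.replicate_zero, List.append_nil, he] at this
        rw [this]
      · obtain ⟨h1, h2⟩ := List.prefix_replicate_iff.1 hτ
        refine Or.inr ⟨a, by simp, ?_⟩
        rw [h2, decodeUnary_encodeUnary_append]
        exact h1

end Unary

end MassProblem

namespace MassProblem

/-! ### Compact disjunctions -/

section CodeTree

variable {T : ℕ → Set (List ℕ)} {ζ : Baire}

/-- The tree of the unary codes of records which are consistent with `T 0, …, T t`. -/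
def codeTree (T : ℕ → Set (List ℕ)) (t : ℕ) : Set (List ℕ) :=
  {σ | (∀ x ∈ σ, x < 2) ∧ ∀ k < σ.length + 1, (decodeUnary (σ.take k)).1 ≤ Nat.pair t 1 ∧
    (∀ a ∈ (decodeUnary (σ.take k)).2, a.unpair.1 < t + 1) ∧
      ∀ i < t + 1, proj i (decodeUnary (σ.take k)).2 ∈ T i}

theorem isBinaryTree_codeTree (t : ℕ) : IsBinaryTree (codeTree T t) := by
  refine ⟨fun σ hσ => hσ.1, ?_⟩
  rintro σ ⟨h1, h2⟩ τ ⟨ρ, rfl⟩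
  refine ⟨fun x hx => h1 x (List.mem_append_left _ hx), fun k hk => ?_⟩
  have := h2 k (by rw [List.length_append]; omega)
  rwa [List.take_append_of_le_length (by omega)] at this

theorem isComputableTreeSeq_codeTree (hT : IsComputableTreeSeq T) :
    IsComputableTreeSeq (codeTree T) := by
  refine ⟨isBinaryTree_codeTree, ComputablePred.and' ?_ ?_⟩
  · exact ComputablePred.ball_list (p := fun (_ : ℕ × List ℕ) x => x < 2)
      (ComputablePred.lt' Computable.snd (Computable.const 2)) Computable.snd
  · have hdec : Computable fun p : (ℕ × List ℕ) × ℕ => decodeUnary (p.1.2.take p.2) :=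
      computable_decodeUnary.comp (computable_take.comp Computable.snd
        (Computable.snd.comp Computable.fst))
    have ht : Computable fun p : (ℕ × List ℕ) × ℕ => p.1.1 := Computable.fst.comp Computable.fst
    refine ComputablePred.ball_lt (p := fun (p : ℕ × List ℕ) k =>
      (decodeUnary (p.2.take k)).1 ≤ Nat.pair p.1 1 ∧
      (∀ a ∈ (decodeUnary (p.2.take k)).2, a.unpair.1 < p.1 + 1) ∧
        ∀ i < p.1 + 1, proj i (decodeUnary (p.2.take k)).2 ∈ T i)
      (ComputablePred.and' ?_ (ComputablePred.and' ?_ ?_))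
      (Computable.succ.comp (Computable.list_length.comp Computable.snd))
    · exact ComputablePred.le' (Computable.fst.comp hdec)
        (computable_pair.comp ht (Computable.const 1))
    · exact ComputablePred.ball_list (p := fun (p : (ℕ × List ℕ) × ℕ) a =>
        a.unpair.1 < p.1.1 + 1) (ComputablePred.lt' (computable_unpair_fst.comp Computable.snd)
          (Computable.succ.comp (ht.comp Computable.fst))) (Computable.snd.comp hdec)
    · exact ComputablePred.ball_lt (p := fun (p : (ℕ × List ℕ) × ℕ) i =>
        proj i (decodeUnary (p.1.2.take p.2)).2 ∈ T i) (hT.2.comp' (Computable.snd.pair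
          (computable_proj.comp Computable.snd (Computable.snd.comp
            (hdec.comp Computable.fst))))) (Computable.succ.comp ht)

/-- This is the source of the bound in `codeTree`: a letter of a consistent record names a tape up
to `t` and writes a bit, so its unary code has at most `Nat.pair t 1` ones. -/
theorem le_pair_one {a t : ℕ} (h1 : a.unpair.1 ≤ t) (h2 : a.unpair.2 < 2) : a ≤ Nat.pair t 1 := by
  have h3 : a ≤ Nat.pair t a.unpair.2 := by
    conv_lhs => rw [← Nat.pair_unpair a]
    rcases h1.eq_or_lt with h | h
    · rw [h]
    · exact (Nat.pair_lt_pair_left _ h).le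
  refine h3.trans ?_
  rcases (Nat.lt_succ_iff.1 h2).eq_or_lt with h | h
  · rw [h]
  · exact (Nat.pair_lt_pair_right _ h).le

theorem encodeUnary_mem_codeTree (hT : ∀ n, IsBinaryTree (T n)) {t : ℕ} {r : List ℕ}
    (h1 : ∀ a ∈ r, a.unpair.1 ≤ t) (h2 : ∀ i ≤ t, proj i r ∈ T i) :
    encodeUnary r ∈ codeTree T t := by
  refine ⟨encodeUnary_lt r, fun k _ => ?_⟩
  obtain ⟨h3, h4⟩ := decodeUnary_of_prefix (List.take_prefix k (encodeUnary r))
  refine ⟨?_, fun a ha => Nat.lt_succ_of_le (h1 a (h3.subset ha)), fun i hi =>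
    (hT i).2 _ (h2 i (Nat.lt_succ_iff.1 hi)) _ (proj_prefix i h3)⟩
  rcases h4 with h4 | ⟨a, ha, h4⟩
  · rw [h4]
    exact Nat.zero_le _
  · refine h4.trans (le_pair_one (h1 a ha) ((hT _).1 _ (h2 _ (h1 a ha)) _ ?_))
    exact List.mem_map.2 ⟨a, List.mem_filter.2 ⟨ha, by simp⟩, rfl⟩

theorem exists_code (hT : ∀ n, IsBinaryTree (T n)) {t : ℕ} {f : Baire}
    (hf : f ∈ consistencySet (Set.Iic t) T) : ∃ g ∈ paths (codeTree T t), RedBy encodeUnary f g := by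
  have hlen : Tendsto (fun n => (encodeUnary (initSeg f n)).length) atTop atTop :=
    tendsto_atTop_mono (fun n => by simpa using length_le_length_encodeUnary (initSeg f n))
      tendsto_id
  obtain ⟨g, hg⟩ := exists_limit (s := fun n => encodeUnary (initSeg f n))
    (fun n => encodeUnary_mono (initSeg_prefix f n.le_succ)) hlen
  refine ⟨g, fun n => ?_, hg, hlen⟩
  have hn : n ≤ (encodeUnary (initSeg f n)).length := by
    simpa using length_le_length_encodeUnary (initSeg f n)
  have hmem : encodeUnary (initSeg f n) ∈ codeTree T t := by
    refine encodeUnary_mem_codeTree hT (fun a ha => ?_) fun i hi => hf.2 i hi n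
    obtain ⟨k, -, rfl⟩ := List.mem_map.1 ha
    exact hf.1 k
  exact (isBinaryTree_codeTree t).2 _ hmem _ ((isInit_initSeg g n).prefix_of_le (hg n) (by simpa using hn))

/-- The bound on blocks of ones prevents a path from ending in ones forever, so every path codes an
infinite record. -/
theorem decodeUnary_unbounded {t : ℕ} {g : Baire} (hg : g ∈ paths (codeTree T t)) (m : ℕ) :
    ∃ n, m ≤ (decodeUnary (initSeg g n)).2.length := by
  by_contra hc
  push Not at hc
  have hmono : ∀ n, (decodeUnary (initSeg g n)).2.length ≤
      (decodeUnary (initSeg g (n + 1))).2.length := fun n =>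
    (decodeUnary_mono (initSeg_prefix g n.le_succ)).length_le
  -- Each decoded letter accounts for at most `Nat.pair t 1 + 1` symbols, its ones and the final 0;
  -- the remaining symbols are the pending ones.
  have hp : ∀ n, n ≤ (decodeUnary (initSeg g n)).2.length * (Nat.pair t 1 + 1) +
      (decodeUnary (initSeg g n)).1 := by
    intro n
    induction n with
    | zero => exact Nat.zero_le _
    | succ n ih =>
      have hB : (decodeUnary (initSeg g n)).1 ≤ Nat.pair t 1 := by
        have := ((hg n).2 n (by simp)).1
        rwa [take_initSeg, min_self] at this
      rw [initSeg_succ, decodeUnary_append_singleton, decodeStep]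
      split_ifs
      · simp only [List.length_append, List.length_singleton, add_mul]
        omega
      · dsimp only
        omega
  have h1 := hp (m * (Nat.pair t 1 + 1) + Nat.pair t 1 + 1)
  set N := m * (Nat.pair t 1 + 1) + Nat.pair t 1 + 1
  have hB : (decodeUnary (initSeg g N)).1 ≤ Nat.pair t 1 := by
    have := ((hg N).2 N (by simp)).1
    rwa [take_initSeg, min_self] at this
  have h2 := Nat.mul_le_mul_right (Nat.pair t 1 + 1) (hc N).le
  omega

/-- Among finitely many tapes one is written infinitely often, and consistency makes its content a
path of the corresponding tree. The tape depends on `g`, so this reduction is only nonuniform. -/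
theorem exists_red_of_code (hT : ∀ n, IsBinaryTree (T n)) {t : ℕ} {g : Baire}
    (hg : g ∈ paths (codeTree T t)) : ∃ i, ∃ y ∈ paths (T i), Red y g := by
  have hpre : ∀ {m n}, m ≤ n →
      (decodeUnary (initSeg g m)).2 <+: (decodeUnary (initSeg g n)).2 := fun h =>
    decodeUnary_mono (initSeg_prefix g h)
  have hmem : ∀ n, (∀ a ∈ (decodeUnary (initSeg g n)).2, a.unpair.1 < t + 1) ∧
      ∀ i < t + 1, proj i (decodeUnary (initSeg g n)).2 ∈ T i := by
    intro n
    have := ((hg n).2 n (by simp)).2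
    rwa [take_initSeg, min_self] at this
  obtain ⟨f, hf⟩ := exists_limit (s := fun n => (decodeUnary (initSeg g n)).2)
    (fun n => hpre n.le_succ) (tendsto_atTop_atTop.2 fun m => by
      obtain ⟨n, hn⟩ := decodeUnary_unbounded hg m
      exact ⟨n, fun k hk => hn.trans (hpre hk).length_le⟩)
  have hfin : ∀ m, ∃ n, initSeg f m <+: (decodeUnary (initSeg g n)).2 := by
    intro m
    obtain ⟨n, hn⟩ := decodeUnary_unbounded hg m
    exact ⟨n, (isInit_initSeg f m).prefix_of_le (hf n) (by simpa using hn)⟩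
  obtain ⟨i, hi, hfreq⟩ := exists_frequent_tape (f := f) (b := t) fun m => by
    obtain ⟨n, hn⟩ := hfin (m + 1)
    refine (hmem n).1 _ (hn.subset ?_)
    rw [initSeg_succ]
    simp
  have hlen : Tendsto (fun n => (proj i (decodeUnary (initSeg g n)).2).length) atTop atTop := by
    refine tendsto_atTop_atTop.2 fun k => ?_
    obtain ⟨m, hm⟩ := proj_unbounded hfreq k
    obtain ⟨n, hn⟩ := hfin m
    exact ⟨n, fun l hl => hm.trans (proj_prefix i (hn.trans (hpre hl))).length_le⟩
  obtain ⟨y, hy⟩ := exists_limit (s := fun n => proj i (decodeUnary (initSeg g n)).2)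
    (fun n => proj_prefix i (hpre n.le_succ)) hlen
  refine ⟨i, y, fun k => ?_, fun σ => proj i (decodeUnary σ).2, computable_proj.comp
    (Computable.const i) (Computable.snd.comp computable_decodeUnary), hy, hlen⟩
  obtain ⟨n, hn⟩ := (hlen.eventually (eventually_ge_atTop k)).exists
  exact (hT i).2 _ ((hmem n).2 i (Nat.lt_succ_of_le hi)) _
    ((isInit_initSeg y k).prefix_of_le (hy n) (by simpa using hn))

end CodeTree

theorem nonuniformlyComputable_reducible {P Q : Set Baire} (h : ∀ g ∈ Q, ∃ y ∈ P, Red y g) :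
    ReducibleVia NonuniformlyComputable P Q := by
  choose! y hy using h
  refine ⟨fun g => ⟨g ∈ Q, fun _ => y g⟩, ?_, fun g hg => ⟨y g, ⟨hg, rfl⟩, (hy g hg).1⟩⟩
  rintro g _ ⟨hg, rfl⟩
  exact turingReducible_of_red (hy g hg).2

/-- Nonuniform equivalence does not imply equivalence with respect to teams, even for nonempty
effectively closed sets. -/
theorem exists_nonuniform_equivalent {T : ℕ → Set (List ℕ)} {K : Set (List ℕ)} {ζ : Baire}
    (hT : IsComputableTreeSeq T) (hK : IsComputableTree K) (hζ : ∀ n, col n ζ ∈ paths (T n))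
    (hP : ∀ n, ∀ y ∈ paths (T n), ¬ Red y (eraseCol n ζ)) (hne : (paths K).Nonempty)
    (hKP : ∀ z ∈ paths K, ∀ n, ∃ y ∈ paths (T n), Red y z) :
    ∃ P Q : Set Baire, IsPi01 P ∧ IsPi01 Q ∧ P.Nonempty ∧ Q.Nonempty ∧
      EquivalentVia NonuniformlyComputable P Q ∧ StrictlyBelowVia TeamLearnable P Q := by
  have hnil : ∀ i, [] ∈ T i := fun i => nil_mem_of_paths (hζ i)
  have hinf := infinite_leaves_of_red hK hne hP hKP
  have htag : Computable₂ fun n (σ : List ℕ) => encodeUnary (σ.map (Nat.pair n)) :=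
    computable_encodeUnary.comp computable_tag
  have hfwd : ∀ g ∈ infConcat K fun n => paths (T n), ∃ y ∈ infConcat K fun t => paths (codeTree T t),
      RedBy (afterLeaf K fun n σ => encodeUnary (σ.map (Nat.pair n))) g y := fun g hg => by
    refine redBy_infConcat hK.1 (fun n y hy => ?_) hg
    obtain ⟨g, hg, hyg⟩ := exists_code hT.1
      (tag_mem_consistencySet hnil (Set.mem_Iic.2 (le_refl n)) hy)
    exact ⟨g, hg, hyg.comp (redBy_tag n y)⟩
  obtain ⟨z, hz⟩ := hne
  refine ⟨infConcat K fun t => paths (codeTree T t), infConcat K fun n => paths (T n),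
    ⟨_, isComputableTree_infConcatTree hK (isComputableTreeSeq_codeTree hT),
      paths_infConcatTree hK.1 (isComputableTreeSeq_codeTree hT).1⟩,
    ⟨_, isComputableTree_infConcatTree hK hT, paths_infConcatTree hK.1 hT.1⟩,
    ⟨z, Or.inl hz⟩, ⟨z, Or.inl hz⟩, ⟨nonuniformlyComputable_reducible fun g hg => ?_,
      nonuniformlyComputable_reducible ?_⟩,
    teamLearnable_reducible (computable_afterLeaf hK htag) hfwd,
    not_reducible_infConcat hK.1 hinf hP hKP computable_encodeUnary fun b f h1 h2 => ?_⟩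
  · obtain ⟨y, hy, h⟩ := hfwd g hg
    exact ⟨y, hy, _, computable_afterLeaf hK htag, h⟩
  · rintro f (hf | ⟨t, ρ, hρ, g, hg, rfl⟩)
    · exact ⟨f, Or.inl hf, Red.refl f⟩
    · obtain ⟨i, y, hy, hyg⟩ := exists_red_of_code hT.1 hg
      obtain ⟨τ, hτ⟩ := exists_isNthLeaf hK.1 hinf i
      have hred : Red (concat τ y) y := ⟨_, computable_append τ, redBy_append τ y⟩
      exact ⟨_, Or.inr ⟨i, τ, hτ, y, hy, rfl⟩, hred.trans (hyg.trans (red_concat ρ g))⟩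
  -- Unary coding turns the records used against the team into points of the compact class, so the
  -- argument against teams applies with `encodeUnary` as the coding.
  · exact exists_code hT.1 (mem_consistentDisjCL_of_copies hζ h1 h2 fun i hi => hi).2

end MassProblem

/-! ### Both parts of the theorem. -/

theorem mainTheorem12 :
    -- a computable sequence of sets, which works for all choices of the corresponding trees
    (∃ P : ℕ → Set Baire, IsPi01Seq P ∧ (∀ n, (P n).Nonempty) ∧
      ∀ T : ℕ → Set (List ℕ), IsComputableTreeSeq T → (∀ n, paths (T n) = P n) →
        -- the recursive meets, formed with any computable tree of the set `CPA`
        (∀ C : Set (List ℕ), IsComputableTree C → paths C = CPA →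
          StrictlyBelowVia TeamLearnable
            (infConcat C fun t => consistentDisjCL (Set.Iic t) T) (infConcat C P)) ∧
        StrictlyBelowVia TeamLearnable (consistentDisjCL Set.univ T) (coproduct P)) ∧
    ∃ P Q : Set Baire, IsPi01 P ∧ IsPi01 Q ∧ P.Nonempty ∧ Q.Nonempty ∧
      EquivalentVia NonuniformlyComputable P Q ∧ StrictlyBelowVia TeamLearnable P Q := by
  obtain ⟨T₀, K, ζ, hT₀, hK, hζ, hP, hne, hKP, hCPA⟩ := exists_sequence
  refine ⟨⟨fun n => paths (T₀ n), ⟨T₀, hT₀, fun _ => rfl⟩, fun n => ⟨_, hζ n⟩, fun T _ hTP => ?_⟩,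
    exists_nonuniform_equivalent hT₀ hK hζ hP hne hKP⟩
  -- The facts used about the sequence concern only the sets of paths, so they hold for every choice
  -- of the trees.
  simp only [← hTP] at hζ hP hCPA ⊢
  refine ⟨fun C hC hCC => infConcat_disj_strictlyBelow hζ hP hC ?_ ?_,
    disj_strictlyBelow_coproduct hζ hP⟩
  · rw [hCC]
    exact nonempty_CPA
  · rw [hCC]
    exact hCPA
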